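/- Fix $\lambda>0$ and two probability laws on $[0,\infty)$, the law of the service time $H$ and the law of the vacation time $V$, with $P(V=0)<1$. Packets are generated at the epochs of a Poisson process of rate $\lambda$ and are sent to a single server at once; service times are i.i.d. copies of $H$, vacations are i.i.d. copies of $V$, and arrivals, services and vacations are independent. In the \emph{Buffer Relaxation System} (BRS, gated buffer) the buffer holds one packet, a new packet replaces the one in the buffer, and the buffer becomes available (empty) as soon as a service starts. After each service completion the server takes a vacation, whether or not the buffer is empty; on return from a vacation it serves the packet in the buffer if there is one, and otherwise takes another vacation. At time $0$ the buffer is empty, a vacation starts, and the age is some constant $a\ge0$. Let $S_l$, $C_l$, $r_l$ be the start of service, the completion time and the generation time of the $l$-th served packet ($l=0,1,\dots$), and put $G_l=S_l-r_l$, $I_{l+1}=S_{l+1}-S_l$ (the regenerative cycle), $A_{l+1}=C_{l+1}-r_l$ (the age peak), and $\Delta(t)=t-\max\left(\{-a\}\cup\{r_l:C_l\le t\}\right)$ (the age). For $s\ge 0$ write $H^*(s)=E[e^{-sH}]$, $V^*(s)=E[e^{-sV}]$; $X^{*(n)}$ denotes the $n$-th derivative, one-sided at $0$. \textbf{(i)}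 For every $l\ge0$ and $s\ge0$, $E[e^{-sI_{l+1}}]=I^*(s)$, where $$I^*(s)=H^*(s)V^*(s)+H^*(\lambda+s)\,\frac{V^*(s+\lambda)\,(V^*(s)-1)}{1-V^*(s+\lambda)}.$$ \textbf{(ii)} Every $G_l$ is integrable, and for every $l\ge1$, $$E[G_l]=\frac1\lambda+V^{*(1)}(\lambda)H^*(\lambda)+V^*(\lambda)H^{*(1)}(\lambda)+\frac{V^{*(1)}(\lambda)}{1-V^*(\lambda)}V^*(\lambda)H^*(\lambda).$$ \textbf{(iii)} If $E[H],E[V]<\infty$, then $H^*$ and $V^*$ are differentiable on $[0,\infty)$, the peaks are integrable, and the PAoI, i.e. both $\lim_{l\to\infty}E[A_l]$ and the almost sure limit $\lim_{k\to\infty}\frac1k\sum_{l=1}^kA_l$, exists and equals $$E[A_{BRS}]=-2H^{*(1)}(0)-V^{*(1)}(0)+\frac1\lambda+V^{*(1)}(\lambda)H^*(\lambda)+V^*(\lambda)H^{*(1)}(\lambda)+\frac{H^*(\lambda)V^*(\lambda)}{1-V^*(\lambda)}\left(V^{*(1)}(\lambda)-V^{*(1)}(0)\right).$$ \textbf{(iv)}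 If $E[H^2],E[V^2]<\infty$, then $I^*$ is twice continuously differentiable on $[0,\infty)$, $\Delta(t)$ is integrable for every $t\ge 0$, and, with $$E[\Delta_{BRS}]=\frac{-I^{*(2)}(0)}{2I^{*(1)}(0)}+V^{*(1)}(\lambda)H^*(\lambda)+V^*(\lambda)H^{*(1)}(\lambda)+\frac{V^{*(1)}(\lambda)}{1-V^*(\lambda)}V^*(\lambda)H^*(\lambda)+\frac1\lambda-H^{*(1)}(0),$$ the AoI equals $E[\Delta_{BRS}]$ in the following senses: almost surely $\frac1T\int_0^T\Delta(t)\,dt\to E[\Delta_{BRS}]$ as $T\to\infty$; $\frac1T\int_0^TE[\Delta(t)]\,dt\to E[\Delta_{BRS}]$; and whenever $\lim_{t\to\infty}E[\Delta(t)]$ exists (as it does under the ergodicity assumption in the definition of AoI) it equals $E[\Delta_{BRS}]$. -/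

import Mathlib

open MeasureTheory ProbabilityTheory Filter Topology Set

noncomputable section

namespace BRS

/-! ### Sample-path dynamics of the Buffer Relaxation System

The inputs of a sample path are the inter-arrival times `X n` of the data packets, the service
times `H l` of the packets that are served (numbered from `0` in the order of service), and the
vacations: `V l j` is the `j`-th vacation taken between the service of the packet `l - 1` and the
service of the packet `l` (before the service of the first packet if `l = 0`).  At time `0` the
buffer is empty and the server starts a vacation. -/

/-- Generation (arrival) time of the `n`-th packet that the source generates. -/
def arrival (X : ℕ → ℝ) (n : ℕ) : ℝ := ∑ i ∈ Finset.range (n + 1), X i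

/-- End of the `j`-th of the successive vacations `v 0, v 1, …` started at time `u`. -/
def vacationEnd (v : ℕ → ℝ) (u : ℝ) (j : ℕ) : ℝ := u + ∑ i ∈ Finset.range (j + 1), v i

/-- Multiple vacation scheme.  The buffer has been emptied and made available at time `o`, and
vacations start at time `u`.  This is the time of the first return from a vacation at which the
server finds a packet in the buffer, i.e. at which some packet has arrived after `o`. -/
def nextStart (X v : ℕ → ℝ) (o u : ℝ) : ℝ :=
  vacationEnd v u (sInf {j : ℕ | ∃ n, arrival X n ∈ Ioc o (vacationEnd v u j)})

/-- `serviceStart X H V l` is the time `S_l` at which the service of packet `l` starts.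
The buffer is available again from `S_l` on, and after the completion of packet `l`, at time
`S_l + H_l`, the server takes vacations, at least one of them. -/
def serviceStart (X H : ℕ → ℝ) (V : ℕ → ℕ → ℝ) : ℕ → ℝ
  | 0 => nextStart X (V 0) 0 0
  | l + 1 => nextStart X (V (l + 1)) (serviceStart X H V l) (serviceStart X H V l + H l)

/-- The time at which the buffer becomes available for the packets among which packet `l` is. -/
def bufferOpen (X H : ℕ → ℝ) (V : ℕ → ℕ → ℝ) : ℕ → ℝ
  | 0 => 0
  | l + 1 => serviceStart X H V l

/-- Generation time `r_l` of the served packet `l`: the freshest of the packets that have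
arrived since the buffer became available. -/
def genTime (X H : ℕ → ℝ) (V : ℕ → ℕ → ℝ) (l : ℕ) : ℝ :=
  sSup {x : ℝ | x ∈ Ioc (bufferOpen X H V l) (serviceStart X H V l) ∧ ∃ n, arrival X n = x}

/-- Completion time `C_l` of the served packet `l`. -/
def completion (X H : ℕ → ℝ) (V : ℕ → ℕ → ℝ) (l : ℕ) : ℝ := serviceStart X H V l + H l

/-- Waiting time `G_l` of the served packet `l`. -/
def waiting (X H : ℕ → ℝ) (V : ℕ → ℕ → ℝ) (l : ℕ) : ℝ :=
  serviceStart X H V l - genTime X H V l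

/-- Regenerative cycle: time between the starts of service of packets `l` and `l + 1`. -/
def cycle (X H : ℕ → ℝ) (V : ℕ → ℕ → ℝ) (l : ℕ) : ℝ :=
  serviceStart X H V (l + 1) - serviceStart X H V l

/-- Age peak at the completion of packet `l + 1`: the value that the age reaches at that moment,
just before it drops, i.e. the time elapsed since the generation of packet `l`. -/
def peakAge (X H : ℕ → ℝ) (V : ℕ → ℕ → ℝ) (l : ℕ) : ℝ :=
  completion X H V (l + 1) - genTime X H V l

/-- The age `Δ(t) = t - max {r_l : C_l ≤ t}`, where `a` is the age at time `0` (an initial update,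
generated at time `-a`, is in force until the first completion). -/
def age (a : ℝ) (X H : ℕ → ℝ) (V : ℕ → ℕ → ℝ) (t : ℝ) : ℝ :=
  t - sSup (insert (-a) {r : ℝ | ∃ l, completion X H V l ≤ t ∧ genTime X H V l = r})

/-! ### Transforms and closed forms -/

/-- Laplace–Stieltjes transform `s ↦ ∫ e^{-s x} dν(x)` of a law `ν` on the line. -/
def lst (ν : Measure ℝ) (s : ℝ) : ℝ := ∫ x, Real.exp (-(s * x)) ∂ν

/-- First derivative at `0` of a function on `[0, ∞)`. -/
def deriv₀ (f : ℝ → ℝ) : ℝ := derivWithin f (Ici 0) 0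

/-- Second derivative at `0` of a function on `[0, ∞)`. -/
def secondDeriv₀ (f : ℝ → ℝ) : ℝ := iteratedDerivWithin 2 f (Ici 0) 0

/-- Closed form of the transform `I*(s)` of the regenerative cycle, from `H*` and `V*`. -/
def cycleLST (lam : ℝ) (Hs Vs : ℝ → ℝ) (s : ℝ) : ℝ :=
  Hs s * Vs s + Hs (lam + s) * (Vs (s + lam) * (Vs s - 1) / (1 - Vs (s + lam)))

/-- Closed form of the mean waiting time `E[G]`. -/
def meanWaiting (lam : ℝ) (Hs Vs : ℝ → ℝ) : ℝ :=
  1 / lam + deriv Vs lam * Hs lam + Vs lam * deriv Hs lam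
    + deriv Vs lam / (1 - Vs lam) * Vs lam * Hs lam

/-- Closed form of the AoI. -/
def aoi (lam : ℝ) (Hs Vs : ℝ → ℝ) : ℝ :=
  -secondDeriv₀ (cycleLST lam Hs Vs) / (2 * deriv₀ (cycleLST lam Hs Vs))
    + deriv Vs lam * Hs lam + Vs lam * deriv Hs lam
    + deriv Vs lam / (1 - Vs lam) * Vs lam * Hs lam + 1 / lam - deriv₀ Hs

/-- Closed form of the PAoI. -/
def paoi (lam : ℝ) (Hs Vs : ℝ → ℝ) : ℝ :=
  -2 * deriv₀ Hs - deriv₀ Vs + 1 / lam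
    + deriv Vs lam * Hs lam + Vs lam * deriv Hs lam
    + Hs lam * Vs lam / (1 - Vs lam) * (deriv Vs lam - deriv₀ Vs)

end BRS

end

namespace BRS

open scoped ENNReal

set_option linter.unusedSectionVars false

noncomputable section

/-! Call the time between two consecutive starts of service a cycle. Its length `I`, and the waiting
time `G` of the packet served at its end, depend on the service that opens the cycle, the vacations
that follow it and the arrivals up to its end. The gap in progress at the end of the cycle is
exponential, so its remaining part is again exponential and independent of the past: the inputs left
over are a fresh copy, independent of the cycle (`measure_next`). All cycles of a path are therefore
read off by iterating one shift `next`. The initial vacation period counts as a cycle opened by an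
artificial service of length 0. The opening service thus has a law `κ` of its own, the point mass at
0 for the first cycle and `νH` for all later ones; this is why the formula for the mean of `G`
starts at the second packet.

Transform. Let `W_j` be the end of vacation `j` and `X_0` the first gap. The cycle is `W_J`, with
`J` the first `j` such that `X_0 ≤ W_j`, and given the vacations and the opening service, `J > j`
has probability `exp (-λ W_j)`. Hence `exp (-s I)` is `exp (-s W_0)` minus the increments `exp (-s
W_j) - exp (-s W_{j+1})` over `j < J`, and taking means leaves a geometric series
(`integral_exp_firstCycle`).

Waiting time. `G ≥ x` means that something has arrived by `I - x` and nothing in `(I - x, I]`, so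
`P(G ≥ x) = exp (-λ x) P(I - X_0 ≥ x)` and `E G = (1 - E exp (-λ (I - X_0))) / λ`. The last mean is
found by splitting according to the vacation at whose end the cycle stops (`integral_firstWait`).

Moments. The closed form of the transform is differentiable at 0 as often as needed. By Fatou's
lemma a law on `[0, ∞)` whose transform has this regularity has the corresponding moments, so
moments of `I` come from the closed form and need no separate estimate.

Age. The age has slope 1 between completions, so the area between two completions is half a
difference of squares, with mean `E I² / 2 + E I (E H + E G)`. Peaks and areas depend on three
successive cycles; the strong law holds along each residue class modulo 3, hence overall, and
renewal-reward gives the almost sure average. For the average of the mean age, bounded convergence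
gives the lower bound, and a truncated form of Wald's inequality for the number of cycles begun
before `T` gives the upper one (`tendsto_timeAverage_integral`). A limit of the mean age, if there
is one, is its own Cesàro limit. -/

/-! ### Memorylessness of exponential gaps and independence of coordinates. -/

lemma expMeasure_Iio_zero {lam : ℝ} : expMeasure lam (Iio 0) = 0 := by
  rw [expMeasure, gammaMeasure, withDensity_apply _ measurableSet_Iio]
  exact lintegral_exponentialPDF_of_nonpos le_rfl

lemma expMeasure_apply {lam : ℝ} {t : Set ℝ} (ht : MeasurableSet t) :
    expMeasure lam t = ∫⁻ x in t, exponentialPDF lam x := by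
  rw [expMeasure, gammaMeasure, withDensity_apply _ ht]
  rfl

lemma expMeasure_eq_withDensity {lam : ℝ} :
    expMeasure lam = volume.withDensity (exponentialPDF lam) := rfl

lemma measurable_exponentialPDF {lam : ℝ} : Measurable (exponentialPDF lam) :=
  (measurable_exponentialPDFReal lam).ennreal_ofReal

lemma expMeasure_absolutelyContinuous {lam : ℝ} : expMeasure lam ≪ volume :=
  withDensity_absolutelyContinuous _ _

/-- Memoryless property of the exponential distribution. -/
lemma expMeasure_memoryless {lam a : ℝ} (ha : 0 ≤ a) {t : Set ℝ}
    (ht : MeasurableSet t) :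
    expMeasure lam {x | a < x ∧ x - a ∈ t}
      = ENNReal.ofReal (Real.exp (-(lam * a))) * expMeasure lam t := by
  have hm : MeasurableSet {x : ℝ | a < x ∧ x - a ∈ t} :=
    (measurableSet_lt measurable_const measurable_id).inter
      ((measurable_id.sub measurable_const) ht)
  rw [expMeasure_apply hm, expMeasure_apply ht, ← lintegral_indicator hm,
    ← lintegral_indicator ht, ← lintegral_const_mul _ (measurable_exponentialPDF.indicator ht),
    ← lintegral_add_right_eq_self _ a]
  refine lintegral_congr_ae ?_
  -- At 0 the strict inequality fails although the density is positive; this one point is discarded.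
  have h0 : ∀ᵐ x : ℝ ∂volume, x ≠ 0 := by
    simp [ae_iff]
  filter_upwards [h0] with x hx
  by_cases hxt : x ∈ t
  · rcases lt_or_gt_of_ne hx with hx | hx
    · rw [indicator_of_notMem (by simp; intro h; linarith), indicator_of_mem hxt,
        exponentialPDF_of_neg hx, mul_zero]
    · rw [indicator_of_mem (by simpa using ⟨hx, hxt⟩), indicator_of_mem hxt,
        exponentialPDF_of_nonneg (by linarith), exponentialPDF_of_nonneg hx.le,
        ← ENNReal.ofReal_mul (Real.exp_pos _).le]
      congr 1
      rw [show -(lam * (x + a)) = -(lam * a) + -(lam * x) by ring, Real.exp_add]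
      ring
  · rw [indicator_of_notMem (by simp [hxt]), indicator_of_notMem hxt, mul_zero]

lemma expMeasure_Ioi {lam a : ℝ} (hlam : 0 < lam) (ha : 0 ≤ a) :
    expMeasure lam (Ioi a) = ENNReal.ofReal (Real.exp (-(lam * a))) := by
  have := isProbabilityMeasure_expMeasure hlam
  have h := expMeasure_memoryless (lam := lam) ha MeasurableSet.univ
  simpa [Ioi] using h

/-- The memoryless property for a sequence of independent variables, the coordinate `i₀` of which
is exponentially distributed. -/
lemma infinitePi_memoryless {ι : Type*} [DecidableEq ι] {μ : ι → Measure ℝ}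
    [∀ i, IsProbabilityMeasure (μ i)] {i₀ : ι} {lam a : ℝ}
    (hμ : μ i₀ = expMeasure lam) (ha : 0 ≤ a) {B : Set (ι → ℝ)} (hB : MeasurableSet B) :
    Measure.infinitePi μ {r | a < r i₀ ∧ Function.update r i₀ (r i₀ - a) ∈ B}
      = ENNReal.ofReal (Real.exp (-(lam * a))) * Measure.infinitePi μ B := by
  have hup : Measurable (fun r : ι → ℝ => Function.update r i₀ (r i₀ - a)) := by
    refine measurable_pi_lambda _ fun i => ?_
    by_cases hi : i = i₀
    · subst hi; simp only [Function.update_self]; fun_prop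
    · simp only [Function.update_of_ne hi]; fun_prop
  have hlt : MeasurableSet {r : ι → ℝ | a < r i₀} :=
    measurableSet_lt measurable_const (measurable_pi_apply _)
  set c := ENNReal.ofReal (Real.exp (-(lam * a))) with hc
  have hc0 : c ≠ 0 := by simp [hc, Real.exp_pos]
  have hct : c ≠ ∞ := ENNReal.ofReal_ne_top
  -- The conditioned and shifted law is identified with the product law by its values on finite
  -- boxes, where only the factor at `i₀` is affected.
  have key : c⁻¹ • (((Measure.infinitePi μ).restrict {r | a < r i₀}).map
      (fun r : ι → ℝ => Function.update r i₀ (r i₀ - a))) = Measure.infinitePi μ := by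
    apply Measure.eq_infinitePi
    intro s t ht
    -- Adding `i₀` with the whole line as its factor changes neither the box nor the product.
    wlog hs : i₀ ∈ s generalizing s t
    · have := this (insert i₀ s) (Function.update t i₀ univ) (fun i => by
        by_cases hi : i = i₀
        · subst hi; simp
        · simpa [hi] using ht i) (Finset.mem_insert_self _ _)
      have e1 : Set.pi (↑(insert i₀ s)) (Function.update t i₀ univ) = Set.pi (↑s) t := by
        ext x
        simp only [Finset.coe_insert, Set.mem_pi, mem_insert_iff, Finset.mem_coe]
        constructor
        · intro h i hi
          have := h i (Or.inr hi)
          rwa [Function.update_of_ne (by rintro rfl; exact hs hi)] at this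
        · rintro h i (rfl | hi)
          · simp
          · rw [Function.update_of_ne (by rintro rfl; exact hs hi)]; exact h i hi
      rw [e1, Finset.prod_insert hs] at this
      rw [this, Function.update_self, measure_univ, one_mul]
      refine Finset.prod_congr rfl fun i hi => ?_
      rw [Function.update_of_ne (by rintro rfl; exact hs hi)]
    · have hpi : MeasurableSet (Set.pi (↑s) t) :=
        MeasurableSet.pi s.countable_toSet fun i _ => ht i
      rw [Measure.smul_apply, Measure.map_apply hup hpi, Measure.restrict_apply (hup hpi)]
      have e2 : (fun r : ι → ℝ => Function.update r i₀ (r i₀ - a)) ⁻¹' (Set.pi (↑s) t)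
          ∩ {r | a < r i₀}
          = Set.pi (↑s) (Function.update t i₀ {x | a < x ∧ x - a ∈ t i₀}) := by
        ext r
        simp only [mem_inter_iff, mem_preimage, Set.mem_pi, Finset.mem_coe, Set.mem_ofPred_eq]
        constructor
        · rintro ⟨h, h'⟩ i hi
          by_cases hi' : i = i₀
          · subst hi'
            have := h i hi
            rw [Function.update_self] at this ⊢
            exact ⟨h', this⟩
          · have := h i hi
            rw [Function.update_of_ne hi'] at this ⊢
            exact this
        · intro h
          have h0 := h i₀ hs
          rw [Function.update_self] at h0
          refine ⟨fun i hi => ?_, h0.1⟩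
          by_cases hi' : i = i₀
          · subst hi'; rw [Function.update_self]; exact h0.2
          · have := h i hi
            rw [Function.update_of_ne hi'] at this ⊢
            exact this
      rw [e2, Measure.infinitePi_pi, ← Finset.mul_prod_erase _ _ hs,
        ← Finset.mul_prod_erase _ _ hs, Function.update_self, hμ,
        expMeasure_memoryless ha (ht i₀), smul_eq_mul, ← hc, mul_assoc, ← mul_assoc c⁻¹,
        ENNReal.inv_mul_cancel hc0 hct, one_mul]
      · congr 1
        refine Finset.prod_congr rfl fun i hi => ?_
        rw [Function.update_of_ne (Finset.ne_of_mem_erase hi)]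
      · intro i _
        by_cases hi : i = i₀
        · subst hi
          rw [Function.update_self]
          exact (measurableSet_lt measurable_const measurable_id).inter
            ((measurable_id.sub measurable_const) (ht i))
        · rw [Function.update_of_ne hi]; exact ht i
  have h2 := congrArg (fun m : Measure (ι → ℝ) => c * m B) key
  simp only [Measure.smul_apply, smul_eq_mul] at h2
  rw [← mul_assoc, ENNReal.mul_inv_cancel hc0 hct, one_mul, Measure.map_apply hup hB,
    Measure.restrict_apply (hup hB)] at h2
  rw [← h2]
  congr 1
  ext r
  simp [and_comm]

/-- Coordinates with indices in a set are independent of the coordinates outside of it. -/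
lemma indepFun_infinitePi_of_disjoint {ι β γ : Type*} [MeasurableSpace β] [MeasurableSpace γ]
    {μ : ι → Measure ℝ} [∀ i, IsProbabilityMeasure (μ i)] {S T : Set ι} (hST : Disjoint S T)
    {f : (ι → ℝ) → β} {g : (ι → ℝ) → γ}
    (hf : Measurable[⨆ i ∈ S, MeasurableSpace.comap (fun z : ι → ℝ => z i) inferInstance] f)
    (hg : Measurable[⨆ i ∈ T, MeasurableSpace.comap (fun z : ι → ℝ => z i) inferInstance] g) :
    IndepFun f g (Measure.infinitePi μ) := by
  have h : iIndepFun (fun i (z : ι → ℝ) => z i) (Measure.infinitePi μ) :=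
    iIndepFun_infinitePi (X := fun _ x => x) (fun _ => measurable_id)
  have h2 := indep_iSup_of_disjoint (fun i => (measurable_pi_apply i).comap_le) h.iIndep hST
  rw [IndepFun_iff_Indep]
  exact indep_of_indep_of_le_left (indep_of_indep_of_le_right h2 hg.comap_le) hf.comap_le

/-! ### Divergence of partial sums. -/

section Divergence

lemma integrable_exp_neg_mul {ν : Measure ℝ} [IsFiniteMeasure ν] (hν : ∀ᵐ x ∂ν, 0 ≤ x) {s : ℝ}
    (hs : 0 ≤ s) : Integrable (fun x => Real.exp (-(s * x))) ν := by
  refine Integrable.of_bound (C := 1) (by fun_prop) ?_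
  filter_upwards [hν] with x hx
  rw [Real.norm_eq_abs, abs_of_pos (Real.exp_pos _), Real.exp_le_one_iff]
  nlinarith [mul_nonneg hs hx]

lemma lst_nonneg (ν : Measure ℝ) (s : ℝ) : 0 ≤ lst ν s :=
  integral_nonneg fun _ => (Real.exp_pos _).le

lemma lst_lt_one {ν : Measure ℝ} [IsProbabilityMeasure ν] (hν : ∀ᵐ x ∂ν, 0 ≤ x)
    (hν0 : ν {0} ≠ 1) {s : ℝ} (hs : 0 < s) : lst ν s < 1 := by
  have hint := integrable_exp_neg_mul hν hs.le
  have hle : ∀ᵐ x ∂ν, 0 ≤ 1 - Real.exp (-(s * x)) := by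
    filter_upwards [hν] with x hx
    have : Real.exp (-(s * x)) ≤ 1 := by
      rw [Real.exp_le_one_iff]; nlinarith [mul_nonneg hs.le hx]
    linarith
  have hsub : ∫ x, (1 - Real.exp (-(s * x))) ∂ν = 1 - lst ν s := by
    rw [integral_sub (integrable_const _) hint]; simp [lst]
  by_contra! hcon
  have h0 : ∫ x, (1 - Real.exp (-(s * x))) ∂ν = 0 :=
    le_antisymm (by rw [hsub]; linarith) (integral_nonneg_of_ae hle)
  rw [integral_eq_zero_iff_of_nonneg_ae hle ((integrable_const _).sub hint)] at h0
  apply hν0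
  have : ∀ᵐ x ∂ν, x ∈ ({0} : Set ℝ) := by
    filter_upwards [h0] with x hx
    have hx' : Real.exp (-(s * x)) = 1 := by
      have : 1 - Real.exp (-(s * x)) = 0 := hx
      linarith
    rw [Real.exp_eq_one_iff] at hx'
    simpa [hs.ne'] using hx'
  exact (prob_compl_eq_zero_iff (measurableSet_singleton 0)).1 this

lemma mgf_neg_eq_lst {Ω : Type*} [MeasurableSpace Ω] {P : Measure Ω} {X : Ω → ℝ}
    (hX : AEMeasurable X P) (s : ℝ) : mgf X P (-s) = lst (P.map X) s := by
  rw [lst, integral_map hX (by fun_prop), mgf]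
  simp

/-- Sums of i.i.d. nonnegative variables that are not almost surely zero diverge. -/
lemma ae_tendsto_sum_atTop {Ω : Type*} [MeasurableSpace Ω] {P : Measure Ω}
    [IsProbabilityMeasure P] {ν : Measure ℝ} [IsProbabilityMeasure ν] (hν : ∀ᵐ x ∂ν, 0 ≤ x)
    (hν0 : ν {0} ≠ 1) {X : ℕ → Ω → ℝ} (hX : ∀ n, Measurable (X n)) (hlaw : ∀ n, P.map (X n) = ν)
    (hind : iIndepFun X P) :
    ∀ᵐ ω ∂P, Tendsto (fun n => ∑ i ∈ Finset.range n, X i ω) atTop atTop := by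
  have hnn : ∀ᵐ ω ∂P, ∀ n, 0 ≤ X n ω := by
    rw [ae_all_iff]
    intro n
    have := hlaw n ▸ hν
    exact ae_of_ae_map (hX n).aemeasurable this
  have hbd : ∀ M : ℕ, ∀ᵐ ω ∂P, ¬ ∀ n, ∑ i ∈ Finset.range n, X i ω ≤ M := by
    intro M
    have hr := lst_lt_one hν hν0 one_pos
    -- Exponential Markov inequality with parameter -1: each summand contributes the factor `lst ν 1
    -- < 1`, so staying below `M` forever has probability 0.
    have hle : ∀ n, P.real {ω | ∀ n, ∑ i ∈ Finset.range n, X i ω ≤ M}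
        ≤ Real.exp M * lst ν 1 ^ n := by
      intro n
      have hint : Integrable (fun ω => Real.exp (-1 * (∑ i ∈ Finset.range n, X i) ω)) P := by
        refine Integrable.of_bound (C := 1) (by fun_prop) ?_
        filter_upwards [hnn] with ω hω
        rw [Real.norm_eq_abs, abs_of_pos (Real.exp_pos _), Real.exp_le_one_iff, Finset.sum_apply]
        have := Finset.sum_nonneg fun i (_ : i ∈ Finset.range n) => hω i
        linarith
      have h1 := measure_le_le_exp_mul_mgf (μ := P) (X := ∑ i ∈ Finset.range n, X i) (M : ℝ)
        (by norm_num : (-1 : ℝ) ≤ 0) hint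
      rw [hind.mgf_sum hX, Finset.prod_congr rfl fun i _ => by
        rw [mgf_neg_eq_lst (hX i).aemeasurable, hlaw i], Finset.prod_const,
        Finset.card_range] at h1
      simp only [neg_neg, one_mul] at h1
      refine le_trans (measureReal_mono fun ω hω => ?_) h1
      simpa using hω n
    have hlim : Tendsto (fun n => Real.exp M * lst ν 1 ^ n) atTop (𝓝 0) := by
      simpa using (tendsto_pow_atTop_nhds_zero_of_lt_one (lst_nonneg ν 1) hr).const_mul
        (Real.exp M)
    have h0 := ge_of_tendsto' hlim hle
    rw [ae_iff]
    simp only [not_not]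
    exact (measureReal_eq_zero_iff).1 (le_antisymm h0 measureReal_nonneg)
  filter_upwards [hnn, ae_all_iff.2 hbd] with ω hω hω'
  have hmono : Monotone (fun n => ∑ i ∈ Finset.range n, X i ω) := by
    refine monotone_nat_of_le_succ fun n => ?_
    rw [Finset.sum_range_succ]
    linarith [hω n]
  refine tendsto_atTop_atTop_of_monotone hmono fun b => ?_
  obtain ⟨M, hM⟩ := exists_nat_ge b
  have := hω' M
  push Not at this
  obtain ⟨n, hn⟩ := this
  exact ⟨n, by linarith⟩

end Divergence

/-! ### The canonical path space -/

/-- Indices of the inputs: inter-arrival times, service times, and vacations. -/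
abbrev Idx := ℕ ⊕ ℕ ⊕ (ℕ × ℕ)

/-- The inputs of a cycle that starts at time `0` with an empty buffer, with a service whose
length is the entry `inr (inl 0)`. -/
abbrev Path := Idx → ℝ

/-- Marginal laws of the inputs; `κ` is the law of the first service time. -/
def marginal (lam : ℝ) (νH νV κ : Measure ℝ) : Idx → Measure ℝ
  | Sum.inl _ => expMeasure lam
  | Sum.inr (Sum.inl 0) => κ
  | Sum.inr (Sum.inl (_ + 1)) => νH
  | Sum.inr (Sum.inr _) => νV

instance {lam : ℝ} {νH νV κ : Measure ℝ} [IsProbabilityMeasure (expMeasure lam)]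
    [IsProbabilityMeasure νH] [IsProbabilityMeasure νV] [IsProbabilityMeasure κ] (i : Idx) :
    IsProbabilityMeasure (marginal lam νH νV κ i) := by
  rcases i with _ | (_ | _) | _ <;> simp only [marginal] <;> infer_instance

/-- Joint law of the inputs. -/
def pathLaw (lam : ℝ) (νH νV κ : Measure ℝ) : Measure Path :=
  Measure.infinitePi (marginal lam νH νV κ)

instance {lam : ℝ} {νH νV κ : Measure ℝ} [IsProbabilityMeasure (expMeasure lam)]
    [IsProbabilityMeasure νH] [IsProbabilityMeasure νV] [IsProbabilityMeasure κ] :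
    IsProbabilityMeasure (pathLaw lam νH νV κ) := by
  unfold pathLaw; infer_instance

/-- Inter-arrival times of a path. -/
def gaps (z : Path) (n : ℕ) : ℝ := z (Sum.inl n)

/-- Service times of a path. -/
def services (z : Path) (l : ℕ) : ℝ := z (Sum.inr (Sum.inl l))

/-- Vacations of a path. -/
def vacations (z : Path) (l j : ℕ) : ℝ := z (Sum.inr (Sum.inr (l, j)))

@[fun_prop] lemma measurable_gaps (n : ℕ) : Measurable (fun z => gaps z n) :=
  measurable_pi_apply _

@[fun_prop] lemma measurable_services (n : ℕ) : Measurable (fun z => services z n) :=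
  measurable_pi_apply _

@[fun_prop] lemma measurable_vacations (l j : ℕ) : Measurable (fun z => vacations z l j) :=
  measurable_pi_apply _

/-- Arrival times of a path. -/
def arr (z : Path) (n : ℕ) : ℝ := arrival (gaps z) n

/-- Ends of the vacations in the first cycle of a path. -/
def vacEnd (z : Path) (j : ℕ) : ℝ := vacationEnd (vacations z 0) (services z 0) j

/-- Length of the first cycle of a path. -/
def firstCycle (z : Path) : ℝ := vacEnd z (sInf {j | gaps z 0 ≤ vacEnd z j})

/-- Number of arrivals in the first cycle of a path. -/
def count (z : Path) : ℕ := sInf {n | firstCycle z < arr z n}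

/-- Waiting time of the packet that is served at the end of the first cycle. -/
def firstWait (z : Path) : ℝ := firstCycle z - arr z (count z - 1)

/-- The inputs that are left at the end of the first cycle. -/
def next (z : Path) : Path
  | Sum.inl 0 => arr z (count z) - firstCycle z
  | Sum.inl (k + 1) => gaps z (count z + (k + 1))
  | Sum.inr (Sum.inl l) => services z (l + 1)
  | Sum.inr (Sum.inr p) => vacations z (p.1 + 1) p.2

lemma measurable_sInf_nat {α : Type*} [MeasurableSpace α] {p : ℕ → α → Prop}
    (hp : ∀ n, MeasurableSet {a | p n a}) : Measurable (fun a => sInf {n | p n a}) := by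
  classical
  have h : (fun a => sInf {n | p n a})
      = fun a => if h : ∃ n, p n a then Nat.find h else 0 := by
    funext a
    by_cases h : ∃ n, p n a
    · rw [dif_pos h, Nat.sInf_def (s := {n | p n a}) h]
    · rw [dif_neg h, Set.eq_empty_of_forall_notMem (s := {n | p n a}) fun n hn => h ⟨n, hn⟩,
        Nat.sInf_empty]
  refine measurable_to_nat fun a => ?_
  -- The second set collects the points where no index qualifies and `sInf` takes its default value
  -- 0.
  have hset : (fun a => sInf {n | p n a}) ⁻¹' {sInf {n | p n a}}
      = {b | (p (sInf {n | p n a}) b ∧ ∀ m < sInf {n | p n a}, ¬ p m b)}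
        ∪ {b | sInf {n | p n a} = 0 ∧ ∀ m, ¬ p m b} := by
    ext b
    generalize sInf {n | p n a} = k
    simp only [mem_preimage, mem_singleton_iff, mem_union, Set.mem_ofPred_eq]
    constructor
    · rintro rfl
      by_cases hb : ∃ n, p n b
      · left
        exact ⟨Nat.sInf_mem (s := {n | p n b}) hb, fun m hm => Nat.notMem_of_lt_sInf hm⟩
      · right
        push Not at hb
        refine ⟨?_, hb⟩
        rw [Set.eq_empty_of_forall_notMem (s := {n | p n b}) hb, Nat.sInf_empty]
    · rintro (⟨h1, h2⟩ | ⟨rfl, h2⟩)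
      · refine le_antisymm (Nat.sInf_le h1) ?_
        by_contra! hlt
        exact h2 _ hlt (Nat.sInf_mem (s := {n | p n b}) ⟨k, h1⟩)
      · rw [Set.eq_empty_of_forall_notMem (s := {n | p n b}) h2, Nat.sInf_empty]
  rw [hset]
  refine MeasurableSet.union ?_ ?_
  · refine (hp _).inter ?_
    have : {b | ∀ m < sInf {n | p n a}, ¬ p m b}
        = ⋂ m, ⋂ _ : m < sInf {n | p n a}, {b | p m b}ᶜ := by ext; simp
    have hm : MeasurableSet {b | ∀ m < sInf {n | p n a}, ¬ p m b} := by
      rw [this]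
      exact MeasurableSet.iInter fun m => MeasurableSet.iInter fun _ => (hp m).compl
    exact hm
  · refine MeasurableSet.inter (MeasurableSet.const _) ?_
    have : {b | ∀ m, ¬ p m b} = ⋂ m, {b | p m b}ᶜ := by ext; simp
    have hm : MeasurableSet {b | ∀ m, ¬ p m b} := by
      rw [this]
      exact MeasurableSet.iInter fun m => (hp m).compl
    exact hm

lemma measurable_nat_index {α β : Type*} [MeasurableSpace α] [MeasurableSpace β] {f : α → ℕ → β}
    (hf : ∀ n, Measurable (fun a => f a n)) {N : α → ℕ} (hN : Measurable N) :
    Measurable (fun a => f a (N a)) := by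
  have : Measurable (fun q : ℕ × α => f q.2 q.1) := measurable_from_prod_countable_right hf
  exact this.comp (hN.prodMk measurable_id)

@[fun_prop] lemma measurable_arr (n : ℕ) : Measurable (fun z => arr z n) := by
  unfold arr arrival; fun_prop

@[fun_prop] lemma measurable_vacEnd (n : ℕ) : Measurable (fun z => vacEnd z n) := by
  unfold vacEnd vacationEnd; fun_prop

@[fun_prop] lemma measurable_firstCycle : Measurable firstCycle :=
  measurable_nat_index measurable_vacEnd (measurable_sInf_nat fun n =>
    measurableSet_le (measurable_gaps 0) (measurable_vacEnd n))

@[fun_prop] lemma measurable_count : Measurable count :=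
  measurable_sInf_nat fun n => measurableSet_lt measurable_firstCycle (measurable_arr n)

@[fun_prop] lemma measurable_firstWait : Measurable firstWait :=
  measurable_firstCycle.sub (measurable_nat_index measurable_arr
    (measurable_count.sub_const 1))

@[fun_prop] lemma measurable_next : Measurable next := by
  refine measurable_pi_lambda _ fun i => ?_
  rcases i with (_ | k) | l | p
  · exact (measurable_nat_index measurable_arr measurable_count).sub measurable_firstCycle
  · exact measurable_nat_index (f := fun z n => gaps z n) measurable_gaps
      (measurable_count.add_const _)
  · exact measurable_services _
  · exact measurable_vacations _ _

/-- The almost sure properties of the inputs. -/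
structure Good (z : Path) : Prop where
  gaps_pos : ∀ n, 0 < gaps z n
  arr_atTop : Tendsto (arr z) atTop atTop
  services_nonneg : ∀ l, 0 ≤ services z l
  vacations_nonneg : ∀ l j, 0 ≤ vacations z l j
  vacations_atTop : ∀ l, Tendsto (fun n => ∑ i ∈ Finset.range n, vacations z l i) atTop atTop

section

variable {lam : ℝ} {νH νV κ : Measure ℝ} [IsProbabilityMeasure (expMeasure lam)]
  [IsProbabilityMeasure νH] [IsProbabilityMeasure νV] [IsProbabilityMeasure κ]

lemma pathLaw_map_apply (i : Idx) :
    (pathLaw lam νH νV κ).map (fun z => z i) = marginal lam νH νV κ i := by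
  rw [pathLaw, Measure.infinitePi_map_eval]

lemma iIndepFun_pathLaw : iIndepFun (fun (i : Idx) (z : Path) => z i) (pathLaw lam νH νV κ) :=
  iIndepFun_infinitePi (X := fun _ x => x) (fun _ => measurable_id)

lemma expMeasure_pos (lam : ℝ) : ∀ᵐ x ∂(expMeasure lam), 0 < x := by
  have h : expMeasure lam (Iic 0) = 0 := by
    rw [← Iio_union_right]
    refine measure_union_null expMeasure_Iio_zero ?_
    exact expMeasure_absolutelyContinuous (by simp)
  rw [ae_iff]
  simpa [Iic] using h

lemma ae_good (hH : ∀ᵐ x ∂νH, 0 ≤ x) (hV : ∀ᵐ x ∂νV, 0 ≤ x) (hκ : ∀ᵐ x ∂κ, 0 ≤ x)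
    (hV0 : νV {0} ≠ 1) : ∀ᵐ z ∂(pathLaw lam νH νV κ), Good z := by
  have hE : ∀ᵐ x ∂(expMeasure lam), 0 ≤ x := (expMeasure_pos lam).mono fun x hx => hx.le
  have hE0 : expMeasure lam {0} ≠ 1 := by
    rw [expMeasure_absolutelyContinuous (by simp)]; exact zero_ne_one
  have hof : ∀ i {p : ℝ → Prop}, (∀ᵐ x ∂(marginal lam νH νV κ i), p x) →
      ∀ᵐ z ∂(pathLaw lam νH νV κ), p (z i) := by
    intro i p h
    rw [← pathLaw_map_apply (lam := lam) (νH := νH) (νV := νV) (κ := κ) i] at h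
    exact ae_of_ae_map (measurable_pi_apply i).aemeasurable h
  have h1 : ∀ᵐ z ∂(pathLaw lam νH νV κ), ∀ n, 0 < gaps z n :=
    ae_all_iff.2 fun n => hof (Sum.inl n) (expMeasure_pos lam)
  have h2 : ∀ᵐ z ∂(pathLaw lam νH νV κ), ∀ n, 0 ≤ services z n := by
    refine ae_all_iff.2 fun n => hof (Sum.inr (Sum.inl n)) ?_
    rcases n with _ | n
    · exact hκ
    · exact hH
  have h3 : ∀ᵐ z ∂(pathLaw lam νH νV κ), ∀ l j, 0 ≤ vacations z l j :=
    ae_all_iff.2 fun l => ae_all_iff.2 fun j => hof (Sum.inr (Sum.inr (l, j))) hV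
  have h4 : ∀ᵐ z ∂(pathLaw lam νH νV κ),
      Tendsto (fun n => ∑ i ∈ Finset.range n, gaps z i) atTop atTop :=
    ae_tendsto_sum_atTop hE hE0 (X := fun n z => gaps z n) measurable_gaps
      (fun n => pathLaw_map_apply (Sum.inl n))
      (iIndepFun_pathLaw.precomp (g := fun n => Sum.inl n) Sum.inl_injective)
  have h5 : ∀ᵐ z ∂(pathLaw lam νH νV κ), ∀ l,
      Tendsto (fun n => ∑ i ∈ Finset.range n, vacations z l i) atTop atTop :=
    ae_all_iff.2 fun l => ae_tendsto_sum_atTop hV hV0 (X := fun n z => vacations z l n)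
      (measurable_vacations l) (fun n => pathLaw_map_apply (Sum.inr (Sum.inr (l, n))))
      (iIndepFun_pathLaw.precomp (g := fun n => Sum.inr (Sum.inr (l, n))) fun a b h => by
        simpa using h)
  filter_upwards [h1, h2, h3, h4, h5] with z z1 z2 z3 z4 z5
  exact ⟨z1, z4.comp (tendsto_add_atTop_nat 1), z2, z3, z5⟩

end

namespace Good

variable {z : Path}

lemma arr_strictMono (hz : Good z) : StrictMono (arr z) := by
  refine strictMono_nat_of_lt_succ fun n => ?_
  rw [arr, arr, arrival, arrival, Finset.sum_range_succ _ (n + 1)]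
  linarith [hz.gaps_pos (n + 1)]

lemma vacEnd_succ (z : Path) (j : ℕ) : vacEnd z (j + 1) = vacEnd z j + vacations z 0 (j + 1) := by
  rw [vacEnd, vacEnd, vacationEnd, vacationEnd, Finset.sum_range_succ _ (j + 1)]; ring

lemma vacEnd_mono (hz : Good z) : Monotone (vacEnd z) := by
  refine monotone_nat_of_le_succ fun j => ?_
  rw [vacEnd_succ]
  linarith [hz.vacations_nonneg 0 (j + 1)]

lemma services_le_vacEnd (hz : Good z) (j : ℕ) : services z 0 ≤ vacEnd z j := by
  have := Finset.sum_nonneg fun i (_ : i ∈ Finset.range (j + 1)) => hz.vacations_nonneg 0 i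
  rw [vacEnd, vacationEnd]; linarith

lemma vacEnd_atTop (hz : Good z) : Tendsto (vacEnd z) atTop atTop :=
  tendsto_atTop_add_const_left _ _ ((hz.vacations_atTop 0).comp (tendsto_add_atTop_nat 1))

lemma exists_vacEnd (hz : Good z) : {j | gaps z 0 ≤ vacEnd z j}.Nonempty :=
  (hz.vacEnd_atTop.eventually_ge_atTop (gaps z 0)).exists

lemma gaps_le_firstCycle (hz : Good z) : gaps z 0 ≤ firstCycle z := Nat.sInf_mem hz.exists_vacEnd

lemma services_le_firstCycle (hz : Good z) : services z 0 ≤ firstCycle z :=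
  hz.services_le_vacEnd _

lemma firstCycle_pos (hz : Good z) : 0 < firstCycle z :=
  (hz.gaps_pos 0).trans_le hz.gaps_le_firstCycle

lemma arr_zero (z : Path) : arr z 0 = gaps z 0 := by simp [arr, arrival]

lemma arr_succ (z : Path) (n : ℕ) : arr z (n + 1) = arr z n + gaps z (n + 1) := by
  rw [arr, arr, arrival, arrival, Finset.sum_range_succ _ (n + 1)]

lemma arr_pos (hz : Good z) (n : ℕ) : 0 < arr z n := by
  have h := hz.arr_strictMono.monotone (Nat.zero_le n)
  rw [arr_zero] at h
  exact (hz.gaps_pos 0).trans_le h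

lemma exists_arr (hz : Good z) : {n | firstCycle z < arr z n}.Nonempty :=
  (hz.arr_atTop.eventually_gt_atTop _).exists

lemma firstCycle_lt_arr (hz : Good z) : firstCycle z < arr z (count z) :=
  Nat.sInf_mem hz.exists_arr

lemma arr_le_of_lt_count {n : ℕ} (h : n < count z) : arr z n ≤ firstCycle z :=
  not_lt.1 (Nat.notMem_of_lt_sInf h)

lemma count_pos (hz : Good z) : 0 < count z := by
  by_contra! h
  have h1 := hz.firstCycle_lt_arr
  rw [Nat.le_zero.1 h, arr_zero] at h1
  linarith [hz.gaps_le_firstCycle]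

lemma arr_le_firstCycle (hz : Good z) : arr z (count z - 1) ≤ firstCycle z :=
  arr_le_of_lt_count (Nat.sub_lt hz.count_pos one_pos)

/-- Rewrites the value of `count` as two comparisons, of which only the second involves gap `n + 1`,
the one in progress at the end of the cycle. -/
lemma count_eq_iff (hz : Good z) (n : ℕ) :
    count z = n + 1 ↔ arr z n ≤ firstCycle z ∧ firstCycle z < arr z (n + 1) := by
  constructor
  · intro h
    exact ⟨arr_le_of_lt_count (by omega), h ▸ hz.firstCycle_lt_arr⟩
  · rintro ⟨h1, h2⟩
    refine le_antisymm (Nat.sInf_le h2) ?_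
    by_contra! h
    have := hz.arr_strictMono.monotone (Nat.lt_succ_iff.1 h)
    linarith [hz.firstCycle_lt_arr]

lemma firstWait_nonneg (hz : Good z) : 0 ≤ firstWait z := sub_nonneg.2 hz.arr_le_firstCycle

lemma firstWait_lt_firstCycle (hz : Good z) : firstWait z < firstCycle z :=
  sub_lt_self _ (hz.arr_pos _)

end Good

/-! ### Renewal at the end of a cycle. -/

/-- Indices of the first service, the first `n` gaps and the vacations of the first cycle. -/
def pastIdx (n : ℕ) : Set Idx :=
  {i | (∃ k < n, i = Sum.inl k) ∨ i = Sum.inr (Sum.inl 0) ∨ ∃ j, i = Sum.inr (Sum.inr (0, j))}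

open Classical in
/-- The restriction of a path to `pastIdx n`. -/
def past (n : ℕ) (z : Path) (i : Idx) : ℝ := if i ∈ pastIdx n then z i else 0

/-- Renumbering of the inputs outside of `pastIdx n`. -/
def tailIdx (n : ℕ) : Idx → Idx
  | Sum.inl k => Sum.inl (n + k)
  | Sum.inr (Sum.inl l) => Sum.inr (Sum.inl (l + 1))
  | Sum.inr (Sum.inr p) => Sum.inr (Sum.inr (p.1 + 1, p.2))

lemma tailIdx_injective (n : ℕ) : Function.Injective (tailIdx n) := by
  rintro (k | l | p) (k' | l' | p') h <;> simp_all [tailIdx, Prod.ext_iff]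

lemma tailIdx_notMem (n : ℕ) (i : Idx) : tailIdx n i ∈ (pastIdx n)ᶜ := by
  rcases i with k | l | p <;> simp [tailIdx, pastIdx]

lemma past_gaps {n k : ℕ} (h : k < n) (z : Path) : gaps (past n z) k = gaps z k :=
  if_pos (Or.inl ⟨k, h, rfl⟩)

lemma past_services (n : ℕ) (z : Path) : services (past n z) 0 = services z 0 :=
  if_pos (Or.inr (Or.inl rfl))

lemma past_vacations (n : ℕ) (z : Path) (j : ℕ) : vacations (past n z) 0 j = vacations z 0 j :=
  if_pos (Or.inr (Or.inr ⟨j, rfl⟩))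

lemma past_vacEnd (n : ℕ) (z : Path) (j : ℕ) : vacEnd (past n z) j = vacEnd z j := by
  simp only [vacEnd, vacationEnd, past_services, past_vacations]

/-- Among the gaps only the first decides which vacation ends the cycle, so any positive number of
them is enough. -/
lemma past_firstCycle {n : ℕ} (hn : 0 < n) (z : Path) :
    firstCycle (past n z) = firstCycle z := by
  simp only [firstCycle, past_vacEnd, past_gaps hn]

lemma past_arr {n k : ℕ} (h : k < n) (z : Path) : arr (past n z) k = arr z k := by
  unfold arr arrival
  refine Finset.sum_congr rfl fun i hi => past_gaps ?_ z
  have := Finset.mem_range.1 hi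
  omega

/-- The inputs after the `n`-th gap, a part `a` of which has elapsed. -/
def residual (n : ℕ) (a : ℝ) (z : Path) : Path :=
  Function.update (fun i => z (tailIdx n i)) (Sum.inl 0) (gaps z n - a)

/-- Gap `n + 1` straddles the end of the cycle, and by then the time since arrival `n` has elapsed
of it. -/
lemma next_eq_residual {z : Path} {n : ℕ} (h : count z = n + 1) :
    next z = residual (n + 1) (firstCycle z - arr z n) z := by
  funext i
  rcases i with (_ | k) | l | p
  · rw [residual, Function.update_self, next, h, Good.arr_succ]; ring
  · rw [residual, Function.update_of_ne (by simp), next, h]; rfl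
  · rw [residual, Function.update_of_ne (by simp)]; rfl
  · rw [residual, Function.update_of_ne (by simp)]; rfl

section

variable {lam : ℝ} {νH νV κ : Measure ℝ} [IsProbabilityMeasure (expMeasure lam)]
  [IsProbabilityMeasure νH] [IsProbabilityMeasure νV] [IsProbabilityMeasure κ]

lemma measurable_past (n : ℕ) : Measurable (past n) := by
  refine measurable_pi_lambda _ fun i => ?_
  by_cases h : i ∈ pastIdx n
  · simp only [past, h, if_true]; fun_prop
  · simp only [past, h, if_false]; fun_prop

/-- The renumbering drops service 0, the only coordinate with law `κ`; this is where `κ` turns into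
`νH`. -/
lemma map_tailIdx (n : ℕ) : (pathLaw lam νH νV κ).map (fun z i => z (tailIdx n i))
    = pathLaw lam νH νV νH := by
  rw [pathLaw, Measure.map_infinitePi_infinitePi_of_inj (tailIdx_injective n), pathLaw]
  congr 1
  funext i
  rcases i with k | (_ | l) | p <;> rfl

lemma indepFun_past (n : ℕ) :
    IndepFun (past n) (fun z i => z (tailIdx n i)) (pathLaw lam νH νV κ) := by
  refine indepFun_infinitePi_of_disjoint (disjoint_compl_right (a := pastIdx n)) ?_ ?_
  · refine (@measurable_pi_iff _ _ _ (_) _ _).2 fun i => ?_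
    by_cases h : i ∈ pastIdx n
    · simp only [past, h, if_true]
      exact (comap_measurable fun z : Idx → ℝ => z i).mono
        (le_iSup₂_of_le i h le_rfl) le_rfl
    · simp only [past, h, if_false]; exact measurable_const
  · refine (@measurable_pi_iff _ _ _ (_) _ _).2 fun i => ?_
    exact (comap_measurable fun z : Idx → ℝ => z (tailIdx n i)).mono
        (le_iSup₂_of_le (tailIdx n i) (tailIdx_notMem n i) le_rfl) le_rfl

lemma map_past_tailIdx (n : ℕ) :
    (pathLaw lam νH νV κ).map (fun z => (past n z, fun i => z (tailIdx n i)))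
      = ((pathLaw lam νH νV κ).map (past n)).prod (pathLaw lam νH νV νH) := by
  rw [(indepFun_iff_map_prod_eq_prod_map_map (measurable_past n).aemeasurable
    (measurable_pi_lambda _ fun i => measurable_pi_apply _).aemeasurable).1 (indepFun_past n), map_tailIdx]

/-- If `A ≥ 0` is determined by the past, then, given that the `n`-th gap exceeds `A`, the residual
inputs are distributed as the inputs at the start of a cycle. -/
lemma measure_residual (n : ℕ) {A : Path → ℝ} (hA : Measurable A)
    (hA' : ∀ z, A (past n z) = A z) {E : Set Path} (hE : MeasurableSet E)
    (hE' : ∀ z, past n z ∈ E ↔ z ∈ E) (hpos : ∀ z ∈ E, 0 ≤ A z) {B : Set Path}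
    (hB : MeasurableSet B) :
    pathLaw lam νH νV κ {z | z ∈ E ∧ A z < gaps z n ∧ residual n (A z) z ∈ B}
      = (∫⁻ z in E, ENNReal.ofReal (Real.exp (-(lam * A z))) ∂(pathLaw lam νH νV κ))
        * pathLaw lam νH νV νH B := by
  -- `D` lives on the product of the past and the renumbered rest. By Fubini the past can be frozen;
  -- `A` is then a constant and the memoryless property applies to the first gap of the rest.
  set D : Set (Path × Path) := {q | q.1 ∈ E ∧ A q.1 < q.2 (Sum.inl 0) ∧
    Function.update q.2 (Sum.inl 0) (q.2 (Sum.inl 0) - A q.1) ∈ B} with hD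
  have hup : Measurable fun q : Path × Path =>
      (Function.update q.2 (Sum.inl 0) (q.2 (Sum.inl 0) - A q.1) : Path) := by
    refine measurable_pi_lambda _ fun i => ?_
    by_cases hi : i = Sum.inl 0
    · subst hi; simp only [Function.update_self]; fun_prop
    · simp only [Function.update_of_ne hi]; fun_prop
  have hDm : MeasurableSet D :=
    (measurable_fst hE).inter ((measurableSet_lt (hA.comp measurable_fst)
      ((measurable_pi_apply _).comp measurable_snd)).inter (hup hB))
  have hpm : Measurable fun z : Path => (past n z, fun i => z (tailIdx n i)) :=
    (measurable_past n).prodMk (by fun_prop)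
  have h1 : {z | z ∈ E ∧ A z < gaps z n ∧ residual n (A z) z ∈ B}
      = (fun z : Path => (past n z, fun i => z (tailIdx n i))) ⁻¹' D := by
    ext z
    simp only [hD, mem_preimage, Set.mem_ofPred_eq, hE', hA']
    rfl
  rw [h1, ← Measure.map_apply hpm hDm, map_past_tailIdx, Measure.prod_apply hDm,
    lintegral_map (measurable_measure_prodMk_left hDm) (measurable_past n),
    ← lintegral_indicator hE, ← lintegral_mul_const _
      (Measurable.indicator (by fun_prop) hE)]
  refine lintegral_congr fun z => ?_
  by_cases hz : z ∈ E
  · rw [indicator_of_mem hz]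
    have h2 : Prod.mk (past n z) ⁻¹' D = {r : Path | A z < r (Sum.inl 0) ∧
        Function.update r (Sum.inl 0) (r (Sum.inl 0) - A z) ∈ B} := by
      ext r
      simp only [hD, mem_preimage, Set.mem_ofPred_eq, hE', hA', hz, true_and]
    rw [h2, pathLaw, infinitePi_memoryless (μ := marginal lam νH νV νH) (i₀ := Sum.inl 0) (lam := lam) rfl (hpos z hz) hB]
  · rw [indicator_of_notMem hz, zero_mul]
    have h2 : Prod.mk (past n z) ⁻¹' D = ∅ := by
      ext r
      simp [hD, hE', hz]
    rw [h2, measure_empty]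

/-- Renewal theorem: the inputs that are left at the end of the first cycle are independent of the
first cycle and distributed as the inputs at the start of a cycle. -/
lemma measure_next (hg : ∀ᵐ z ∂(pathLaw lam νH νV κ), Good z) {A : Set (ℝ × ℝ × ℝ)}
    (hA : MeasurableSet A) {B : Set Path} (hB : MeasurableSet B) :
    pathLaw lam νH νV κ {z | (services z 0, firstCycle z, firstWait z) ∈ A ∧ next z ∈ B}
      = pathLaw lam νH νV κ {z | (services z 0, firstCycle z, firstWait z) ∈ A}
        * pathLaw lam νH νV νH B := by
  have hcm : Measurable fun z => (services z 0, firstCycle z, firstWait z) := by fun_prop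
  -- The series in front of the last factor does not depend on `B`. Taking `B = univ` identifies it
  -- with the probability of the cycle event, so it never has to be evaluated.
  have main : ∀ {B : Set Path}, MeasurableSet B →
      pathLaw lam νH νV κ {z | (services z 0, firstCycle z, firstWait z) ∈ A ∧ next z ∈ B}
      = (∑' n, ∫⁻ z in {z | (services z 0, firstCycle z, firstCycle z - arr z n) ∈ A ∧
          arr z n ≤ firstCycle z}, ENNReal.ofReal (Real.exp (-(lam * (firstCycle z - arr z n))))
          ∂(pathLaw lam νH νV κ)) * pathLaw lam νH νV νH B := by
    intro B hB
    have hSm : MeasurableSet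
        {z | (services z 0, firstCycle z, firstWait z) ∈ A ∧ next z ∈ B} :=
      (hcm hA).inter (measurable_next hB)
    -- A cycle almost surely contains an arrival, so the values `n + 1` of `count` exhaust all
    -- cases.
    have hsplit : {z | (services z 0, firstCycle z, firstWait z) ∈ A ∧ next z ∈ B}
        =ᵐ[pathLaw lam νH νV κ]
        ⋃ n, {z | (services z 0, firstCycle z, firstWait z) ∈ A ∧ next z ∈ B}
          ∩ count ⁻¹' {n + 1} := by
      refine eventuallyEq_set.2 ?_
      filter_upwards [hg] with z hz
      simp only [mem_iUnion, mem_inter_iff, mem_preimage, mem_singleton_iff, exists_and_left]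
      exact ⟨fun h => ⟨h, count z - 1, by have := hz.count_pos; omega⟩, fun h => h.1⟩
    rw [measure_congr hsplit, measure_iUnion, ← ENNReal.tsum_mul_right]
    · refine tsum_congr fun n => ?_
      have hfm : Measurable fun z => firstCycle z - arr z n := by fun_prop
      rw [← measure_residual (n + 1) (A := fun z => firstCycle z - arr z n) hfm
        (fun z => by rw [past_firstCycle n.succ_pos, past_arr n.lt_succ_self]) _ _ _ hB]
      · refine measure_congr (eventuallyEq_set.2 ?_)
        filter_upwards [hg] with z hz
        simp only [mem_inter_iff, mem_preimage, mem_singleton_iff, Set.mem_ofPred_eq]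
        constructor
        · rintro ⟨⟨h1, h2⟩, h3⟩
          rw [next_eq_residual h3] at h2
          have h4 := (hz.count_eq_iff n).1 h3
          rw [firstWait, h3, Nat.add_sub_cancel] at h1
          rw [Good.arr_succ] at h4
          exact ⟨⟨h1, h4.1⟩, by linarith [h4.2], h2⟩
        · rintro ⟨⟨h1, h4⟩, h5, h2⟩
          have h3 : count z = n + 1 := (hz.count_eq_iff n).2 ⟨h4, by
            rw [Good.arr_succ]; linarith⟩
          rw [firstWait, h3, Nat.add_sub_cancel, next_eq_residual h3]
          exact ⟨⟨h1, h2⟩, rfl⟩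
      · exact MeasurableSet.inter ((Measurable.prodMk (measurable_services 0)
          (measurable_firstCycle.prodMk hfm)) hA)
          (measurableSet_le (measurable_arr n) measurable_firstCycle)
      · intro z
        simp only [Set.mem_ofPred_eq, past_services, past_firstCycle n.succ_pos,
          past_arr n.lt_succ_self]
      · intro z hz
        exact sub_nonneg.2 hz.2
    · intro i j hij
      refine Disjoint.mono inter_subset_right inter_subset_right ?_
      refine Disjoint.preimage _ ?_
      simpa using fun h => hij h
    · intro n
      exact hSm.inter (measurable_count (measurableSet_singleton _))
  have h1 := main MeasurableSet.univ
  simp only [mem_univ, and_true, measure_univ, mul_one] at h1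
  rw [main hB, h1]

lemma map_next (hg : ∀ᵐ z ∂(pathLaw lam νH νV κ), Good z) :
    (pathLaw lam νH νV κ).map next = pathLaw lam νH νV νH := by
  ext B hB
  rw [Measure.map_apply measurable_next hB]
  have h := measure_next hg MeasurableSet.univ hB
  simpa using! h

/-- Service time, length and waiting time of the first cycle. -/
def firstData (z : Path) : ℝ × ℝ × ℝ := (services z 0, firstCycle z, firstWait z)

@[fun_prop] lemma measurable_firstData : Measurable firstData := by
  unfold firstData; fun_prop

lemma indepFun_next (hg : ∀ᵐ z ∂(pathLaw lam νH νV κ), Good z) :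
    IndepFun firstData next (pathLaw lam νH νV κ) := by
  rw [indepFun_iff_measure_inter_preimage_eq_mul]
  intro A B hA hB
  have h2 : pathLaw lam νH νV νH B = pathLaw lam νH νV κ (next ⁻¹' B) := by
    rw [← map_next hg, Measure.map_apply measurable_next hB]
  rw [← h2]
  exact measure_next hg hA hB

end

/-! ### Laplace transforms: derivatives and moments. -/

section Transform

variable {ν : Measure ℝ} {w : ℝ → ℝ}

lemma integrable_mul_exp (hν : ∀ᵐ x ∂ν, 0 ≤ x) (hw : Integrable w ν) {s : ℝ} (hs : 0 ≤ s) :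
    Integrable (fun x => w x * Real.exp (-(s * x))) ν := by
  refine hw.mul_bdd (c := 1) (by fun_prop) ?_
  filter_upwards [hν] with x hx
  rw [Real.norm_eq_abs, abs_of_pos (Real.exp_pos _), Real.exp_le_one_iff]
  nlinarith [mul_nonneg hs hx]

lemma continuousOn_transform (hν : ∀ᵐ x ∂ν, 0 ≤ x) (hw : Integrable w ν) :
    ContinuousOn (fun s => ∫ x, w x * Real.exp (-(s * x)) ∂ν) (Ici 0) := by
  refine continuousOn_of_dominated (bound := fun x => ‖w x‖)
    (fun s hs => (integrable_mul_exp hν hw hs).aestronglyMeasurable) (fun s hs => ?_) hw.norm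
    (ae_of_all _ fun x => by fun_prop)
  filter_upwards [hν] with x hx
  rw [norm_mul, Real.norm_eq_abs (Real.exp _), abs_of_pos (Real.exp_pos _)]
  refine mul_le_of_le_one_right (norm_nonneg _) ?_
  rw [Real.exp_le_one_iff]
  nlinarith [mul_nonneg (mem_Ici.1 hs) hx]

lemma abs_exp_neg_sub_exp_neg_le {a b : ℝ} (ha : 0 ≤ a) (hb : 0 ≤ b) :
    |Real.exp (-a) - Real.exp (-b)| ≤ |a - b| := by
  wlog h : a ≤ b generalizing a b
  · rw [abs_sub_comm, abs_sub_comm a b]; exact this hb ha (le_of_not_ge h)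
  have h1 : Real.exp (-b) ≤ Real.exp (-a) := Real.exp_le_exp.2 (by linarith)
  rw [abs_of_nonneg (by linarith), abs_of_nonpos (by linarith)]
  have h2 : Real.exp (-a) ≤ 1 := Real.exp_le_one_iff.2 (by linarith)
  have h3 : Real.exp (-b) = Real.exp (-a) * Real.exp (a - b) := by
    rw [← Real.exp_add]; ring_nf
  have h4 := Real.add_one_le_exp (a - b)
  nlinarith [Real.exp_pos (-a)]

/-- Dominated convergence: `u ↦ exp (-u)` is 1-Lipschitz on `[0, ∞)`, so the difference quotients
are bounded by `|x w x|`. The weight lets one lemma serve both derivatives of `lst`, with `w = 1`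
and then `w x = x`. -/
lemma hasDerivWithinAt_transform (hν : ∀ᵐ x ∂ν, 0 ≤ x) (hw : Integrable w ν)
    (hxw : Integrable (fun x => x * w x) ν) {s : ℝ} (hs : 0 ≤ s) :
    HasDerivWithinAt (fun s => ∫ x, w x * Real.exp (-(s * x)) ∂ν)
      (-∫ x, x * w x * Real.exp (-(s * x)) ∂ν) (Ici 0) s := by
  rw [hasDerivWithinAt_iff_tendsto_slope, ← integral_neg]
  have hmem : ∀ᶠ t in 𝓝[Ici 0 \ {s}] s, t ∈ Ici (0 : ℝ) \ {s} := self_mem_nhdsWithin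
  have hslope : (fun t => ∫ x, w x * ((t - s)⁻¹ * (Real.exp (-(t * x)) - Real.exp (-(s * x)))) ∂ν)
      =ᶠ[𝓝[Ici 0 \ {s}] s] slope (fun s => ∫ x, w x * Real.exp (-(s * x)) ∂ν) s := by
    filter_upwards [hmem] with t ht
    rw [slope_def_field, ← integral_sub (integrable_mul_exp hν hw ht.1)
      (integrable_mul_exp hν hw hs), div_eq_inv_mul, ← integral_const_mul]
    congr 1; funext x; ring
  refine Tendsto.congr' hslope ?_
  refine tendsto_integral_filter_of_dominated_convergence (fun x => ‖x * w x‖) ?_ ?_ hxw.norm ?_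
  · exact Eventually.of_forall fun t => hw.aestronglyMeasurable.mul (by fun_prop)
  · filter_upwards [hmem] with t ht
    filter_upwards [hν] with x hx
    have h0 : t - s ≠ 0 := sub_ne_zero.2 ht.2
    have h1 := abs_exp_neg_sub_exp_neg_le (mul_nonneg ht.1 hx) (mul_nonneg hs hx)
    rw [← sub_mul, abs_mul] at h1
    rw [norm_mul, norm_mul, norm_mul, Real.norm_eq_abs (_ - _), Real.norm_eq_abs (t - s)⁻¹,
      abs_inv, mul_comm ‖x‖, Real.norm_eq_abs x]
    refine mul_le_mul_of_nonneg_left ?_ (norm_nonneg _)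
    rw [inv_mul_le_iff₀ (abs_pos.2 h0)]
    exact h1
  · refine ae_of_all _ fun x => ?_
    have hd : HasDerivAt (fun t : ℝ => Real.exp (-(t * x))) (Real.exp (-(s * x)) * -(1 * x)) s :=
      (((hasDerivAt_id s).mul_const x).neg).exp
    have h1 := (hasDerivAt_iff_tendsto_slope.1 hd).mono_left
      (nhdsWithin_mono s (fun t ht => ht.2 : Ici 0 \ {s} ⊆ {s}ᶜ))
    have h2 := h1.const_mul (w x)
    refine (h2.congr fun t => ?_).trans (le_of_eq ?_)
    · rw [slope_def_field, div_eq_inv_mul]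
    · congr 1; ring

/-- If the transform of a nonnegative weight is differentiable at `0`, then the weight has a first
moment. -/
lemma integrable_of_differentiableWithinAt (hν : ∀ᵐ x ∂ν, 0 ≤ x) (hw : Integrable w ν)
    (hw0 : ∀ᵐ x ∂ν, 0 ≤ w x)
    (hd : DifferentiableWithinAt ℝ (fun s => ∫ x, w x * Real.exp (-(s * x)) ∂ν) (Ici 0) 0) :
    Integrable (fun x => x * w x) ν := by
  set F := fun s => ∫ x, w x * Real.exp (-(s * x)) ∂ν with hF
  set d := derivWithin F (Ici 0) 0
  have hu : Tendsto (fun n : ℕ => (1 : ℝ) / (n + 1)) atTop (𝓝[Ici 0 \ {0}] 0) := by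
    refine tendsto_nhdsWithin_iff.2 ⟨tendsto_one_div_add_atTop_nhds_zero_nat,
      Eventually.of_forall fun n => ⟨?_, ?_⟩⟩
    · exact mem_Ici.2 (by positivity)
    · simp only [mem_singleton_iff]; positivity
  have hs := (hasDerivWithinAt_iff_tendsto_slope.1 hd.hasDerivWithinAt).comp hu
  -- Minus the difference quotients of the integrand with step `1 / (n + 1)`. They are nonnegative
  -- and tend to `x * w x`, while their integrals tend to minus the derivative at 0; Fatou's lemma
  -- then bounds the integral of `x * w x`.
  set g : ℕ → ℝ → ℝ := fun n x => w x * (((n : ℝ) + 1) * (1 - Real.exp (-(1 / ((n : ℝ) + 1) * x))))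
    with hg
  have hgint : ∀ n, Integrable (g n) ν := fun n => by
    have := (hw.sub (integrable_mul_exp hν hw
      (by positivity : (0 : ℝ) ≤ 1 / ((n : ℝ) + 1)))).const_mul ((n : ℝ) + 1)
    refine this.congr (ae_of_all _ fun x => ?_)
    simp only [hg, Pi.sub_apply]; ring
  have hgval : ∀ n, ∫ x, g n x ∂ν = -slope F 0 (1 / ((n : ℝ) + 1)) := fun n => by
    have h1 : ∀ x, g n x = ((n : ℝ) + 1) * (w x - w x * Real.exp (-(1 / ((n : ℝ) + 1) * x))) :=
      fun x => by simp only [hg]; ring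
    simp only [h1]
    rw [integral_const_mul, integral_sub hw (integrable_mul_exp hν hw (by positivity)),
      slope_def_field]
    have h0 : F 0 = ∫ x, w x ∂ν := by simp [hF]
    rw [h0]
    simp only [hF]
    field_simp
    ring
  have hg0 : ∀ n, 0 ≤ᵐ[ν] g n := fun n => by
    filter_upwards [hν, hw0] with x hx hwx
    refine mul_nonneg hwx (mul_nonneg (by positivity) (sub_nonneg.2 ?_))
    rw [Real.exp_le_one_iff]
    have : 0 ≤ 1 / ((n : ℝ) + 1) * x := by positivity
    linarith
  have hlim : ∀ x, Tendsto (fun n => g n x) atTop (𝓝 (x * w x)) := fun x => by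
    have hd : HasDerivAt (fun t : ℝ => Real.exp (-(t * x))) (Real.exp (-(0 * x)) * -(1 * x)) 0 :=
      (((hasDerivAt_id (0 : ℝ)).mul_const x).neg).exp
    have h1 := ((hasDerivAt_iff_tendsto_slope.1 hd).mono_left
      (nhdsWithin_mono 0 (fun t ht => ht.2 : Ici (0 : ℝ) \ {0} ⊆ {0}ᶜ))).comp hu
    have h2 := (h1.const_mul (w x)).neg
    refine (h2.congr fun n => ?_).trans (le_of_eq ?_)
    · simp only [hg, Function.comp, slope_def_field]
      simp
      ring
    · congr 1; simp [mul_comm]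
  have hm : AEStronglyMeasurable (fun x => x * w x) ν :=
    aestronglyMeasurable_id.mul hw.aestronglyMeasurable
  have hnn : 0 ≤ᵐ[ν] fun x => x * w x := by
    filter_upwards [hν, hw0] with x hx hwx using mul_nonneg hx hwx
  refine ⟨hm, ?_⟩
  rw [hasFiniteIntegral_iff_ofReal hnn]
  have hfatou := lintegral_liminf_le' (μ := ν) (u := atTop) (f := fun n x => ENNReal.ofReal (g n x))
    (fun n => (hgint n).aemeasurable.ennreal_ofReal)
  have hl1 : ∀ x, liminf (fun n => ENNReal.ofReal (g n x)) atTop = ENNReal.ofReal (x * w x) :=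
    fun x => (ENNReal.tendsto_ofReal (hlim x)).liminf_eq
  have hl2 : liminf (fun n => ∫⁻ x, ENNReal.ofReal (g n x) ∂ν) atTop = ENNReal.ofReal (-d) := by
    refine Tendsto.liminf_eq ?_
    simp_rw [← ofReal_integral_eq_lintegral_ofReal (hgint _) (hg0 _), hgval]
    exact ENNReal.tendsto_ofReal hs.neg
  simp only [hl1] at hfatou
  rw [hl2] at hfatou
  exact hfatou.trans_lt ENNReal.ofReal_lt_top

variable [IsFiniteMeasure ν]

lemma lst_eq_transform (ν : Measure ℝ) : lst ν = fun s => ∫ x, 1 * Real.exp (-(s * x)) ∂ν := by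
  funext s; simp [lst]

lemma hasDerivWithinAt_lst (hν : ∀ᵐ x ∂ν, 0 ≤ x) (hx : Integrable (fun x => x) ν) {s : ℝ}
    (hs : 0 ≤ s) :
    HasDerivWithinAt (lst ν) (-∫ x, x * Real.exp (-(s * x)) ∂ν) (Ici 0) s := by
  have h := hasDerivWithinAt_transform (w := fun _ => 1) hν (integrable_const _) (by simpa using hx)
    hs
  rw [← lst_eq_transform] at h
  simpa using h

lemma differentiableOn_lst (hν : ∀ᵐ x ∂ν, 0 ≤ x) (hx : Integrable (fun x => x) ν) :
    DifferentiableOn ℝ (lst ν) (Ici 0) :=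
  fun _ hs => (hasDerivWithinAt_lst hν hx hs).differentiableWithinAt

lemma derivWithin_lst (hν : ∀ᵐ x ∂ν, 0 ≤ x) (hx : Integrable (fun x => x) ν) {s : ℝ}
    (hs : 0 ≤ s) : derivWithin (lst ν) (Ici 0) s = -∫ x, x * Real.exp (-(s * x)) ∂ν :=
  (hasDerivWithinAt_lst hν hx hs).derivWithin (uniqueDiffOn_Ici 0 s hs)

lemma deriv₀_lst (hν : ∀ᵐ x ∂ν, 0 ≤ x) (hx : Integrable (fun x => x) ν) :
    deriv₀ (lst ν) = -∫ x, x ∂ν := by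
  rw [deriv₀, derivWithin_lst hν hx le_rfl]; simp

lemma integrable_of_integrable_sq (hx : Integrable (fun x : ℝ => x ^ 2) ν) :
    Integrable (fun x => x) ν := by
  refine (hx.add (integrable_const 1)).mono' (by fun_prop) (ae_of_all _ fun x => ?_)
  simp only [Pi.add_apply, Real.norm_eq_abs]
  rw [abs_le]
  constructor <;> nlinarith [sq_nonneg (x - 1), sq_nonneg (x + 1)]

lemma hasDerivWithinAt_derivWithin_lst (hν : ∀ᵐ x ∂ν, 0 ≤ x)
    (hx : Integrable (fun x => x ^ 2) ν) {s : ℝ} (hs : 0 ≤ s) :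
    HasDerivWithinAt (derivWithin (lst ν) (Ici 0)) (∫ x, x ^ 2 * Real.exp (-(s * x)) ∂ν)
      (Ici 0) s := by
  have hx1 := integrable_of_integrable_sq hx
  have h := (hasDerivWithinAt_transform hν hx1 (by simpa [sq] using hx) hs).neg
  rw [neg_neg] at h
  simp only [← sq] at h
  exact h.congr (fun t ht => derivWithin_lst hν hx1 ht) (derivWithin_lst hν hx1 hs)

lemma secondDeriv₀_lst (hν : ∀ᵐ x ∂ν, 0 ≤ x) (hx : Integrable (fun x => x ^ 2) ν) :
    secondDeriv₀ (lst ν) = ∫ x, x ^ 2 ∂ν := by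
  have h := (hasDerivWithinAt_derivWithin_lst hν hx le_rfl).derivWithin
    (uniqueDiffOn_Ici 0 0 self_mem_Ici)
  rw [secondDeriv₀, iteratedDerivWithin_succ, iteratedDerivWithin_one, h]
  simp

lemma contDiffOn_lst (hν : ∀ᵐ x ∂ν, 0 ≤ x) (hx : Integrable (fun x => x ^ 2) ν) :
    ContDiffOn ℝ 2 (lst ν) (Ici 0) := by
  have h1 : ContDiffOn ℝ 1 (derivWithin (lst ν) (Ici 0)) (Ici 0) := by
    rw [show (1 : WithTop ℕ∞) = 0 + 1 by norm_num, contDiffOn_succ_iff_derivWithin (uniqueDiffOn_Ici 0)]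
    refine ⟨fun s hs => (hasDerivWithinAt_derivWithin_lst hν hx hs).differentiableWithinAt,
      by simp, ?_⟩
    rw [contDiffOn_zero]
    exact (continuousOn_transform hν hx).congr fun s hs =>
      (hasDerivWithinAt_derivWithin_lst hν hx hs).derivWithin (uniqueDiffOn_Ici 0 s hs)
  rw [show (2 : WithTop ℕ∞) = 1 + 1 by norm_num, contDiffOn_succ_iff_derivWithin (uniqueDiffOn_Ici 0)]
  exact ⟨differentiableOn_lst hν (integrable_of_integrable_sq hx), by simp, h1⟩

lemma integrable_of_differentiableWithinAt_lst (hν : ∀ᵐ x ∂ν, 0 ≤ x)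
    (h : DifferentiableWithinAt ℝ (lst ν) (Ici 0) 0) : Integrable (fun x => x) ν := by
  rw [lst_eq_transform] at h
  simpa using integrable_of_differentiableWithinAt (w := fun _ => 1) hν (integrable_const _)
    (by simp) h

/-- Two applications of the Fatou argument. The first moment makes the identity an admissible
weight, and its transform is minus the derivative of `lst ν`. -/
lemma integrable_sq_of_contDiffOn_lst (hν : ∀ᵐ x ∂ν, 0 ≤ x)
    (h : ContDiffOn ℝ 2 (lst ν) (Ici 0)) : Integrable (fun x => x ^ 2) ν := by
  have hx := integrable_of_differentiableWithinAt_lst hν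
    (h.differentiableOn (by norm_num) 0 self_mem_Ici)
  have h1 : DifferentiableWithinAt ℝ (fun s => ∫ x, x * Real.exp (-(s * x)) ∂ν) (Ici 0) 0 := by
    rw [show (2 : WithTop ℕ∞) = 1 + 1 by norm_num, contDiffOn_succ_iff_derivWithin (uniqueDiffOn_Ici 0)] at h
    have h2 := (h.2.2.differentiableOn (by norm_num) 0 self_mem_Ici).neg
    refine h2.congr (fun s hs => ?_) ?_
    · rw [Pi.neg_apply, derivWithin_lst hν hx hs, neg_neg]
    · rw [Pi.neg_apply, derivWithin_lst hν hx le_rfl, neg_neg]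
  simpa [sq] using integrable_of_differentiableWithinAt hν hx hν h1

/-- No moment is required for `s > 0`: the point `-s` is interior to the domain of the moment
generating function. -/
lemma hasDerivAt_lst (hν : ∀ᵐ x ∂ν, 0 ≤ x) {s : ℝ} (hs : 0 < s) :
    HasDerivAt (lst ν) (-∫ x, x * Real.exp (-(s * x)) ∂ν) s := by
  have hset : Iic (0 : ℝ) ⊆ integrableExpSet id ν := fun t ht => by
    have := integrable_exp_neg_mul hν (neg_nonneg.2 ht)
    simpa [integrableExpSet] using this
  have hmem : -s ∈ interior (integrableExpSet id ν) :=
    interior_mono hset (by rw [interior_Iic]; simpa using hs)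
  have h := (hasDerivAt_mgf hmem).scomp s (hasDerivAt_neg s)
  have e : mgf id ν ∘ (fun t => -t) = lst ν := by
    funext t
    rw [Function.comp, mgf_neg_eq_lst aemeasurable_id, Measure.map_id]
  rw [e] at h
  have e2 : -∫ x, x * Real.exp (-(s * x)) ∂ν
      = (-1 : ℝ) • ∫ x, (fun ω => id ω * Real.exp (-s * id ω)) x ∂ν := by simp
  rw [e2]
  exact h

lemma integrable_mul_exp_neg (hν : ∀ᵐ x ∂ν, 0 ≤ x) {s : ℝ} (hs : 0 < s) :
    Integrable (fun x => x * Real.exp (-(s * x))) ν := by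
  refine Integrable.of_bound (C := 1 / s) (by fun_prop) ?_
  filter_upwards [hν] with x hx
  rw [Real.norm_eq_abs, abs_of_nonneg (by positivity), le_div_iff₀ hs, Real.exp_neg]
  rw [← div_eq_mul_inv, div_mul_eq_mul_div, div_le_one (Real.exp_pos _)]
  nlinarith [Real.add_one_le_exp (s * x)]

end Transform

/-! ### Transform of the cycle length. -/

section

variable {lam : ℝ} {νH νV κ : Measure ℝ} [IsProbabilityMeasure (expMeasure lam)]
  [IsProbabilityMeasure νH] [IsProbabilityMeasure νV] [IsProbabilityMeasure κ]

/-- Indices of the summands of the ends of the vacations in the first cycle. -/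
def vacIdx : ℕ → Idx
  | 0 => Sum.inr (Sum.inl 0)
  | j + 1 => Sum.inr (Sum.inr (0, j))

lemma vacIdx_injective : Function.Injective vacIdx := by
  rintro (_ | i) (_ | j) h <;> simp_all [vacIdx]

lemma vacEnd_eq_sum (z : Path) (j : ℕ) : vacEnd z j = ∑ i ∈ Finset.range (j + 2), z (vacIdx i) := by
  rw [Finset.sum_range_succ']
  simp only [vacEnd, vacationEnd, vacIdx, services, vacations]
  rw [add_comm]

lemma iIndepFun_vacIdx : iIndepFun (fun j (z : Path) => z (vacIdx j)) (pathLaw lam νH νV κ) :=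
  iIndepFun_pathLaw.precomp vacIdx_injective

/-- `vacEnd z j` is the opening service plus `j + 1` vacations, all independent. -/
lemma integral_exp_vacEnd (t : ℝ) (j : ℕ) :
    ∫ z, Real.exp (-(t * vacEnd z j)) ∂(pathLaw lam νH νV κ) = lst κ t * lst νV t ^ (j + 1) := by
  have h := iIndepFun_vacIdx.mgf_sum (μ := pathLaw lam νH νV κ) (t := -t)
    (fun i => measurable_pi_apply _) (Finset.range (j + 2))
  have e : ∀ i, mgf (fun z : Path => z (vacIdx i)) (pathLaw lam νH νV κ) (-t)
      = lst (marginal lam νH νV κ (vacIdx i)) t := fun i => by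
    rw [mgf_neg_eq_lst (measurable_pi_apply _).aemeasurable, pathLaw_map_apply]
  rw [Finset.prod_congr rfl fun i _ => e i, Finset.prod_range_succ'] at h
  have e0 : marginal lam νH νV κ (vacIdx 0) = κ := rfl
  have e1 : ∀ i, marginal lam νH νV κ (vacIdx (i + 1)) = νV := fun _ => rfl
  simp only [e0, e1, Finset.prod_const, Finset.card_range] at h
  rw [mul_comm, ← h, mgf]
  simp only [Finset.sum_apply, ← vacEnd_eq_sum, neg_mul]

lemma indepFun_vacEnd (j : ℕ) : IndepFun (fun z => vacEnd z j) (fun z => vacations z 0 (j + 1))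
    (pathLaw lam νH νV κ) := by
  have h := iIndepFun_vacIdx.indepFun_sum_range_succ (μ := pathLaw lam νH νV κ)
    (fun i => measurable_pi_apply _) (j + 2)
  convert! h using 1
  funext z
  rw [vacEnd_eq_sum, Finset.sum_apply]

lemma integral_vacEnd_mul (j : ℕ) {f g : ℝ → ℝ} (hf : Measurable f) (hg : Measurable g) :
    ∫ z, f (vacEnd z j) * g (vacations z 0 (j + 1)) ∂(pathLaw lam νH νV κ)
      = (∫ z, f (vacEnd z j) ∂(pathLaw lam νH νV κ)) * ∫ x, g x ∂νV := by
  have h := ((indepFun_vacEnd (lam := lam) (νH := νH) (νV := νV) (κ := κ) j).comp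
    hf hg).integral_fun_mul_eq_mul_integral
    (hf.comp (measurable_vacEnd j)).aestronglyMeasurable
    (hg.comp (measurable_vacations 0 (j + 1))).aestronglyMeasurable
  simp only [Function.comp_apply] at h
  rw [h]
  congr 1
  have h2 : (pathLaw lam νH νV κ).map (fun z => vacations z 0 (j + 1)) = νV :=
    pathLaw_map_apply (Sum.inr (Sum.inr (0, j + 1)))
  conv_rhs => rw [← h2]
  rw [integral_map (measurable_vacations 0 (j + 1)).aemeasurable hg.aestronglyMeasurable]

/-- `past 0` keeps the opening service and the vacations of the first cycle but no gap, so the first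
gap can be integrated out while these are held fixed. -/
lemma lintegral_past_gaps {F : Path × ℝ → ℝ≥0∞} (hF : Measurable F) :
    ∫⁻ z, F (past 0 z, gaps z 0) ∂(pathLaw lam νH νV κ)
      = ∫⁻ z, ∫⁻ x, F (past 0 z, x) ∂(expMeasure lam) ∂(pathLaw lam νH νV κ) := by
  have hG : Measurable fun q : Path × Path => F (q.1, q.2 (Sum.inl 0)) := by fun_prop
  have hpm : Measurable fun z : Path => (past 0 z, fun i => z (tailIdx 0 i)) :=
    (measurable_past 0).prodMk (measurable_pi_lambda _ fun i => measurable_pi_apply _)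
  have h1 : ∫⁻ z, F (past 0 z, gaps z 0) ∂(pathLaw lam νH νV κ)
      = ∫⁻ q, F (q.1, q.2 (Sum.inl 0)) ∂((pathLaw lam νH νV κ).map
          (fun z => (past 0 z, fun i => z (tailIdx 0 i)))) := by
    rw [lintegral_map hG hpm]; rfl
  rw [h1, map_past_tailIdx, lintegral_prod _ hG.aemeasurable,
    lintegral_map (Measurable.lintegral_prod_right' hG) (measurable_past 0)]
  refine lintegral_congr fun z => ?_
  have h2 : (pathLaw lam νH νV νH).map (fun z => z (Sum.inl 0)) = expMeasure lam :=
    pathLaw_map_apply (Sum.inl 0)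
  rw [← h2, lintegral_map (by fun_prop) (measurable_pi_apply _)]

lemma lt_sInf_iff {z : Path} (hz : Good z) (j : ℕ) :
    j < sInf {j | gaps z 0 ≤ vacEnd z j} ↔ vacEnd z j < gaps z 0 := by
  constructor
  · intro h; exact not_le.1 (Nat.notMem_of_lt_sInf h)
  · intro h
    by_contra! h2
    have h3 := Nat.sInf_mem hz.exists_vacEnd
    have h4 := hz.vacEnd_mono h2
    exact absurd h (not_lt.2 (h3.trans h4))

/-- With service and vacations held fixed, the first gap outlasts `vacEnd z j` with probability `exp
(-lam * vacEnd z j)`. The factor `D` is allowed because it ignores the gaps. -/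
lemma lintegral_indicator_vacEnd_lt (hlam : 0 < lam) (hg : ∀ᵐ z ∂(pathLaw lam νH νV κ), Good z)
    (j : ℕ) {D : Path → ℝ} (hD : Measurable D) (hD' : ∀ z, D (past 0 z) = D z)
    (hD0 : ∀ᵐ z ∂(pathLaw lam νH νV κ), 0 ≤ D z) :
    ∫⁻ z, {z | vacEnd z j < gaps z 0}.indicator (fun z => ENNReal.ofReal (D z)) z
        ∂(pathLaw lam νH νV κ)
      = ∫⁻ z, ENNReal.ofReal (D z * Real.exp (-(lam * vacEnd z j))) ∂(pathLaw lam νH νV κ) := by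
  set F : Path × ℝ → ℝ≥0∞ := {q | vacEnd q.1 j < q.2}.indicator fun q => ENNReal.ofReal (D q.1)
    with hF
  have hFm : Measurable F := by
    refine Measurable.indicator (by fun_prop) ?_
    exact measurableSet_lt ((measurable_vacEnd j).comp measurable_fst) measurable_snd
  have h1 := lintegral_past_gaps (lam := lam) (νH := νH) (νV := νV) (κ := κ) hFm
  have e : ∀ z x, F (past 0 z, x) = (Ioi (vacEnd z j)).indicator
      (fun _ => ENNReal.ofReal (D z)) x := fun z x => by
    simp only [hF, indicator, Set.mem_ofPred_eq, past_vacEnd, hD', mem_Ioi]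
  simp only [e] at h1
  refine Eq.trans ?_ (h1.trans ?_)
  · rfl
  · refine lintegral_congr_ae ?_
    filter_upwards [hg, hD0] with z hz hz0
    rw [lintegral_indicator_const measurableSet_Ioi, expMeasure_Ioi hlam
      ((hz.services_nonneg 0).trans (hz.services_le_vacEnd j)), ENNReal.ofReal_mul hz0]

/-- The indicators are 1 exactly for the indices before the vacation that ends the cycle, so the
series is a finite telescoping sum. Stating it additively in `ℝ≥0∞` allows integration term by term
without any summability question. -/
lemma exp_vacEnd_telescope {z : Path} (hz : Good z) {s : ℝ} (hs : 0 ≤ s) :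
    ENNReal.ofReal (Real.exp (-(s * firstCycle z)))
      + ∑' j, {z | vacEnd z j < gaps z 0}.indicator (fun z => ENNReal.ofReal
        (Real.exp (-(s * vacEnd z j)) - Real.exp (-(s * vacEnd z (j + 1))))) z
      = ENNReal.ofReal (Real.exp (-(s * vacEnd z 0))) := by
  have hnn : ∀ j, 0 ≤ Real.exp (-(s * vacEnd z j)) - Real.exp (-(s * vacEnd z (j + 1))) := by
    intro j
    rw [sub_nonneg, Real.exp_le_exp, neg_le_neg_iff]
    exact mul_le_mul_of_nonneg_left (hz.vacEnd_mono j.le_succ) hs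
  rw [tsum_eq_sum (s := Finset.range (sInf {j | gaps z 0 ≤ vacEnd z j}))]
  · rw [Finset.sum_congr rfl (fun j hj => indicator_of_mem
      (by simpa [lt_sInf_iff hz] using hj) _),
      ← ENNReal.ofReal_sum_of_nonneg fun j _ => hnn j, Finset.sum_range_sub',
      ← ENNReal.ofReal_add (Real.exp_pos _).le]
    · congr 1
      rw [firstCycle]; ring
    · rw [← Finset.sum_range_sub' fun j => Real.exp (-(s * vacEnd z j))]
      exact Finset.sum_nonneg fun j _ => hnn j
  · intro j hj
    rw [indicator_of_notMem]
    simpa [lt_sInf_iff hz] using hj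

/-- Transform of the length of the first cycle. -/
lemma integral_exp_firstCycle (hlam : 0 < lam) (hV : ∀ᵐ x ∂νV, 0 ≤ x) (hV0 : νV {0} ≠ 1)
    (hg : ∀ᵐ z ∂(pathLaw lam νH νV κ), Good z) {s : ℝ} (hs : 0 ≤ s) :
    ∫ z, Real.exp (-(s * firstCycle z)) ∂(pathLaw lam νH νV κ)
      = cycleLST lam (lst κ) (lst νV) s := by
  set μ := pathLaw lam νH νV κ with hμ
  have hr := lst_lt_one hV hV0 (show 0 < s + lam by linarith)
  have hr0 := lst_nonneg νV (s + lam)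
  have hbdd : ∀ (f : Path → ℝ), Measurable f → (∀ z, Good z → 0 ≤ f z) → ∀ t : ℝ, 0 ≤ t →
      Integrable (fun z => Real.exp (-(t * f z))) μ := fun f hf hf0 t ht => by
    refine Integrable.of_bound (C := 1) (by fun_prop) ?_
    filter_upwards [hg] with z hz
    rw [Real.norm_eq_abs, abs_of_pos (Real.exp_pos _), Real.exp_le_one_iff]
    nlinarith [mul_nonneg ht (hf0 z hz)]
  have hW0 : ∀ j z, Good z → 0 ≤ vacEnd z j := fun j z hz =>
    (hz.services_nonneg 0).trans (hz.services_le_vacEnd j)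
  have hle1 : lst νV s ≤ 1 := by
    have := integral_mono_ae (integrable_exp_neg_mul hV hs) (integrable_const (1 : ℝ))
      (by filter_upwards [hV] with x hx
          rw [Real.exp_le_one_iff]; nlinarith [mul_nonneg hs hx])
    simpa [lst] using this
  have hterm : ∀ j, ∫⁻ z, {z | vacEnd z j < gaps z 0}.indicator (fun z => ENNReal.ofReal
        (Real.exp (-(s * vacEnd z j)) - Real.exp (-(s * vacEnd z (j + 1))))) z ∂μ
      = ENNReal.ofReal (lst κ (s + lam) * lst νV (s + lam) ^ (j + 1) * (1 - lst νV s)) := by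
    intro j
    have hd : ∀ᵐ z ∂μ, 0 ≤ Real.exp (-(s * vacEnd z j)) - Real.exp (-(s * vacEnd z (j + 1))) := by
      filter_upwards [hg] with z hz
      rw [sub_nonneg, Real.exp_le_exp, neg_le_neg_iff]
      exact mul_le_mul_of_nonneg_left (hz.vacEnd_mono j.le_succ) hs
    rw [hμ, lintegral_indicator_vacEnd_lt hlam hg j (D := fun z => Real.exp (-(s * vacEnd z j))
      - Real.exp (-(s * vacEnd z (j + 1)))) (by fun_prop) (fun z => by simp only [past_vacEnd]) hd,
      ← ofReal_integral_eq_lintegral_ofReal]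
    · congr 1
      -- Splitting off vacation `j + 1` separates independent factors, and the survival probability
      -- raises the exponent at `vacEnd z j` from `s` to `s + lam`.
      have e : ∀ z, (Real.exp (-(s * vacEnd z j)) - Real.exp (-(s * vacEnd z (j + 1))))
            * Real.exp (-(lam * vacEnd z j))
          = Real.exp (-((s + lam) * vacEnd z j)) * (1 - Real.exp (-(s * vacations z 0 (j + 1)))) := by
        intro z
        rw [Good.vacEnd_succ, mul_sub, sub_mul, ← Real.exp_add, ← Real.exp_add, ← Real.exp_add,
          mul_one]
        congr 2 <;> ring
      simp only [e]
      rw [integral_vacEnd_mul j (f := fun x => Real.exp (-((s + lam) * x)))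
        (g := fun x => 1 - Real.exp (-(s * x))) (by fun_prop) (by fun_prop), integral_exp_vacEnd,
        integral_sub (integrable_const _) (integrable_exp_neg_mul hV hs)]
      simp [lst]
    · have h1 := (hbdd _ (measurable_vacEnd j) (hW0 j) s hs).sub
        (hbdd _ (measurable_vacEnd (j + 1)) (hW0 (j + 1)) s hs)
      refine h1.mul_bdd (c := 1) (by fun_prop) ?_
      filter_upwards [hg] with z hz
      rw [Real.norm_eq_abs, abs_of_pos (Real.exp_pos _), Real.exp_le_one_iff]
      nlinarith [mul_nonneg hlam.le (hW0 j z hz)]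
    · filter_upwards [hd] with z hz
      exact mul_nonneg hz (Real.exp_pos _).le
  have h0 : ∀ j, 0 ≤ lst κ (s + lam) * lst νV (s + lam) ^ (j + 1) * (1 - lst νV s) := fun j =>
    mul_nonneg (mul_nonneg (lst_nonneg _ _) (pow_nonneg hr0 _)) (by linarith)
  have hsum : HasSum (fun j => lst κ (s + lam) * lst νV (s + lam) ^ (j + 1) * (1 - lst νV s))
      (lst κ (s + lam) * (lst νV (s + lam) * (1 - lst νV s) / (1 - lst νV (s + lam)))) := by
    have h1 := (hasSum_geometric_of_lt_one hr0 hr).mul_left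
      (lst κ (s + lam) * lst νV (s + lam) * (1 - lst νV s))
    convert! h1 using 1
    · funext j; ring
    · rw [div_eq_mul_inv]; ring
  have htot := lintegral_congr_ae (hg.mono fun z hz => exp_vacEnd_telescope hz hs)
  rw [lintegral_add_left (by fun_prop), lintegral_tsum] at htot
  · simp only [hterm] at htot
    rw [← ENNReal.ofReal_tsum_of_nonneg h0 hsum.summable, hsum.tsum_eq,
      ← ofReal_integral_eq_lintegral_ofReal
        (hbdd _ measurable_firstCycle (fun z hz => hz.firstCycle_pos.le) s hs)
        (ae_of_all _ fun _ => (Real.exp_pos _).le),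
      ← ofReal_integral_eq_lintegral_ofReal (hbdd _ (measurable_vacEnd 0) (hW0 0) s hs)
        (ae_of_all _ fun _ => (Real.exp_pos _).le),
      ← ENNReal.ofReal_add (integral_nonneg fun _ => (Real.exp_pos _).le) (hsum.nonneg h0),
      ENNReal.ofReal_eq_ofReal_iff (add_nonneg (integral_nonneg fun _ => (Real.exp_pos _).le)
        (hsum.nonneg h0)) (integral_nonneg fun _ => (Real.exp_pos _).le), hμ,
      integral_exp_vacEnd] at htot
    rw [cycleLST, hμ, eq_sub_iff_add_eq.2 htot, add_comm lam s]
    ring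
  · intro j
    refine (Measurable.indicator (by fun_prop) ?_).aemeasurable
    exact measurableSet_lt (measurable_vacEnd j) (measurable_gaps 0)

end

/-! ### Integrals against the exponential law. -/

section

variable {lam : ℝ}

lemma lintegral_expMeasure {g : ℝ → ℝ≥0∞} (hg : Measurable g) :
    ∫⁻ x, g x ∂(expMeasure lam) = ∫⁻ x, exponentialPDF lam x * g x := by
  rw [expMeasure_eq_withDensity, lintegral_withDensity_eq_lintegral_mul _ measurable_exponentialPDF
    hg]
  rfl

/-- On the interval the density times `exp (-λ (c - x))` no longer depends on `x`; only the length
`c - b` remains. -/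
lemma lintegral_expMeasure_Ioc (hlam : 0 < lam) {b c : ℝ} (hb : 0 ≤ b) :
    ∫⁻ x, (Ioc b c).indicator (fun x => ENNReal.ofReal (Real.exp (-(lam * (c - x))))) x
        ∂(expMeasure lam)
      = ENNReal.ofReal (lam * Real.exp (-(lam * c)) * (c - b)) := by
  rw [lintegral_expMeasure (Measurable.indicator (by fun_prop) measurableSet_Ioc)]
  have e : ∀ x, exponentialPDF lam x
        * (Ioc b c).indicator (fun x => ENNReal.ofReal (Real.exp (-(lam * (c - x))))) x
      = (Ioc b c).indicator (fun _ => ENNReal.ofReal (lam * Real.exp (-(lam * c)))) x := by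
    intro x
    by_cases hx : x ∈ Ioc b c
    · rw [indicator_of_mem hx, indicator_of_mem hx,
        exponentialPDF_of_nonneg (hb.trans hx.1.le),
        ← ENNReal.ofReal_mul (mul_nonneg hlam.le (Real.exp_pos _).le), mul_assoc, ← Real.exp_add]
      congr 3; ring
    · rw [indicator_of_notMem hx, indicator_of_notMem hx, mul_zero]
  simp only [e]
  rw [lintegral_indicator_const measurableSet_Ioc, Real.volume_Ioc,
    ← ENNReal.ofReal_mul (mul_nonneg hlam.le (Real.exp_pos _).le)]

lemma expMeasure_Iic (hlam : 0 < lam) {d : ℝ} (hd : 0 ≤ d) :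
    expMeasure lam (Iic d) = ENNReal.ofReal (1 - Real.exp (-(lam * d))) := by
  have := isProbabilityMeasure_expMeasure hlam
  rw [← compl_Ioi, prob_compl_eq_one_sub measurableSet_Ioi, expMeasure_Ioi hlam hd,
    ENNReal.ofReal_sub _ (Real.exp_pos _).le, ENNReal.ofReal_one]

lemma setLIntegral_exp_mul (hlam : 0 < lam) {g : ℝ → ℝ≥0∞} (hg : Measurable g) :
    ∫⁻ x in Ioi 0, ENNReal.ofReal (Real.exp (-(lam * x))) * g x
      = ENNReal.ofReal (1 / lam) * ∫⁻ x, g x ∂(expMeasure lam) := by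
  rw [lintegral_expMeasure hg, ← lintegral_const_mul _
      (show Measurable fun x => exponentialPDF lam x * g x from measurable_exponentialPDF.mul hg),
    ← lintegral_indicator measurableSet_Ioi]
  have h0 : ∀ᵐ x : ℝ ∂volume, x ≠ 0 := by simp [ae_iff]
  refine lintegral_congr_ae ?_
  filter_upwards [h0] with x hx
  rcases lt_or_gt_of_ne hx with hx | hx
  · rw [indicator_of_notMem (by simpa using hx.le), exponentialPDF_of_neg hx, zero_mul, mul_zero]
  · rw [indicator_of_mem (by simpa using hx), exponentialPDF_of_nonneg hx.le, ← mul_assoc,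
      ← ENNReal.ofReal_mul (by positivity)]
    congr 2
    field_simp

end

/-! ### The mean waiting time. -/

section

variable {lam : ℝ} {νH νV κ : Measure ℝ} [IsProbabilityMeasure (expMeasure lam)]
  [IsProbabilityMeasure νH] [IsProbabilityMeasure νV] [IsProbabilityMeasure κ]

/-- Arrival times of a good path increase strictly, so `u z` lies between consecutive arrivals for
at most one `n`: the sets are disjoint up to a null set. -/
lemma measure_iUnion_arr (hg : ∀ᵐ z ∂(pathLaw lam νH νV κ), Good z) (u : Path → ℝ)
    {F : ℕ → Set Path} (hF : ∀ n, MeasurableSet (F n))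
    (hFu : ∀ n, ∀ z ∈ F n, arr z n ≤ u z ∧ u z < arr z (n + 1)) :
    pathLaw lam νH νV κ (⋃ n, F n) = ∑' n, pathLaw lam νH νV κ (F n) := by
  refine measure_iUnion₀ (fun i j hij => ?_) fun n => (hF n).nullMeasurableSet
  change pathLaw lam νH νV κ (F i ∩ F j) = 0
  refine measure_mono_null (t := {z | ¬ Good z}) (fun z hz hgood => ?_) hg
  have hi := hFu i z hz.1
  have hj := hFu j z hz.2
  rcases lt_or_gt_of_ne hij with h | h
  · have := hgood.arr_strictMono.monotone h
    linarith
  · have := hgood.arr_strictMono.monotone h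
    linarith

/-- A wait of at least `x` means that something has arrived by time `firstCycle z - x` and nothing
after it up to the end of the cycle. Given that arrival `n` is the last one by that time, the gap
after it has to last `x` longer, which costs the factor `exp (-lam * x)`. The cycle length depends
on the gaps only through gap 0, so it belongs to the past of gap `n + 1`. -/
lemma measure_le_firstWait (hg : ∀ᵐ z ∂(pathLaw lam νH νV κ), Good z) {x : ℝ} (hx : 0 ≤ x) :
    pathLaw lam νH νV κ {z | x ≤ firstWait z} = ENNReal.ofReal (Real.exp (-(lam * x)))
      * pathLaw lam νH νV κ {z | x ≤ firstCycle z - gaps z 0} := by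
  set μ := pathLaw lam νH νV κ with hμ
  have hEm : ∀ n, MeasurableSet {z | arr z n ≤ firstCycle z - x} := fun n =>
    measurableSet_le (measurable_arr n) (by fun_prop)
  -- Arrival `n` has occurred by `firstCycle z - x`, and the next one comes after `firstCycle z -
  -- y`. The case `y = 0` describes the event on the left and `y = x` the one on the right.
  have hA : ∀ y, 0 ≤ y → y ≤ x → ∀ n, μ {z | z ∈ {z | arr z n ≤ firstCycle z - x} ∧
        firstCycle z - y - arr z n < gaps z (n + 1)
          ∧ residual (n + 1) (firstCycle z - y - arr z n) z ∈ univ}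
      = ∫⁻ z in {z | arr z n ≤ firstCycle z - x},
          ENNReal.ofReal (Real.exp (-(lam * (firstCycle z - y - arr z n)))) ∂μ := by
    intro y hy hyx n
    have h := measure_residual (lam := lam) (νH := νH) (νV := νV) (κ := κ) (n + 1)
      (A := fun z => firstCycle z - y - arr z n) (by fun_prop)
      (fun z => by rw [past_firstCycle n.succ_pos, past_arr n.lt_succ_self]) (hEm n)
      (fun z => by simp only [Set.mem_ofPred_eq, past_firstCycle n.succ_pos,
          past_arr n.lt_succ_self])
      (fun z hz => by have : arr z n ≤ firstCycle z - x := hz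
                      linarith) MeasurableSet.univ
    rw [h, measure_univ, mul_one]
  have hFm : ∀ y n, MeasurableSet {z | z ∈ {z | arr z n ≤ firstCycle z - x} ∧
        firstCycle z - y - arr z n < gaps z (n + 1)
          ∧ residual (n + 1) (firstCycle z - y - arr z n) z ∈ univ} := fun y n => by
    simp only [mem_univ, and_true]
    exact (hEm n).inter (measurableSet_lt (by fun_prop) (measurable_gaps _))
  have h1 : {z | x ≤ firstWait z} =ᵐ[μ] ⋃ n, {z | z ∈ {z | arr z n ≤ firstCycle z - x} ∧
        firstCycle z - 0 - arr z n < gaps z (n + 1)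
          ∧ residual (n + 1) (firstCycle z - 0 - arr z n) z ∈ univ} := by
    refine eventuallyEq_set.2 ?_
    filter_upwards [hg] with z hz
    simp only [mem_univ, and_true, mem_iUnion, Set.mem_ofPred_eq, sub_zero]
    constructor
    · intro h
      refine ⟨count z - 1, by rw [firstWait] at h; linarith, ?_⟩
      have h2 := hz.firstCycle_lt_arr
      obtain ⟨k, hk⟩ := Nat.exists_eq_add_of_lt hz.count_pos
      rw [zero_add] at hk
      rw [hk, Good.arr_succ] at h2
      rw [hk, Nat.add_sub_cancel]
      linarith
    · rintro ⟨n, hn, hn'⟩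
      have h3 : count z = n + 1 := (hz.count_eq_iff n).2
        ⟨by linarith, by rw [Good.arr_succ]; linarith⟩
      rw [firstWait, h3, Nat.add_sub_cancel]
      linarith
  have h2 : {z | x ≤ firstCycle z - gaps z 0} =ᵐ[μ]
      ⋃ n, {z | z ∈ {z | arr z n ≤ firstCycle z - x} ∧
        firstCycle z - x - arr z n < gaps z (n + 1)
          ∧ residual (n + 1) (firstCycle z - x - arr z n) z ∈ univ} := by
    refine eventuallyEq_set.2 ?_
    filter_upwards [hg] with z hz
    simp only [mem_univ, and_true, mem_iUnion, Set.mem_ofPred_eq]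
    constructor
    · intro h
      obtain ⟨m, hm⟩ := (hz.arr_atTop.eventually_gt_atTop (firstCycle z - x)).exists
      classical
      have hex : ∃ m, firstCycle z - x < arr z m := ⟨m, hm⟩
      have hf := Nat.find_spec hex
      rcases hk : Nat.find hex with _ | k
      · rw [hk, Good.arr_zero] at hf; linarith
      · have h4 := Nat.find_min hex (show k < Nat.find hex by omega)
        rw [hk, Good.arr_succ] at hf
        exact ⟨k, not_lt.1 h4, by linarith⟩
    · rintro ⟨n, hn, _⟩
      have := hz.arr_strictMono.monotone (Nat.zero_le n)
      rw [Good.arr_zero] at this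
      linarith
  rw [measure_congr h1, measure_congr h2,
    measure_iUnion_arr hg firstCycle (hFm 0), measure_iUnion_arr hg (fun z => firstCycle z - x)
      (hFm x), ← ENNReal.tsum_mul_left]
  · refine tsum_congr fun n => ?_
    rw [← hμ, hA 0 le_rfl hx n, hA x hx le_rfl n, ← lintegral_const_mul _ (by fun_prop)]
    refine lintegral_congr fun z => ?_
    rw [← ENNReal.ofReal_mul (Real.exp_pos _).le, ← Real.exp_add]
    congr 2; ring
  · rintro n z ⟨h3, h4, _⟩
    rw [Good.arr_succ]
    exact ⟨h3, by linarith⟩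
  · rintro n z ⟨h3, h4, _⟩
    have h3' : arr z n ≤ firstCycle z - x := h3
    rw [Good.arr_succ]
    exact ⟨by linarith, by linarith⟩

/-- Layer-cake formula. The integral of `exp (-lam * x)` times the tail of `firstCycle z - gaps z 0`
is `1 / lam` times the probability that an independent exponential variable does not exceed
`firstCycle z - gaps z 0`. -/
lemma lintegral_firstWait (hlam : 0 < lam) (hg : ∀ᵐ z ∂(pathLaw lam νH νV κ), Good z) :
    ∫⁻ z, ENNReal.ofReal (firstWait z) ∂(pathLaw lam νH νV κ)
      = ENNReal.ofReal (1 / lam) * ∫⁻ z, ENNReal.ofReal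
          (1 - Real.exp (-(lam * (firstCycle z - gaps z 0)))) ∂(pathLaw lam νH νV κ) := by
  have hD : MeasurableSet {q : ℝ × Path | q.1 ≤ firstCycle q.2 - gaps q.2 0} :=
    measurableSet_le measurable_fst (by fun_prop)
  have hgm : Measurable fun x => pathLaw lam νH νV κ {z | x ≤ firstCycle z - gaps z 0} :=
    measurable_measure_prodMk_left hD
  rw [lintegral_eq_lintegral_meas_le _ (hg.mono fun z hz => hz.firstWait_nonneg)
    measurable_firstWait.aemeasurable, setLIntegral_congr_fun measurableSet_Ioi
      (fun x hx => measure_le_firstWait hg (le_of_lt hx)), setLIntegral_exp_mul hlam hgm]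
  congr 1
  have e := Measure.prod_apply (μ := expMeasure lam) (ν := pathLaw lam νH νV κ) hD
  rw [Measure.prod_apply_symm hD] at e
  refine e.symm.trans (lintegral_congr_ae ?_)
  filter_upwards [hg] with z hz
  rw [← expMeasure_Iic hlam (sub_nonneg.2 hz.gaps_le_firstCycle)]
  rfl

/-- The end of the vacation before the `j`-th one, or `0` if `j = 0`. -/
def vacStart (z : Path) : ℕ → ℝ
  | 0 => 0
  | j + 1 => vacEnd z j

lemma measurable_vacStart (j : ℕ) : Measurable fun z => vacStart z j := by
  rcases j with _ | j
  · exact measurable_const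
  · exact measurable_vacEnd j

lemma past_vacStart (n : ℕ) (z : Path) (j : ℕ) : vacStart (past n z) j = vacStart z j := by
  rcases j with _ | j
  · rfl
  · exact past_vacEnd n z j

lemma vacStart_nonneg {z : Path} (hz : Good z) (j : ℕ) : 0 ≤ vacStart z j := by
  rcases j with _ | j
  · exact le_rfl
  · exact (hz.services_nonneg 0).trans (hz.services_le_vacEnd j)

/-- Only one term is nonzero: the first gap lies in the interval of the vacation that ends the cycle
and in no other. Positivity of the gap puts it inside `(0, vacEnd z 0]` when that vacation is the
first. -/
lemma exp_firstCycle_sub_gaps {z : Path} (hz : Good z) :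
    ENNReal.ofReal (Real.exp (-(lam * (firstCycle z - gaps z 0))))
      = ∑' j, (Ioc (vacStart z j) (vacEnd z j)).indicator
          (fun x => ENNReal.ofReal (Real.exp (-(lam * (vacEnd z j - x))))) (gaps z 0) := by
  rw [tsum_eq_single (sInf {j | gaps z 0 ≤ vacEnd z j}), indicator_of_mem]
  · rfl
  · refine ⟨?_, Nat.sInf_mem hz.exists_vacEnd⟩
    rcases hk : sInf {j | gaps z 0 ≤ vacEnd z j} with _ | k
    · exact hz.gaps_pos 0
    · exact (lt_sInf_iff hz k).1 (by omega)
  · intro j hj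
    rw [indicator_of_notMem]
    rintro ⟨h1, h2⟩
    refine hj (le_antisymm ?_ (Nat.sInf_le h2))
    rcases j with _ | k
    · exact Nat.zero_le _
    · exact (lt_sInf_iff hz k).2 h1

lemma lintegral_exp_firstCycle_sub_gaps (hlam : 0 < lam)
    (hg : ∀ᵐ z ∂(pathLaw lam νH νV κ), Good z) :
    ∫⁻ z, ENNReal.ofReal (Real.exp (-(lam * (firstCycle z - gaps z 0)))) ∂(pathLaw lam νH νV κ)
      = ∑' j, ∫⁻ z, ENNReal.ofReal (lam * Real.exp (-(lam * vacEnd z j))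
          * (vacEnd z j - vacStart z j)) ∂(pathLaw lam νH νV κ) := by
  have hFm : ∀ j, Measurable fun q : Path × ℝ => (Ioc (vacStart q.1 j) (vacEnd q.1 j)).indicator
      (fun x => ENNReal.ofReal (Real.exp (-(lam * (vacEnd q.1 j - x))))) q.2 := by
    intro j
    have hm : MeasurableSet {q : Path × ℝ | vacStart q.1 j < q.2 ∧ q.2 ≤ vacEnd q.1 j} :=
      (measurableSet_lt ((measurable_vacStart j).comp measurable_fst) measurable_snd).inter
        (measurableSet_le measurable_snd ((measurable_vacEnd j).comp measurable_fst))
    exact Measurable.indicator (f := fun q : Path × ℝ =>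
      ENNReal.ofReal (Real.exp (-(lam * (vacEnd q.1 j - q.2))))) (by fun_prop) hm
  rw [lintegral_congr_ae (hg.mono fun z hz => exp_firstCycle_sub_gaps hz), lintegral_tsum]
  · refine tsum_congr fun j => ?_
    have h := lintegral_past_gaps (lam := lam) (νH := νH) (νV := νV) (κ := κ) (hFm j)
    simp only [past_vacStart, past_vacEnd] at h
    rw [h]
    refine lintegral_congr_ae ?_
    filter_upwards [hg] with z hz
    exact lintegral_expMeasure_Ioc hlam (vacStart_nonneg hz j)
  · intro j
    exact ((hFm j).comp (measurable_id.prodMk (measurable_gaps 0))).aemeasurable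

/-- The transform of `vacEnd z 0` is the product of the two transforms; the mean is minus its
derivative, which exists at `s > 0` without moment assumptions. -/
lemma integral_vacEnd_zero_mul_exp (hκ : ∀ᵐ x ∂κ, 0 ≤ x) (hV : ∀ᵐ x ∂νV, 0 ≤ x)
    (hg : ∀ᵐ z ∂(pathLaw lam νH νV κ), Good z) {s : ℝ} (hs : 0 < s) :
    Integrable (fun z => vacEnd z 0 * Real.exp (-(s * vacEnd z 0))) (pathLaw lam νH νV κ) ∧
    ∫ z, vacEnd z 0 * Real.exp (-(s * vacEnd z 0)) ∂(pathLaw lam νH νV κ)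
      = -(deriv (lst κ) s * lst νV s + lst κ s * deriv (lst νV) s) := by
  set ρ := (pathLaw lam νH νV κ).map fun z => vacEnd z 0 with hρ
  have hm : AEMeasurable (fun z => vacEnd z 0) (pathLaw lam νH νV κ) :=
    (measurable_vacEnd 0).aemeasurable
  have : IsProbabilityMeasure ρ := Measure.isProbabilityMeasure_map hm
  have hρ0 : ∀ᵐ x ∂ρ, 0 ≤ x := by
    rw [hρ, ae_map_iff hm measurableSet_Ici]
    filter_upwards [hg] with z hz
    exact (hz.services_nonneg 0).trans (hz.services_le_vacEnd 0)
  have h1 : lst ρ = fun t => lst κ t * lst νV t := by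
    funext t
    rw [lst, hρ, integral_map hm (by fun_prop), integral_exp_vacEnd]
    simp
  have h2 := hasDerivAt_lst hρ0 hs
  rw [h1] at h2
  have h3 := h2.unique ((hasDerivAt_lst hκ hs).differentiableAt.hasDerivAt.mul
    (hasDerivAt_lst hV hs).differentiableAt.hasDerivAt)
  constructor
  · exact (integrable_mul_exp_neg hρ0 hs).comp_aemeasurable hm
  · rw [← h3, neg_neg, hρ, integral_map hm (by fun_prop)]

/-- Mean waiting time of the packet that is served at the end of the first cycle. -/
lemma integral_firstWait (hlam : 0 < lam) (hκ : ∀ᵐ x ∂κ, 0 ≤ x) (hV : ∀ᵐ x ∂νV, 0 ≤ x)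
    (hV0 : νV {0} ≠ 1) (hg : ∀ᵐ z ∂(pathLaw lam νH νV κ), Good z) :
    Integrable firstWait (pathLaw lam νH νV κ) ∧
    ∫ z, firstWait z ∂(pathLaw lam νH νV κ) = meanWaiting lam (lst κ) (lst νV) := by
  set μ := pathLaw lam νH νV κ with hμ
  have hr := lst_lt_one hV hV0 hlam
  have hr0 := lst_nonneg νV lam
  have hdV := (hasDerivAt_lst hV hlam).deriv
  have hdV0 : deriv (lst νV) lam ≤ 0 := by
    rw [hdV, neg_nonpos]
    exact integral_nonneg_of_ae (hV.mono fun x hx => mul_nonneg hx (Real.exp_pos _).le)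
  have hW0 := integral_vacEnd_zero_mul_exp (lam := lam) (νH := νH) hκ hV hg hlam
  have hvac0 : ∀ j z, Good z → 0 ≤ vacEnd z j := fun j z hz =>
    (hz.services_nonneg 0).trans (hz.services_le_vacEnd j)
  set d0 := deriv (lst κ) lam * lst νV lam + lst κ lam * deriv (lst νV) lam with hd0
  have hd0' : d0 ≤ 0 := by
    rw [← neg_nonneg, ← hW0.2]
    exact integral_nonneg_of_ae (hg.mono fun z hz => mul_nonneg (hvac0 0 z hz) (Real.exp_pos _).le)
  -- Contribution of vacation `j + 1`: the transform of `vacEnd z j` at `lam`, times `lam` times the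
  -- mean of `v * exp (-lam * v)` for a vacation `v`, which is minus the derivative of `lst νV` at
  -- `lam`.
  set c : ℕ → ℝ := fun j => -(lam * deriv (lst νV) lam * (lst κ lam * lst νV lam ^ (j + 1)))
    with hc
  have hc0 : ∀ j, 0 ≤ c j := fun j => by
    have : 0 ≤ lam * (-deriv (lst νV) lam) * (lst κ lam * lst νV lam ^ (j + 1)) :=
      mul_nonneg (mul_nonneg hlam.le (by linarith))
        (mul_nonneg (lst_nonneg _ _) (pow_nonneg hr0 _))
    simp only [hc]; linarith
  -- The first interval stands apart from the geometric series, as it contains the opening service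
  -- as well as a vacation.
  have hterm0 : ∫⁻ z, ENNReal.ofReal (lam * Real.exp (-(lam * vacEnd z 0))
          * (vacEnd z 0 - vacStart z 0)) ∂μ = ENNReal.ofReal (-(lam * d0)) := by
    have e : ∀ z, lam * Real.exp (-(lam * vacEnd z 0)) * (vacEnd z 0 - vacStart z 0)
        = lam * (vacEnd z 0 * Real.exp (-(lam * vacEnd z 0))) := fun z => by
      rw [vacStart]; ring
    simp only [e]
    rw [← ofReal_integral_eq_lintegral_ofReal (hW0.1.const_mul lam), integral_const_mul, hW0.2]
    · congr 1; ring
    · exact hg.mono fun z hz => mul_nonneg hlam.le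
        (mul_nonneg (hvac0 0 z hz) (Real.exp_pos _).le)
  have hterm : ∀ j, ∫⁻ z, ENNReal.ofReal (lam * Real.exp (-(lam * vacEnd z (j + 1)))
          * (vacEnd z (j + 1) - vacStart z (j + 1))) ∂μ = ENNReal.ofReal (c j) := by
    intro j
    have e : ∀ z, lam * Real.exp (-(lam * vacEnd z (j + 1)))
          * (vacEnd z (j + 1) - vacStart z (j + 1))
        = (fun x => Real.exp (-(lam * x))) (vacEnd z j)
          * (fun x => lam * (x * Real.exp (-(lam * x)))) (vacations z 0 (j + 1)) := fun z => by
      simp only [vacStart, Good.vacEnd_succ, mul_add, neg_add, Real.exp_add]; ring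
    simp only [e]
    have hi := ((indepFun_vacEnd (lam := lam) (νH := νH) (νV := νV) (κ := κ) j).comp
      (φ := fun x => Real.exp (-(lam * x))) (ψ := fun x => lam * (x * Real.exp (-(lam * x))))
      (by fun_prop) (by fun_prop)).integrable_mul (Integrable.of_bound (C := 1)
        (by fun_prop) (hg.mono fun z hz => by
          rw [Function.comp, Real.norm_eq_abs, abs_of_pos (Real.exp_pos _), Real.exp_le_one_iff]
          nlinarith [mul_nonneg hlam.le (hvac0 j z hz)]))
      (by
        have h1 : Integrable (fun x => lam * (x * Real.exp (-(lam * x))))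
            (μ.map fun z => vacations z 0 (j + 1)) := by
          have : μ.map (fun z => vacations z 0 (j + 1)) = νV :=
            pathLaw_map_apply (Sum.inr (Sum.inr (0, j + 1)))
          rw [this]
          exact (integrable_mul_exp_neg hV hlam).const_mul lam
        exact h1.comp_measurable (measurable_vacations 0 (j + 1)))
    rw [← ofReal_integral_eq_lintegral_ofReal]
    · congr 1
      rw [hμ, integral_vacEnd_mul j (f := fun x => Real.exp (-(lam * x)))
        (g := fun x => lam * (x * Real.exp (-(lam * x)))) (by fun_prop) (by fun_prop),
        integral_exp_vacEnd,
        integral_const_mul]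
      simp only [hc, hdV]
      ring
    · exact hi
    · exact hg.mono fun z hz => mul_nonneg (Real.exp_pos _).le (mul_nonneg hlam.le
        (mul_nonneg (hz.vacations_nonneg 0 (j + 1)) (Real.exp_pos _).le))
  have hsum : HasSum c (-(lam * (deriv (lst νV) lam / (1 - lst νV lam) * lst νV lam * lst κ lam))) := by
    have h1 := (hasSum_geometric_of_lt_one hr0 hr).mul_left
      (-(lam * deriv (lst νV) lam * lst κ lam * lst νV lam))
    convert! h1 using 1
    · funext j; simp only [hc]; ring
    · rw [div_eq_mul_inv]; ring
  have hexp : Integrable (fun z => Real.exp (-(lam * (firstCycle z - gaps z 0)))) μ := by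
    refine Integrable.of_bound (C := 1) (by fun_prop) ?_
    filter_upwards [hg] with z hz
    rw [Real.norm_eq_abs, abs_of_pos (Real.exp_pos _), Real.exp_le_one_iff]
    nlinarith [mul_nonneg hlam.le (sub_nonneg.2 hz.gaps_le_firstCycle)]
  have hm : ∫ z, Real.exp (-(lam * (firstCycle z - gaps z 0))) ∂μ
      = -(lam * d0) + -(lam * (deriv (lst νV) lam / (1 - lst νV lam) * lst νV lam * lst κ lam)) := by
    have h1 := lintegral_exp_firstCycle_sub_gaps (lam := lam) (νH := νH) (νV := νV) (κ := κ) hlam hg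
    rw [tsum_eq_zero_add' ENNReal.summable, ← hμ, hterm0] at h1
    simp only [hterm] at h1
    rw [← ENNReal.ofReal_tsum_of_nonneg hc0 hsum.summable, hsum.tsum_eq,
      ← ENNReal.ofReal_add (by nlinarith) (hsum.nonneg hc0),
      ← ofReal_integral_eq_lintegral_ofReal hexp (ae_of_all _ fun _ => (Real.exp_pos _).le),
      ENNReal.ofReal_eq_ofReal_iff (integral_nonneg fun _ => (Real.exp_pos _).le)
        (add_nonneg (by nlinarith) (hsum.nonneg hc0))] at h1
    exact h1
  have hnn : 0 ≤ᵐ[μ] fun z => 1 - Real.exp (-(lam * (firstCycle z - gaps z 0))) :=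
    hg.mono fun z hz => by
      refine sub_nonneg.2 ?_
      rw [Real.exp_le_one_iff]
      nlinarith [mul_nonneg hlam.le (sub_nonneg.2 hz.gaps_le_firstCycle)]
  have hlint := lintegral_firstWait (lam := lam) (νH := νH) (νV := νV) (κ := κ) hlam hg
  have hsub : Integrable (fun z => 1 - Real.exp (-(lam * (firstCycle z - gaps z 0)))) μ :=
    (integrable_const 1).sub hexp
  rw [← hμ, ← ofReal_integral_eq_lintegral_ofReal hsub hnn,
    ← ENNReal.ofReal_mul (by positivity), integral_sub (integrable_const 1) hexp, hm] at hlint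
  have hw0 : 0 ≤ᵐ[μ] firstWait := hg.mono fun z hz => hz.firstWait_nonneg
  have hint : Integrable firstWait μ := by
    refine ⟨measurable_firstWait.aestronglyMeasurable, ?_⟩
    rw [hasFiniteIntegral_iff_ofReal hw0, hlint]
    exact ENNReal.ofReal_lt_top
  refine ⟨hint, ?_⟩
  rw [← ofReal_integral_eq_lintegral_ofReal hint hw0] at hlint
  have hpos : 0 ≤ ∫ z, (1 - Real.exp (-(lam * (firstCycle z - gaps z 0)))) ∂μ :=
    integral_nonneg_of_ae hnn
  rw [integral_sub (integrable_const 1) hexp, hm] at hpos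
  rw [ENNReal.ofReal_eq_ofReal_iff (integral_nonneg_of_ae hw0)
    (mul_nonneg (by positivity) hpos)] at hlint
  rw [hlint, meanWaiting, hd0]
  simp only [integral_const, probReal_univ, smul_eq_mul, mul_one]
  field_simp
  ring

end

/-! ### Cycles of a sample path -/

section Iterate

variable {z : Path}

lemma arr_next (z : Path) (n : ℕ) : arr (next z) n = arr z (count z + n) - firstCycle z := by
  induction n with
  | zero => rw [Good.arr_zero]; rfl
  | succ n ih =>
    rw [Good.arr_succ, ih, ← add_assoc, Good.arr_succ]
    change _ + gaps z (count z + (n + 1)) = _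
    rw [← add_assoc]; ring

lemma exists_arr_next {y : ℝ} (hy : 0 < y) :
    (∃ n, arr z n = firstCycle z + y) ↔ ∃ n, arr (next z) n = y := by
  constructor
  · rintro ⟨n, hn⟩
    have h : count z ≤ n := by
      by_contra! h
      have := Good.arr_le_of_lt_count h
      linarith
    obtain ⟨k, rfl⟩ := Nat.exists_eq_add_of_le h
    exact ⟨k, by rw [arr_next, hn]; ring⟩
  · rintro ⟨n, hn⟩
    exact ⟨count z + n, by rw [arr_next] at hn; linarith⟩

/-- Beginning of the `l`-th cycle. -/
def cycleStart (z : Path) (l : ℕ) : ℝ := ∑ k ∈ Finset.range l, firstCycle (next^[k] z)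

lemma cycleStart_succ (z : Path) (l : ℕ) :
    cycleStart z (l + 1) = cycleStart z l + firstCycle (next^[l] z) := by
  rw [cycleStart, Finset.sum_range_succ]; rfl

lemma services_iterate (z : Path) (l k : ℕ) : services (next^[l] z) k = services z (l + k) := by
  induction l generalizing k with
  | zero => simp
  | succ l ih =>
    rw [Function.iterate_succ_apply']
    change services (next^[l] z) (k + 1) = _
    rw [ih]; congr 1; omega

lemma vacations_iterate (z : Path) (l k j : ℕ) :
    vacations (next^[l] z) k j = vacations z (l + k) j := by
  induction l generalizing k with
  | zero => simp
  | succ l ih =>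
    rw [Function.iterate_succ_apply']
    change vacations (next^[l] z) (k + 1) j = _
    rw [ih]; congr 1; omega

/-- Translates between `nextStart` and `genTime`, which search all arrivals in absolute time, and a
cycle, which knows only the inputs left to it. Positivity of `y` excludes arrivals that earlier
cycles have used up. -/
lemma exists_arr_iterate (hz : ∀ l, Good (next^[l] z)) (l : ℕ) {y : ℝ} (hy : 0 < y) :
    (∃ n, arr z n = cycleStart z l + y) ↔ ∃ n, arr (next^[l] z) n = y := by
  induction l generalizing y with
  | zero => simp [cycleStart]
  | succ l ih =>
    rw [Function.iterate_succ_apply', ← exists_arr_next hy, ← ih (by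
      have := (hz l).firstCycle_pos; linarith), cycleStart_succ, add_assoc]

lemma nextStart_eq (hz : ∀ l, Good (next^[l] z)) (l : ℕ) :
    nextStart (gaps z) (vacations z l) (cycleStart z l) (cycleStart z l + services z l)
      = cycleStart z (l + 1) := by
  have hv : ∀ j, vacationEnd (vacations z l) (cycleStart z l + services z l) j
      = cycleStart z l + vacEnd (next^[l] z) j := fun j => by
    simp only [vacationEnd, vacEnd, services_iterate, vacations_iterate, add_zero]
    ring
  have hset : {j : ℕ | ∃ n, arrival (gaps z) n ∈ Ioc (cycleStart z l)
        (vacationEnd (vacations z l) (cycleStart z l + services z l) j)}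
      = {j | gaps (next^[l] z) 0 ≤ vacEnd (next^[l] z) j} := by
    ext j
    simp only [Set.mem_ofPred_eq, hv, mem_Ioc]
    constructor
    · rintro ⟨n, h1, h2⟩
      obtain ⟨k, hk⟩ := (exists_arr_iterate hz l (y := arr z n - cycleStart z l)
        (sub_pos.2 h1)).1 ⟨n, by ring⟩
      have := (hz l).arr_strictMono.monotone (Nat.zero_le k)
      rw [Good.arr_zero, hk] at this
      have h2' : arr z n ≤ cycleStart z l + vacEnd (next^[l] z) j := h2
      linarith
    · intro h
      obtain ⟨n, hn⟩ := (exists_arr_iterate hz l ((hz l).gaps_pos 0)).2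
        ⟨0, Good.arr_zero _⟩
      refine ⟨n, ?_, ?_⟩
      · change _ < arr z n
        linarith [(hz l).gaps_pos 0]
      · change arr z n ≤ _
        linarith
  rw [nextStart, hset, hv, cycleStart_succ]
  rfl

/-- Service times of the served packets of a path. -/
def servedTimes (z : Path) (l : ℕ) : ℝ := services z (l + 1)

/-- Cycle 0 is the initial vacation period, opened by the artificial service `services z 0 = 0`. It
ends at the start of service of packet 0, hence the shift by one. -/
lemma serviceStart_eq (hz : ∀ l, Good (next^[l] z)) (h0 : services z 0 = 0) (l : ℕ) :
    serviceStart (gaps z) (servedTimes z) (vacations z) l = cycleStart z (l + 1) := by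
  induction l with
  | zero =>
    rw [← nextStart_eq hz 0, serviceStart, h0]
    simp [cycleStart]
  | succ l ih =>
    rw [← nextStart_eq hz (l + 1), serviceStart, ih]
    rfl

lemma bufferOpen_eq (hz : ∀ l, Good (next^[l] z)) (h0 : services z 0 = 0) (l : ℕ) :
    bufferOpen (gaps z) (servedTimes z) (vacations z) l = cycleStart z l := by
  rcases l with _ | l
  · simp [bufferOpen, cycleStart]
  · rw [bufferOpen, serviceStart_eq hz h0]

lemma cycle_eq (hz : ∀ l, Good (next^[l] z)) (h0 : services z 0 = 0) (l : ℕ) :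
    cycle (gaps z) (servedTimes z) (vacations z) l = firstCycle (next^[l + 1] z) := by
  rw [cycle, serviceStart_eq hz h0, serviceStart_eq hz h0, cycleStart_succ _ (l + 1)]
  ring

lemma genTime_eq (hz : ∀ l, Good (next^[l] z)) (h0 : services z 0 = 0) (l : ℕ) :
    genTime (gaps z) (servedTimes z) (vacations z) l
      = cycleStart z (l + 1) - firstWait (next^[l] z) := by
  rw [genTime, bufferOpen_eq hz h0, serviceStart_eq hz h0]
  refine IsGreatest.csSup_eq ⟨⟨⟨?_, ?_⟩, ?_⟩, ?_⟩
  · rw [cycleStart_succ]; linarith [(hz l).firstWait_lt_firstCycle]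
  · linarith [(hz l).firstWait_nonneg]
  · obtain ⟨n, hn⟩ := (exists_arr_iterate hz l ((hz l).arr_pos (count (next^[l] z) - 1))).2
      ⟨_, rfl⟩
    refine ⟨n, ?_⟩
    change arr z n = _
    rw [hn, cycleStart_succ, firstWait]; ring
  · rintro x ⟨⟨h1, h2⟩, n, hn⟩
    have hn' : arr z n = x := hn
    obtain ⟨k, hk⟩ := (exists_arr_iterate hz l (y := x - cycleStart z l) (sub_pos.2 h1)).1
      ⟨n, by rw [hn']; ring⟩
    have hk2 : k ≤ count (next^[l] z) - 1 := by
      by_contra! h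
      have h3 := (hz l).arr_strictMono.monotone (show count (next^[l] z) ≤ k by omega)
      have h4 := (hz l).firstCycle_lt_arr
      rw [cycleStart_succ] at h2
      linarith
    have h3 := (hz l).arr_strictMono.monotone hk2
    rw [cycleStart_succ, firstWait]
    linarith

lemma waiting_eq (hz : ∀ l, Good (next^[l] z)) (h0 : services z 0 = 0) (l : ℕ) :
    waiting (gaps z) (servedTimes z) (vacations z) l = firstWait (next^[l] z) := by
  rw [waiting, genTime_eq hz h0, serviceStart_eq hz h0]; ring

lemma completion_eq (hz : ∀ l, Good (next^[l] z)) (h0 : services z 0 = 0) (l : ℕ) :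
    completion (gaps z) (servedTimes z) (vacations z) l
      = cycleStart z (l + 1) + services z (l + 1) := by
  rw [completion, serviceStart_eq hz h0]; rfl

lemma peakAge_eq (hz : ∀ l, Good (next^[l] z)) (h0 : services z 0 = 0) (l : ℕ) :
    peakAge (gaps z) (servedTimes z) (vacations z) l
      = firstWait (next^[l] z) + firstCycle (next^[l + 1] z) + services z (l + 2) := by
  rw [peakAge, genTime_eq hz h0, completion_eq hz h0, cycleStart_succ _ (l + 1)]; ring

end Iterate

/-! ### The age as a function of time -/

/-- Generation times `r` and completion times `C` of the served packets, in order. -/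
structure IsSchedule (C r : ℕ → ℝ) : Prop where
  pos : 0 < r 0
  strictMono : StrictMono r
  mono : Monotone C
  le : ∀ l, r l ≤ C l
  unbounded : Tendsto C atTop atTop

/-- The age at time `t`. -/
def ageAt (a : ℝ) (C r : ℕ → ℝ) (t : ℝ) : ℝ :=
  t - sSup (insert (-a) {x : ℝ | ∃ l, C l ≤ t ∧ r l = x})

namespace IsSchedule

variable {C r : ℕ → ℝ} {a : ℝ}

lemma r_pos (h : IsSchedule C r) (l : ℕ) : 0 < r l :=
  h.pos.trans_le (h.strictMono.monotone (Nat.zero_le l))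

lemma C_pos (h : IsSchedule C r) (l : ℕ) : 0 < C l := (h.r_pos l).trans_le (h.le l)

lemma bddAbove (h : IsSchedule C r) (t : ℝ) :
    BddAbove (insert (-a) {x : ℝ | ∃ l, C l ≤ t ∧ r l = x}) := by
  refine ⟨max (-a) t, ?_⟩
  rintro x (rfl | ⟨l, hl, rfl⟩)
  · exact le_max_left _ _
  · exact ((h.le l).trans hl).trans (le_max_right _ _)

/-- Makes the age the difference of a continuous and a monotone function of time, hence interval
integrable. -/
lemma monotone_sSup (h : IsSchedule C r) :
    Monotone fun t => sSup (insert (-a) {x : ℝ | ∃ l, C l ≤ t ∧ r l = x}) := by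
  intro s t hst
  refine csSup_le_csSup (h.bddAbove t) (insert_nonempty _ _) (insert_subset_insert ?_)
  rintro x ⟨l, hl, rfl⟩
  exact ⟨l, hl.trans hst, rfl⟩

lemma intervalIntegrable_ageAt (h : IsSchedule C r) (s t : ℝ) :
    IntervalIntegrable (ageAt a C r) volume s t :=
  (continuous_id.intervalIntegrable s t).sub (h.monotone_sSup.intervalIntegrable)

lemma ageAt_nonneg (h : IsSchedule C r) (ha : 0 ≤ a) {t : ℝ} (ht : 0 ≤ t) :
    0 ≤ ageAt a C r t := by
  refine sub_nonneg.2 (csSup_le (insert_nonempty _ _) ?_)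
  rintro x (rfl | ⟨l, hl, rfl⟩)
  · linarith
  · exact (h.le l).trans hl

lemma ageAt_le (h : IsSchedule C r) (t : ℝ) : ageAt a C r t ≤ t + a := by
  have := le_csSup (h.bddAbove (a := a) t) (mem_insert _ _)
  rw [ageAt]; linarith

lemma ageAt_of_lt (h : IsSchedule C r) {t : ℝ} (ht : t < C 0) : ageAt a C r t = t + a := by
  have : {x : ℝ | ∃ l, C l ≤ t ∧ r l = x} = ∅ := by
    refine eq_empty_of_forall_notMem ?_
    rintro x ⟨l, hl, _⟩
    linarith [h.mono (Nat.zero_le l)]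
  rw [ageAt, this, insert_empty_eq, csSup_singleton]; ring

lemma ageAt_eq (h : IsSchedule C r) (ha : 0 ≤ a) {l : ℕ} {t : ℝ} (h1 : C l ≤ t)
    (h2 : t < C (l + 1)) : ageAt a C r t = t - r l := by
  rw [ageAt]
  congr 1
  refine IsGreatest.csSup_eq ⟨Or.inr ⟨l, h1, rfl⟩, ?_⟩
  rintro x (rfl | ⟨k, hk, rfl⟩)
  · linarith [h.r_pos l]
  · refine h.strictMono.monotone ?_
    by_contra! hlt
    linarith [h.mono (Nat.succ_le_of_lt hlt)]

/-- Area under the age between two completions. -/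
lemma integral_ageAt_succ (h : IsSchedule C r) (ha : 0 ≤ a) (l : ℕ) :
    ∫ t in C l..C (l + 1), ageAt a C r t
      = ((C (l + 1) - r l) ^ 2 - (C l - r l) ^ 2) / 2 := by
  have hle := h.mono l.le_succ
  -- The linear formula holds on `[C l, C (l + 1))`, whereas interval integrals run over `(C l, C (l
  -- + 1)]`; the end points are null.
  have e : ∫ t in C l..C (l + 1), ageAt a C r t = ∫ t in C l..C (l + 1), (t - r l) := by
    rw [intervalIntegral.integral_of_le hle, intervalIntegral.integral_of_le hle,
      ← integral_Ico_eq_integral_Ioc, ← integral_Ico_eq_integral_Ioc]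
    exact setIntegral_congr_fun measurableSet_Ico fun t ht => h.ageAt_eq ha ht.1 ht.2
  rw [e, intervalIntegral.integral_comp_sub_right (fun x => x), integral_id]

lemma integral_ageAt_zero (h : IsSchedule C r) :
    ∫ t in (0 : ℝ)..C 0, ageAt a C r t = ((C 0 + a) ^ 2 - a ^ 2) / 2 := by
  have hle := (h.C_pos 0).le
  have e : ∫ t in (0 : ℝ)..C 0, ageAt a C r t = ∫ t in (0 : ℝ)..C 0, (t + a) := by
    rw [intervalIntegral.integral_of_le hle, intervalIntegral.integral_of_le hle,
      ← integral_Ico_eq_integral_Ioc, ← integral_Ico_eq_integral_Ioc]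
    exact setIntegral_congr_fun measurableSet_Ico fun t ht => h.ageAt_of_lt ht.2
  rw [e, intervalIntegral.integral_comp_add_right (fun x => x), integral_id, zero_add]

lemma integral_ageAt_completion (h : IsSchedule C r) (ha : 0 ≤ a) (n : ℕ) :
    ∫ t in (0 : ℝ)..C n, ageAt a C r t = ((C 0 + a) ^ 2 - a ^ 2) / 2
      + ∑ l ∈ Finset.range n, ((C (l + 1) - r l) ^ 2 - (C l - r l) ^ 2) / 2 := by
  induction n with
  | zero => rw [h.integral_ageAt_zero, Finset.sum_range_zero, add_zero]
  | succ n ih =>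
    rw [← intervalIntegral.integral_add_adjacent_intervals (h.intervalIntegrable_ageAt 0 (C n))
      (h.intervalIntegrable_ageAt _ _), ih, h.integral_ageAt_succ ha, Finset.sum_range_succ]
    ring

lemma integral_ageAt_mono (h : IsSchedule C r) (ha : 0 ≤ a) {s t : ℝ} (hs : 0 ≤ s)
    (hst : s ≤ t) : ∫ u in (0 : ℝ)..s, ageAt a C r u ≤ ∫ u in (0 : ℝ)..t, ageAt a C r u := by
  rw [← intervalIntegral.integral_add_adjacent_intervals (h.intervalIntegrable_ageAt 0 s)
    (h.intervalIntegrable_ageAt s t)]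
  have := intervalIntegral.integral_nonneg (μ := volume) hst fun u hu => h.ageAt_nonneg ha (hs.trans hu.1)
  linarith

lemma exists_index (h : IsSchedule C r) {t : ℝ} (ht : C 0 ≤ t) :
    ∃ k, C k ≤ t ∧ t < C (k + 1) := by
  classical
  have hex : ∃ n, t < C n := (h.unbounded.eventually_gt_atTop t).exists
  have hf := Nat.find_spec hex
  rcases hk : Nat.find hex with _ | k
  · rw [hk] at hf; linarith
  · exact ⟨k, not_lt.1 (Nat.find_min hex (by omega)), hk ▸ hf⟩

/-- Renewal-reward theorem along a sample path. -/
lemma tendsto_average (h : IsSchedule C r) (ha : 0 ≤ a) {m q : ℝ} (hm : 0 < m)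
    (hC : Tendsto (fun n : ℕ => C n / n) atTop (𝓝 m))
    (hQ : Tendsto (fun n : ℕ => (∑ l ∈ Finset.range n,
      ((C (l + 1) - r l) ^ 2 - (C l - r l) ^ 2) / 2) / (n : ℝ)) atTop (𝓝 q)) :
    Tendsto (fun T : ℝ => T⁻¹ * ∫ t in (0 : ℝ)..T, ageAt a C r t) atTop (𝓝 (q / m)) := by
  set F := fun T : ℝ => ∫ t in (0 : ℝ)..T, ageAt a C r t with hF
  have hFC : Tendsto (fun n : ℕ => F (C n) / n) atTop (𝓝 q) := by
    have h1 : Tendsto (fun n : ℕ => ((C 0 + a) ^ 2 - a ^ 2) / 2 / (n : ℝ)) atTop (𝓝 0) :=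
      tendsto_const_div_atTop_nhds_zero_nat _
    have h2 := h1.add hQ
    rw [zero_add] at h2
    refine h2.congr fun n => ?_
    rw [← add_div, ← h.integral_ageAt_completion ha n]
  have hratio : Tendsto (fun n : ℕ => ((n : ℝ) + 1) / n) atTop (𝓝 1) := by
    have h1 : Tendsto (fun n : ℕ => 1 + 1 / (n : ℝ)) atTop (𝓝 (1 + 0)) :=
      tendsto_const_nhds.add (tendsto_const_div_atTop_nhds_zero_nat _)
    rw [add_zero] at h1
    refine h1.congr' ?_
    filter_upwards [eventually_gt_atTop 0] with n hn
    have : (n : ℝ) ≠ 0 := by positivity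
    field_simp
  have hC1 : Tendsto (fun n : ℕ => C (n + 1) / n) atTop (𝓝 m) := by
    have h1 := (hC.comp (tendsto_add_atTop_nat 1)).mul hratio
    rw [mul_one] at h1
    refine h1.congr' ?_
    filter_upwards [eventually_gt_atTop 0] with n hn
    have : (n : ℝ) ≠ 0 := by positivity
    simp only [Function.comp]
    push_cast
    field_simp
  have hF1 : Tendsto (fun n : ℕ => F (C (n + 1)) / n) atTop (𝓝 q) := by
    have h1 := (hFC.comp (tendsto_add_atTop_nat 1)).mul hratio
    rw [mul_one] at h1
    refine h1.congr' ?_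
    filter_upwards [eventually_gt_atTop 0] with n hn
    have : (n : ℝ) ≠ 0 := by positivity
    simp only [Function.comp]
    push_cast
    field_simp
  -- For `C k ≤ T < C (k + 1)`, monotonicity places `F T / T` between `F (C k) / C (k + 1)` and `F
  -- (C (k + 1)) / C k`; both bounds tend to `q / m`.
  have hlo : Tendsto (fun n : ℕ => F (C n) / C (n + 1)) atTop (𝓝 (q / m)) := by
    refine (hFC.div hC1 hm.ne').congr' ?_
    filter_upwards [eventually_gt_atTop 0] with n hn
    have : (n : ℝ) ≠ 0 := by positivity
    have := (h.C_pos (n + 1)).ne'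
    simp only [Pi.div_apply]
    field_simp
  have hhi : Tendsto (fun n : ℕ => F (C (n + 1)) / C n) atTop (𝓝 (q / m)) := by
    refine (hF1.div hC hm.ne').congr' ?_
    filter_upwards [eventually_gt_atTop 0] with n hn
    have : (n : ℝ) ≠ 0 := by positivity
    have := (h.C_pos n).ne'
    simp only [Pi.div_apply]
    field_simp
  -- The premise `C 0 ≤ T` sits inside the existential so that `choose` yields an index function on
  -- all of `ℝ`.
  have hex : ∀ T : ℝ, ∃ k, C 0 ≤ T → C k ≤ T ∧ T < C (k + 1) := fun T => by
    by_cases hT : C 0 ≤ T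
    · obtain ⟨k, hk⟩ := h.exists_index hT
      exact ⟨k, fun _ => hk⟩
    · exact ⟨0, fun h' => absurd h' hT⟩
  choose k hk using hex
  have hkt : Tendsto k atTop atTop := by
    refine tendsto_atTop.2 fun M => ?_
    filter_upwards [eventually_ge_atTop (C 0), eventually_ge_atTop (C M)] with T h0 hM
    by_contra! hlt
    linarith [(hk T h0).2, h.mono (Nat.succ_le_of_lt hlt)]
  have hFn : ∀ T, 0 ≤ T → 0 ≤ F T := fun T hT =>
    intervalIntegral.integral_nonneg hT fun u hu => h.ageAt_nonneg ha hu.1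
  refine tendsto_of_tendsto_of_tendsto_of_le_of_le' (hlo.comp hkt) (hhi.comp hkt) ?_ ?_
  · filter_upwards [eventually_ge_atTop (C 0)] with T hT
    have h1 := hk T hT
    have hT0 := (h.C_pos 0).trans_le hT
    rw [← div_eq_inv_mul]
    exact div_le_div₀ (hFn T hT0.le) (h.integral_ageAt_mono ha (h.C_pos _).le h1.1) hT0 h1.2.le
  · filter_upwards [eventually_ge_atTop (C 0)] with T hT
    have h1 := hk T hT
    have hT0 := (h.C_pos 0).trans_le hT
    rw [← div_eq_inv_mul]
    exact div_le_div₀ (hFn _ (h.C_pos _).le) (h.integral_ageAt_mono ha hT0.le h1.2.le)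
      (h.C_pos _) h1.1

end IsSchedule

/-! ### Regularity of the closed form of the cycle transform. -/

section ClosedForm

variable {lam : ℝ} {κ νV : Measure ℝ} [IsProbabilityMeasure κ] [IsProbabilityMeasure νV]

lemma lst_zero (ν : Measure ℝ) [IsProbabilityMeasure ν] : lst ν 0 = 1 := by simp [lst]

lemma contDiffOn_cycleLST (hlam : 0 < lam) (hV : ∀ᵐ x ∂νV, 0 ≤ x)
    (hV0 : νV {0} ≠ 1) {n : WithTop ℕ∞} (h1 : ContDiffOn ℝ n (lst κ) (Ici 0))
    (h2 : ContDiffOn ℝ n (lst νV) (Ici 0)) :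
    ContDiffOn ℝ n (cycleLST lam (lst κ) (lst νV)) (Ici 0) := by
  have e1 : ContDiffOn ℝ n (fun s => lst κ (lam + s)) (Ici 0) :=
    h1.comp (contDiff_const.add contDiff_id).contDiffOn fun s hs =>
      add_nonneg hlam.le (mem_Ici.1 hs)
  have e2 : ContDiffOn ℝ n (fun s => lst νV (s + lam)) (Ici 0) :=
    h2.comp (contDiff_id.add contDiff_const).contDiffOn fun s hs =>
      add_nonneg (mem_Ici.1 hs) hlam.le
  refine (h1.mul h2).add (e1.mul ((e2.mul (h2.sub contDiffOn_const)).div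
    (contDiffOn_const.sub e2) fun s hs => ?_))
  have := lst_lt_one hV hV0 (show 0 < s + lam by have := mem_Ici.1 hs; linarith)
  linarith

/-- The factor `lst νV s - 1` vanishes at 0, so in the second summand only its derivative survives;
the derivatives at `lam` drop out. -/
lemma hasDerivWithinAt_cycleLST (hlam : 0 < lam) (hκ : ∀ᵐ x ∂κ, 0 ≤ x)
    (hV : ∀ᵐ x ∂νV, 0 ≤ x) (hV0 : νV {0} ≠ 1) (h1 : Integrable (fun x => x) κ)
    (h2 : Integrable (fun x => x) νV) :
    HasDerivWithinAt (cycleLST lam (lst κ) (lst νV))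
      (deriv₀ (lst κ) + deriv₀ (lst νV)
        + lst κ lam * lst νV lam / (1 - lst νV lam) * deriv₀ (lst νV)) (Ici 0) 0 := by
  have d1 : HasDerivWithinAt (lst κ) (deriv₀ (lst κ)) (Ici 0) 0 :=
    (differentiableOn_lst hκ h1 0 self_mem_Ici).hasDerivWithinAt
  have d2 : HasDerivWithinAt (lst νV) (deriv₀ (lst νV)) (Ici 0) 0 :=
    (differentiableOn_lst hV h2 0 self_mem_Ici).hasDerivWithinAt
  have hne : 1 - lst νV lam ≠ 0 := by
    have := lst_lt_one hV hV0 hlam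
    linarith
  have e1 : HasDerivWithinAt (fun s => lst κ (lam + s)) (deriv (lst κ) lam) (Ici 0) 0 := by
    have h := (hasDerivAt_lst hκ hlam).differentiableAt.hasDerivAt
    rw [← add_zero lam] at h
    have h3 := (h.comp_const_add lam 0).hasDerivWithinAt (s := Ici 0)
    rwa [add_zero] at h3
  have e2 : HasDerivWithinAt (fun s => lst νV (s + lam)) (deriv (lst νV) lam) (Ici 0) 0 := by
    have h := (hasDerivAt_lst hV hlam).differentiableAt.hasDerivAt
    rw [← zero_add lam] at h
    have h3 := (h.comp_add_const 0 lam).hasDerivWithinAt (s := Ici 0)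
    rwa [zero_add] at h3
  have h := (d1.mul d2).add (e1.mul ((e2.mul (d2.sub_const 1)).div (e2.const_sub 1)
    (by rwa [zero_add])))
  convert! h using 1
  simp only [lst_zero, zero_add, add_zero, Pi.mul_apply, Pi.div_apply, sub_self, mul_zero]
  field_simp
  ring

end ClosedForm

/-! ### Moments of the cycle length. -/

section Moments

variable {lam : ℝ} {νH νV κ : Measure ℝ} [IsProbabilityMeasure (expMeasure lam)]
  [IsProbabilityMeasure νH] [IsProbabilityMeasure νV] [IsProbabilityMeasure κ]

/-- Law of the length of the first cycle. -/
def cycleLaw (lam : ℝ) (νH νV κ : Measure ℝ) : Measure ℝ :=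
  (pathLaw lam νH νV κ).map firstCycle

instance : IsProbabilityMeasure (cycleLaw lam νH νV κ) :=
  Measure.isProbabilityMeasure_map measurable_firstCycle.aemeasurable

lemma cycleLaw_nonneg (hg : ∀ᵐ z ∂(pathLaw lam νH νV κ), Good z) :
    ∀ᵐ x ∂(cycleLaw lam νH νV κ), 0 ≤ x := by
  rw [cycleLaw, ae_map_iff measurable_firstCycle.aemeasurable measurableSet_Ici]
  exact hg.mono fun z hz => hz.firstCycle_pos.le

lemma eqOn_lst_cycleLaw (hlam : 0 < lam) (hV : ∀ᵐ x ∂νV, 0 ≤ x) (hV0 : νV {0} ≠ 1)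
    (hg : ∀ᵐ z ∂(pathLaw lam νH νV κ), Good z) :
    EqOn (lst (cycleLaw lam νH νV κ)) (cycleLST lam (lst κ) (lst νV)) (Ici 0) := fun s hs => by
  rw [← integral_exp_firstCycle hlam hV hV0 hg hs, lst, cycleLaw,
    integral_map measurable_firstCycle.aemeasurable (by fun_prop)]

/-- Integrability is deduced from the formula: the transform of the cycle law agrees on `[0, ∞)`
with a closed form that is differentiable at 0, which forces a finite first moment. -/
lemma integrable_firstCycle (hlam : 0 < lam) (hκ : ∀ᵐ x ∂κ, 0 ≤ x) (hV : ∀ᵐ x ∂νV, 0 ≤ x)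
    (hV0 : νV {0} ≠ 1) (hg : ∀ᵐ z ∂(pathLaw lam νH νV κ), Good z)
    (h1 : Integrable (fun x => x) κ) (h2 : Integrable (fun x => x) νV) :
    Integrable firstCycle (pathLaw lam νH νV κ) ∧
    ∫ z, firstCycle z ∂(pathLaw lam νH νV κ) = -deriv₀ (cycleLST lam (lst κ) (lst νV)) := by
  have heq := eqOn_lst_cycleLaw (νH := νH) hlam hV hV0 hg
  have hd := (hasDerivWithinAt_cycleLST hlam hκ hV hV0 h1 h2).differentiableWithinAt.congr heq
    (heq self_mem_Ici)
  have hi := integrable_of_differentiableWithinAt_lst (cycleLaw_nonneg hg) hd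
  refine ⟨hi.comp_measurable measurable_firstCycle, ?_⟩
  have h := deriv₀_lst (cycleLaw_nonneg hg) hi
  have h3 : deriv₀ (lst (cycleLaw lam νH νV κ)) = deriv₀ (cycleLST lam (lst κ) (lst νV)) :=
    derivWithin_congr heq (heq self_mem_Ici)
  rw [← h3, h, neg_neg, cycleLaw, integral_map measurable_firstCycle.aemeasurable (by fun_prop)]

lemma integrable_firstCycle_sq (hlam : 0 < lam) (hκ : ∀ᵐ x ∂κ, 0 ≤ x) (hV : ∀ᵐ x ∂νV, 0 ≤ x)
    (hV0 : νV {0} ≠ 1) (hg : ∀ᵐ z ∂(pathLaw lam νH νV κ), Good z)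
    (h1 : Integrable (fun x => x ^ 2) κ) (h2 : Integrable (fun x => x ^ 2) νV) :
    Integrable (fun z => firstCycle z ^ 2) (pathLaw lam νH νV κ) ∧
    ∫ z, firstCycle z ^ 2 ∂(pathLaw lam νH νV κ)
      = secondDeriv₀ (cycleLST lam (lst κ) (lst νV)) := by
  have heq := eqOn_lst_cycleLaw (νH := νH) hlam hV hV0 hg
  have hd := (contDiffOn_cycleLST hlam hV hV0 (contDiffOn_lst hκ h1)
    (contDiffOn_lst hV h2)).congr heq
  have hi := integrable_sq_of_contDiffOn_lst (cycleLaw_nonneg hg) hd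
  refine ⟨hi.comp_measurable measurable_firstCycle, ?_⟩
  have h := secondDeriv₀_lst (cycleLaw_nonneg hg) hi
  have h3 : secondDeriv₀ (lst (cycleLaw lam νH νV κ))
      = secondDeriv₀ (cycleLST lam (lst κ) (lst νV)) :=
    iteratedDerivWithin_congr heq self_mem_Ici
  rw [← h3, h, cycleLaw, integral_map measurable_firstCycle.aemeasurable (by fun_prop)]

end Moments

/-! ### Independence of successive cycles. -/

section Independence

lemma indepFun_of_map {Ω Ω' β γ : Type*} [MeasurableSpace Ω] [MeasurableSpace Ω']
    [MeasurableSpace β] [MeasurableSpace γ] {P : Measure Ω} {T : Ω → Ω'} (hT : Measurable T)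
    {f : Ω' → β} {g : Ω' → γ} (hf : Measurable f) (hg : Measurable g)
    (h : IndepFun f g (P.map T)) : IndepFun (fun ω => f (T ω)) (fun ω => g (T ω)) P := by
  rw [indepFun_iff_measure_inter_preimage_eq_mul] at h ⊢
  intro s t hs ht
  have := h s t hs ht
  rwa [Measure.map_apply hT ((hf hs).inter (hg ht)), Measure.map_apply hT (hf hs),
    Measure.map_apply hT (hg ht)] at this

/-- The joint law of `A`, `f ∘ Y` and `g ∘ Y` is a triple product, and reassociating it groups `A`
with `f ∘ Y`. This adjoins cycles to the past one at a time. -/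
lemma indepFun_prodMk_comp {Ω α β γ δ : Type*} [MeasurableSpace Ω] [MeasurableSpace α]
    [MeasurableSpace β] [MeasurableSpace γ] [MeasurableSpace δ] {P : Measure Ω}
    [IsProbabilityMeasure P] {A : Ω → α} {Y : Ω → β} (hA : Measurable A) (hY : Measurable Y)
    {f : β → γ} {g : β → δ} (hf : Measurable f) (hg : Measurable g) (h1 : IndepFun A Y P)
    (h2 : IndepFun (fun ω => f (Y ω)) (fun ω => g (Y ω)) P) :
    IndepFun (fun ω => (A ω, f (Y ω))) (fun ω => g (Y ω)) P := by
  have hfY : Measurable fun ω => f (Y ω) := hf.comp hY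
  have hgY : Measurable fun ω => g (Y ω) := hg.comp hY
  have e1 : P.map (fun ω => (A ω, (f (Y ω), g (Y ω))))
      = (P.map A).prod ((P.map fun ω => f (Y ω)).prod (P.map fun ω => g (Y ω))) := by
    rw [← (indepFun_iff_map_prod_eq_prod_map_map hfY.aemeasurable hgY.aemeasurable).1 h2]
    exact (indepFun_iff_map_prod_eq_prod_map_map hA.aemeasurable
      (hfY.prodMk hgY).aemeasurable).1 (h1.comp measurable_id (hf.prodMk hg))
  have e2 : P.map (fun ω => (A ω, f (Y ω))) = (P.map A).prod (P.map fun ω => f (Y ω)) :=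
    (indepFun_iff_map_prod_eq_prod_map_map hA.aemeasurable hfY.aemeasurable).1
      (h1.comp measurable_id hf)
  rw [indepFun_iff_map_prod_eq_prod_map_map (hA.prodMk hfY).aemeasurable hgY.aemeasurable]
  have := Measure.isProbabilityMeasure_map (μ := P) hA.aemeasurable
  have := Measure.isProbabilityMeasure_map (μ := P) hfY.aemeasurable
  have := Measure.isProbabilityMeasure_map (μ := P) hgY.aemeasurable
  have e3 := congrArg (Measure.map MeasurableEquiv.prodAssoc.symm) e1
  rw [Measure.map_map MeasurableEquiv.prodAssoc.symm.measurable (hA.prodMk (hfY.prodMk hgY))] at e3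
  rw [e2]
  refine Eq.trans ?_ (e3.trans ?_)
  · rfl
  · exact ((measurePreserving_prodAssoc _ _ _).symm MeasurableEquiv.prodAssoc).map_eq

variable {lam : ℝ} {νH νV κ : Measure ℝ} [IsProbabilityMeasure (expMeasure lam)]
  [IsProbabilityMeasure νH] [IsProbabilityMeasure νV] [IsProbabilityMeasure κ]

lemma measurable_iterate_next (l : ℕ) : Measurable next^[l] := measurable_next.iterate l

/-- Only the first step changes the law, from `κ` to `νH`; after that `next` preserves it. -/
lemma map_iterate_next (hg : ∀ᵐ z ∂(pathLaw lam νH νV κ), Good z)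
    (hg' : ∀ᵐ z ∂(pathLaw lam νH νV νH), Good z) (l : ℕ) :
    (pathLaw lam νH νV κ).map next^[l + 1] = pathLaw lam νH νV νH := by
  induction l with
  | zero => exact map_next hg
  | succ l ih =>
    rw [Function.iterate_succ', ← Measure.map_map measurable_next (measurable_iterate_next _), ih,
      map_next hg']

lemma ae_good_iterate (hg : ∀ᵐ z ∂(pathLaw lam νH νV κ), Good z)
    (hg' : ∀ᵐ z ∂(pathLaw lam νH νV νH), Good z) :
    ∀ᵐ z ∂(pathLaw lam νH νV κ), ∀ l, Good (next^[l] z) := by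
  refine ae_all_iff.2 fun l => ?_
  rcases l with _ | l
  · exact hg
  · rw [← map_iterate_next hg hg' l] at hg'
    exact ae_of_ae_map (measurable_iterate_next _).aemeasurable hg'

lemma indepFun_firstData_iterate (hg : ∀ᵐ z ∂(pathLaw lam νH νV κ), Good z)
    (hg' : ∀ᵐ z ∂(pathLaw lam νH νV νH), Good z) (l : ℕ) :
    IndepFun (fun z => firstData (next^[l] z)) (fun z => next^[l + 1] z)
      (pathLaw lam νH νV κ) := by
  simp only [Function.iterate_succ_apply']
  rcases l with _ | l
  · exact indepFun_next hg
  · refine indepFun_of_map (measurable_iterate_next _) measurable_firstData measurable_next ?_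
    rw [map_iterate_next hg hg' l]
    exact indepFun_next hg'

/-- If `A` is independent of the inputs of the `l`-th cycle onwards, then `A` together with the
data of the `l`-th cycle is independent of the inputs of the next cycle onwards. -/
lemma indepFun_prodMk_firstData (hg : ∀ᵐ z ∂(pathLaw lam νH νV κ), Good z)
    (hg' : ∀ᵐ z ∂(pathLaw lam νH νV νH), Good z) {α : Type*} [MeasurableSpace α]
    {A : Path → α} (hA : Measurable A) {l : ℕ}
    (h : IndepFun A (fun z => next^[l] z) (pathLaw lam νH νV κ)) :
    IndepFun (fun z => (A z, firstData (next^[l] z))) (fun z => next^[l + 1] z)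
      (pathLaw lam νH νV κ) := by
  have h2 := indepFun_firstData_iterate hg hg' l
  simp only [Function.iterate_succ_apply'] at h2 ⊢
  exact indepFun_prodMk_comp hA (measurable_iterate_next l) measurable_firstData measurable_next h h2

@[fun_prop] lemma measurable_cycleStart (l : ℕ) : Measurable fun z => cycleStart z l :=
  Finset.measurable_fun_sum _ fun k _ => measurable_firstCycle.comp (measurable_iterate_next k)

/-- The independence behind the Wald-type bound: whether a cycle begins before `T` tells nothing
about what happens from its beginning on. -/
lemma indepFun_cycleStart (hg : ∀ᵐ z ∂(pathLaw lam νH νV κ), Good z)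
    (hg' : ∀ᵐ z ∂(pathLaw lam νH νV νH), Good z) (l : ℕ) :
    IndepFun (fun z => cycleStart z l) (fun z => next^[l] z) (pathLaw lam νH νV κ) := by
  induction l with
  | zero =>
    simp only [cycleStart, Finset.range_zero, Finset.sum_empty]
    exact indepFun_const_left _ _
  | succ l ih =>
    have h := indepFun_prodMk_firstData hg hg' (measurable_cycleStart l) ih
    simp only [cycleStart_succ]
    exact h.comp (φ := fun q : ℝ × ℝ × ℝ × ℝ => q.1 + q.2.2.1) (ψ := id) (by fun_prop)
      measurable_id

/-- The data of three successive cycles. -/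
def threeData (z : Path) : (((ℝ × ℝ × ℝ) × (ℝ × ℝ × ℝ)) × (ℝ × ℝ × ℝ)) :=
  ((firstData z, firstData (next z)), firstData (next (next z)))

lemma measurable_threeData : Measurable threeData := by unfold threeData; fun_prop

lemma indepFun_threeData (hg : ∀ᵐ z ∂(pathLaw lam νH νV κ), Good z)
    (hg' : ∀ᵐ z ∂(pathLaw lam νH νV νH), Good z) (l : ℕ) :
    IndepFun (fun z => threeData (next^[l] z)) (fun z => next^[l + 3] z)
      (pathLaw lam νH νV κ) := by
  have h1 := indepFun_firstData_iterate hg hg' l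
  have hm := measurable_firstData.comp (measurable_iterate_next l)
  have h2 := indepFun_prodMk_firstData hg hg' hm h1
  have h3 := indepFun_prodMk_firstData hg hg'
    (hm.prodMk (measurable_firstData.comp (measurable_iterate_next (l + 1)))) h2
  simp only [Function.comp_apply, Function.iterate_succ_apply'] at h3
  simp only [threeData, Function.iterate_succ_apply']
  exact h3

end Independence

/-! ### Strong law for functions of three successive cycles. -/

section StrongLaw

lemma sum_range_eq_sum_residues (x : ℕ → ℝ) (n : ℕ) :
    ∑ l ∈ Finset.range n, x l = ∑ k ∈ Finset.range ((n + 2) / 3), x (3 * k + 0)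
      + ∑ k ∈ Finset.range ((n + 1) / 3), x (3 * k + 1)
      + ∑ k ∈ Finset.range (n / 3), x (3 * k + 2) := by
  induction n with
  | zero => simp
  | succ n ih =>
    rw [Finset.sum_range_succ, ih]
    obtain ⟨m, h | h | h⟩ : ∃ m, n = 3 * m ∨ n = 3 * m + 1 ∨ n = 3 * m + 2 := ⟨n / 3, by omega⟩
    · simp only [h, show (3 * m + 1 + 2) / 3 = m + 1 by omega, show (3 * m + 1 + 1) / 3 = m by omega,
        show (3 * m + 1) / 3 = m by omega, show 3 * m / 3 = m by omega, Finset.sum_range_succ _ m]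
      ring_nf
    · simp only [h, show (3 * m + 1 + 1 + 2) / 3 = m + 1 by omega,
        show (3 * m + 1 + 1 + 1) / 3 = m + 1 by omega, show (3 * m + 1 + 1) / 3 = m by omega,
        show (3 * m + 1) / 3 = m by omega, Finset.sum_range_succ _ m]
      ring_nf
    · simp only [h, show (3 * m + 2 + 1 + 2) / 3 = m + 1 by omega,
        show (3 * m + 2 + 1 + 1) / 3 = m + 1 by omega, show (3 * m + 2 + 1) / 3 = m + 1 by omega,
        show (3 * m + 2) / 3 = m by omega, Finset.sum_range_succ _ m]
      ring_nf

lemma tendsto_average_of_residues {x : ℕ → ℝ} {c : ℝ}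
    (h : ∀ r, Tendsto (fun n : ℕ => (∑ k ∈ Finset.range n, x (3 * k + r)) / (n : ℝ)) atTop (𝓝 c)) :
    Tendsto (fun n : ℕ => (∑ l ∈ Finset.range n, x l) / (n : ℝ)) atTop (𝓝 c) := by
  -- Here `d = 2 - r` for the residue `r`; that class has `(n + d) / 3` members below `n`,
  -- asymptotically a third of them.
  have key : ∀ d ≤ 2, Tendsto (fun n : ℕ => (∑ k ∈ Finset.range ((n + d) / 3), x (3 * k + (2 - d)))
      / (n : ℝ)) atTop (𝓝 (c * 3⁻¹)) := by
    intro d hd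
    have hN : Tendsto (fun n : ℕ => (n + d) / 3) atTop atTop := by
      refine tendsto_atTop.2 fun b => ?_
      filter_upwards [eventually_ge_atTop (3 * b)] with n hn
      omega
    have hr : Tendsto (fun n : ℕ => (((n + d) / 3 : ℕ) : ℝ) / n) atTop (𝓝 3⁻¹) := by
      have h1 : Tendsto (fun n : ℕ => (3 : ℝ)⁻¹ - 1 / (n : ℝ)) atTop (𝓝 3⁻¹) := by
        have := (tendsto_const_nhds (x := (3 : ℝ)⁻¹)).sub
          (tendsto_const_div_atTop_nhds_zero_nat (1 : ℝ))
        simpa using this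
      have h2 : Tendsto (fun n : ℕ => (3 : ℝ)⁻¹ + 1 / (n : ℝ)) atTop (𝓝 3⁻¹) := by
        have := (tendsto_const_nhds (x := (3 : ℝ)⁻¹)).add
          (tendsto_const_div_atTop_nhds_zero_nat (1 : ℝ))
        simpa using this
      refine tendsto_of_tendsto_of_tendsto_of_le_of_le' h1 h2 ?_ ?_
      · filter_upwards [eventually_gt_atTop 0] with n hn
        have hn' : (0 : ℝ) < n := by exact_mod_cast hn
        have h3 : n ≤ 3 * ((n + d) / 3) + 3 := by omega
        have h4 : (n : ℝ) ≤ 3 * (((n + d) / 3 : ℕ) : ℝ) + 3 := by exact_mod_cast h3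
        rw [le_div_iff₀ hn', sub_mul, one_div, inv_mul_cancel₀ hn'.ne']
        linarith
      · filter_upwards [eventually_gt_atTop 0] with n hn
        have hn' : (0 : ℝ) < n := by exact_mod_cast hn
        have h3 : 3 * ((n + d) / 3) ≤ n + 3 := by omega
        have h4 : 3 * (((n + d) / 3 : ℕ) : ℝ) ≤ n + 3 := by exact_mod_cast h3
        rw [div_le_iff₀ hn', add_mul, one_div, inv_mul_cancel₀ hn'.ne']
        linarith
    refine (((h (2 - d)).comp hN).mul hr).congr' ?_
    filter_upwards [eventually_ge_atTop 3] with n hn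
    have : (((n + d) / 3 : ℕ) : ℝ) ≠ 0 := by
      have : 0 < (n + d) / 3 := by omega
      exact_mod_cast this.ne'
    simp only [Function.comp_apply]
    field_simp
  have h3 := ((key 2 le_rfl).add (key 1 (by norm_num))).add (key 0 (by norm_num))
  refine (h3.congr fun n => ?_).trans (le_of_eq ?_)
  · rw [sum_range_eq_sum_residues x n, add_div, add_div]
    rfl
  · congr 1; ring

variable {lam : ℝ} {νH νV κ : Measure ℝ} [IsProbabilityMeasure (expMeasure lam)]
  [IsProbabilityMeasure νH] [IsProbabilityMeasure νV] [IsProbabilityMeasure κ]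

/-- Strong law of large numbers for functions of three successive cycles. -/
lemma strong_law_threeData (hg : ∀ᵐ z ∂(pathLaw lam νH νV κ), Good z)
    (hg' : ∀ᵐ z ∂(pathLaw lam νH νV νH), Good z)
    {q : ((ℝ × ℝ × ℝ) × (ℝ × ℝ × ℝ)) × (ℝ × ℝ × ℝ) → ℝ} (hq : Measurable q)
    (hint : Integrable (fun z => q (threeData z)) (pathLaw lam νH νV νH)) :
    ∀ᵐ z ∂(pathLaw lam νH νV κ), Tendsto (fun n : ℕ =>
      (∑ l ∈ Finset.range n, q (threeData (next^[l + 1] z))) / (n : ℝ)) atTop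
      (𝓝 (∫ z, q (threeData z) ∂(pathLaw lam νH νV νH))) := by
  set μ := pathLaw lam νH νV κ with hμ
  have hqm : Measurable fun z => q (threeData z) := hq.comp measurable_threeData
  have hident : ∀ l, IdentDistrib (fun z => q (threeData (next^[l + 1] z)))
      (fun z => q (threeData z)) μ (pathLaw lam νH νV νH) := fun l =>
    ⟨(hqm.comp (measurable_iterate_next _)).aemeasurable, hqm.aemeasurable, by
      rw [← map_iterate_next hg hg' l, Measure.map_map hqm (measurable_iterate_next _)]; rfl⟩
  have hindep : ∀ i j, i + 3 ≤ j → IndepFun (fun z => q (threeData (next^[i + 1] z)))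
      (fun z => q (threeData (next^[j + 1] z))) μ := by
    intro i j hij
    obtain ⟨d, rfl⟩ := Nat.exists_eq_add_of_le hij
    have h := (indepFun_threeData hg hg' (i + 1)).comp hq (hqm.comp (measurable_iterate_next d))
    have e : ∀ z : Path, next^[i + 3 + d + 1] z = next^[d] (next^[i + 1 + 3] z) := fun z => by
      rw [← Function.iterate_add_apply]; congr 1; omega
    simp only [e]
    exact h
  have hres : ∀ r : ℕ, ∀ᵐ z ∂μ, Tendsto (fun n : ℕ =>
      (∑ k ∈ Finset.range n, q (threeData (next^[3 * k + r + 1] z))) / (n : ℝ)) atTop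
      (𝓝 (∫ z, q (threeData z) ∂(pathLaw lam νH νV νH))) := by
    intro r
    -- Within a residue class the blocks of three cycles do not overlap. Pairwise independence
    -- suffices for this strong law, and the shift by one cycle makes the summands identically
    -- distributed.
    have h := strong_law_ae_real (μ := μ) (fun k z => q (threeData (next^[3 * k + r + 1] z)))
      ((hident _).integrable_iff.2 hint) (fun i j hij => by
        rcases lt_or_gt_of_ne hij with h | h
        · exact hindep _ _ (by omega)
        · exact (hindep (3 * j + r) (3 * i + r) (by omega)).symm)
      (fun i => (hident _).trans (hident _).symm)
    rwa [(hident _).integral_eq] at h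
  filter_upwards [ae_all_iff.2 hres] with z hz
  exact tendsto_average_of_residues (x := fun l => q (threeData (next^[l + 1] z))) hz

end StrongLaw

/-! ### Means of the peak and of the area under the age. -/

section Expectations

variable {lam : ℝ} {νH νV κ : Measure ℝ} [IsProbabilityMeasure (expMeasure lam)]
  [IsProbabilityMeasure νH] [IsProbabilityMeasure νV] [IsProbabilityMeasure κ]

lemma integral_comp_iterate_next (hg : ∀ᵐ z ∂(pathLaw lam νH νV κ), Good z)
    (hg' : ∀ᵐ z ∂(pathLaw lam νH νV νH), Good z) {f : Path → ℝ} (hf : Measurable f) (l : ℕ) :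
    ∫ z, f (next^[l + 1] z) ∂(pathLaw lam νH νV κ) = ∫ z, f z ∂(pathLaw lam νH νV νH) := by
  rw [← map_iterate_next hg hg' l, integral_map (measurable_iterate_next _).aemeasurable
    hf.aestronglyMeasurable]

lemma integrable_comp_iterate_next (hg : ∀ᵐ z ∂(pathLaw lam νH νV κ), Good z)
    (hg' : ∀ᵐ z ∂(pathLaw lam νH νV νH), Good z) {f : Path → ℝ}
    (hf : Integrable f (pathLaw lam νH νV νH)) (l : ℕ) :
    Integrable (fun z => f (next^[l + 1] z)) (pathLaw lam νH νV κ) := by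
  rw [← map_iterate_next hg hg' l] at hf
  exact hf.comp_measurable (measurable_iterate_next _)

lemma map_services_succ (l : ℕ) :
    (pathLaw lam νH νV κ).map (fun z => services z (l + 1)) = νH :=
  pathLaw_map_apply (Sum.inr (Sum.inl (l + 1)))

lemma integrable_services {f : ℝ → ℝ} (hf : Integrable f νH) (l : ℕ) :
    Integrable (fun z => f (services z (l + 1))) (pathLaw lam νH νV κ) := by
  rw [← map_services_succ (lam := lam) (νV := νV) (κ := κ) (νH := νH) l] at hf
  exact hf.comp_measurable (measurable_services _)

lemma integral_services {f : ℝ → ℝ} (hf : Measurable f) (l : ℕ) :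
    ∫ z, f (services z (l + 1)) ∂(pathLaw lam νH νV κ) = ∫ x, f x ∂νH := by
  conv_rhs => rw [← map_services_succ (lam := lam) (νV := νV) (κ := κ) (νH := νH) l]
  rw [integral_map (measurable_services _).aemeasurable hf.aestronglyMeasurable]

/-- The peak of the age at the end of the service that follows two cycles. -/
def peak (z : Path) : ℝ := firstWait z + firstCycle (next z) + services (next (next z)) 0

lemma services_next_next (z : Path) : services (next (next z)) 0 = services z 2 := rfl

lemma integrable_peak (hg : ∀ᵐ z ∂(pathLaw lam νH νV κ), Good z)
    (hw : Integrable firstWait (pathLaw lam νH νV κ))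
    (hc : Integrable firstCycle (pathLaw lam νH νV νH)) (hH : Integrable (fun x => x) νH) :
    Integrable peak (pathLaw lam νH νV κ) := by
  have h1 : Integrable (fun z => firstCycle (next z)) (pathLaw lam νH νV κ) := by
    rw [← map_next hg] at hc
    exact hc.comp_measurable measurable_next
  exact (hw.add h1).add (integrable_services hH 1)

lemma integral_peak (hg : ∀ᵐ z ∂(pathLaw lam νH νV κ), Good z)
    (hw : Integrable firstWait (pathLaw lam νH νV κ))
    (hc : Integrable firstCycle (pathLaw lam νH νV νH)) (hH : Integrable (fun x => x) νH) :
    ∫ z, peak z ∂(pathLaw lam νH νV κ) = ∫ z, firstWait z ∂(pathLaw lam νH νV κ)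
      + ∫ z, firstCycle z ∂(pathLaw lam νH νV νH) + ∫ x, x ∂νH := by
  have hc0 := hc
  have h1 : Integrable (fun z => firstCycle (next z)) (pathLaw lam νH νV κ) := by
    rw [← map_next hg] at hc
    exact hc.comp_measurable measurable_next
  have h2 : ∫ z, firstCycle (next z) ∂(pathLaw lam νH νV κ)
      = ∫ z, firstCycle z ∂(pathLaw lam νH νV νH) := by
    rw [← map_next hg, integral_map measurable_next.aemeasurable
      measurable_firstCycle.aestronglyMeasurable]
  have h3 := integrable_services (lam := lam) (νV := νV) (κ := κ) hH 1
  have e : ∀ z, peak z = firstWait z + firstCycle (next z) + services z (1 + 1) := fun z => rfl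
  simp only [e]
  have h4 : Integrable (fun z => firstWait z + firstCycle (next z)) (pathLaw lam νH νV κ) :=
    hw.add h1
  rw [integral_add h4 h3, integral_add hw h1, h2, integral_services measurable_id' 1]

/-- Area under the age between the completions that end the first two cycles. -/
def area (z : Path) : ℝ := (peak z ^ 2 - (firstWait z + services (next z) 0) ^ 2) / 2

lemma measurable_peak : Measurable peak := by unfold peak; fun_prop

lemma measurable_area : Measurable area :=
  ((measurable_peak.pow_const 2).sub ((measurable_firstWait.add
    ((measurable_services 0).comp measurable_next)).pow_const 2)).div_const 2

lemma memLp_services {f : Path → ℝ} (hf : Measurable f) {μ : Measure Path}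
    (h : Integrable (fun z => f z ^ 2) μ) : MemLp f 2 μ :=
  (memLp_two_iff_integrable_sq hf.aestronglyMeasurable).2 h

lemma memLp_firstWait (hg : ∀ᵐ z ∂(pathLaw lam νH νV κ), Good z)
    (hc : Integrable (fun z => firstCycle z ^ 2) (pathLaw lam νH νV κ)) :
    MemLp firstWait 2 (pathLaw lam νH νV κ) := by
  refine (memLp_services measurable_firstCycle hc).mono measurable_firstWait.aestronglyMeasurable ?_
  filter_upwards [hg] with z hz
  rw [Real.norm_eq_abs, Real.norm_eq_abs, abs_of_nonneg hz.firstWait_nonneg,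
    abs_of_nonneg hz.firstCycle_pos.le]
  exact hz.firstWait_lt_firstCycle.le

lemma integrable_area (hg : ∀ᵐ z ∂(pathLaw lam νH νV κ), Good z)
    (hc : Integrable (fun z => firstCycle z ^ 2) (pathLaw lam νH νV κ))
    (hc' : Integrable (fun z => firstCycle z ^ 2) (pathLaw lam νH νV νH))
    (hH : Integrable (fun x => x ^ 2) νH) : Integrable area (pathLaw lam νH νV κ) := by
  have h1 := memLp_firstWait hg hc
  have h2 : MemLp (fun z => firstCycle (next z)) 2 (pathLaw lam νH νV κ) := by
    refine memLp_services (measurable_firstCycle.comp measurable_next) ?_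
    rw [← map_next hg] at hc'
    exact hc'.comp_measurable measurable_next
  have h3 : ∀ l, MemLp (fun z => services z (l + 1)) 2 (pathLaw lam νH νV κ) := fun l =>
    memLp_services (measurable_services _) (integrable_services hH l)
  have hp := (memLp_two_iff_integrable_sq
    ((measurable_firstWait.add (measurable_firstCycle.comp measurable_next)).add
      (measurable_services 2)).aestronglyMeasurable).1 ((h1.add h2).add (h3 1))
  have hb := (memLp_two_iff_integrable_sq
    (measurable_firstWait.add (measurable_services 1)).aestronglyMeasurable).1 (h1.add (h3 0))
  exact (hp.sub hb).div_const 2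

/-- Mean area under the age between two completions. -/
lemma integral_area (hg' : ∀ᵐ z ∂(pathLaw lam νH νV νH), Good z)
    (hc : Integrable (fun z => firstCycle z ^ 2) (pathLaw lam νH νV νH))
    (hH : Integrable (fun x => x ^ 2) νH) :
    ∫ z, area z ∂(pathLaw lam νH νV νH)
      = (∫ z, firstCycle z ^ 2 ∂(pathLaw lam νH νV νH)) / 2
        + (∫ z, firstCycle z ∂(pathLaw lam νH νV νH))
          * (∫ x, x ∂νH + ∫ z, firstWait z ∂(pathLaw lam νH νV νH)) := by
  set μ := pathLaw lam νH νV νH with hμ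
  have hmn := measurable_next
  have hG := memLp_firstWait hg' hc
  have hI' := memLp_services measurable_firstCycle hc
  have hmapn : μ.map next = μ := map_next hg'
  have hI : MemLp (fun z => firstCycle (next z)) 2 μ := by
    refine memLp_services (measurable_firstCycle.comp measurable_next) ?_
    rw [← hmapn] at hc
    exact hc.comp_measurable measurable_next
  have hh : ∀ l, MemLp (fun z => services z (l + 1)) 2 μ := fun l =>
    memLp_services (measurable_services _) (integrable_services hH l)
  have hH1 := integrable_of_integrable_sq hH
  have eI : ∫ z, firstCycle (next z) ∂μ = ∫ z, firstCycle z ∂μ := by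
    conv_rhs => rw [← hmapn]
    rw [integral_map measurable_next.aemeasurable measurable_firstCycle.aestronglyMeasurable]
  have eI2 : ∫ z, firstCycle (next z) ^ 2 ∂μ = ∫ z, firstCycle z ^ 2 ∂μ := by
    conv_rhs => rw [← hmapn]
    rw [integral_map measurable_next.aemeasurable
      (measurable_firstCycle.pow_const 2).aestronglyMeasurable]
  have ind0 : IndepFun firstData next μ := indepFun_next hg'
  have i1 : IndepFun (fun z => firstCycle (next z)) (fun z => services z 2) μ := by
    have h := (indepFun_firstData_iterate (κ := νH) hg' hg' 1).comp
      (φ := fun q : ℝ × ℝ × ℝ => q.2.1) (ψ := fun z : Path => services z 0) (by fun_prop) (by fun_prop)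
    exact h
  have i2 : IndepFun firstWait (fun z => firstCycle (next z)) μ :=
    ind0.comp (φ := fun q : ℝ × ℝ × ℝ => q.2.2) (ψ := firstCycle) (by fun_prop) (by fun_prop)
  have i3 : IndepFun firstWait (fun z => services z 2 - services z 1) μ :=
    ind0.comp (φ := fun q : ℝ × ℝ × ℝ => q.2.2) (ψ := fun z : Path => services z 1 - services z 0)
      (by fun_prop) (by fun_prop)
  have e1 := i1.integral_fun_mul_eq_mul_integral hI.aestronglyMeasurable (hh 1).aestronglyMeasurable
  have e2 := i2.integral_fun_mul_eq_mul_integral hG.aestronglyMeasurable hI.aestronglyMeasurable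
  have e3 := i3.integral_fun_mul_eq_mul_integral hG.aestronglyMeasurable
    ((hh 1).sub (hh 0)).aestronglyMeasurable
  have s1 : ∫ z, services z 2 ∂μ = ∫ x, x ∂νH := integral_services measurable_id' 1
  have s0 : ∫ z, services z 1 ∂μ = ∫ x, x ∂νH := integral_services measurable_id' 0
  have s1' : ∫ z, services z 2 ^ 2 ∂μ = ∫ x, x ^ 2 ∂νH :=
    integral_services (measurable_id'.pow_const 2) 1
  have s0' : ∫ z, services z 1 ^ 2 ∂μ = ∫ x, x ^ 2 ∂νH :=
    integral_services (measurable_id'.pow_const 2) 0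
  have hi1 : Integrable (fun z => firstCycle (next z) ^ 2 / 2) μ := hI.integrable_sq.div_const 2
  have hi2 : Integrable (fun z => firstCycle (next z) * services z 2) μ := hI.integrable_mul (hh 1)
  have hi3 : Integrable (fun z => firstWait z * firstCycle (next z)) μ := hG.integrable_mul hI
  have hi4 : Integrable (fun z => firstWait z * (services z 2 - services z 1)) μ :=
    hG.integrable_mul ((hh 1).sub (hh 0))
  have q1 : Integrable (fun z => services z 2 ^ 2) μ := (hh 1).integrable_sq
  have q0 : Integrable (fun z => services z 1 ^ 2) μ := (hh 0).integrable_sq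
  have hi5 : Integrable (fun z => (services z 2 ^ 2 - services z 1 ^ 2) / 2) μ :=
    (q1.sub q0).div_const 2
  -- In this expansion every product has independent factors: the length of the second cycle never
  -- meets `services z 1`, the service that opens it. The last two terms have mean 0 since the two
  -- services have the same law.
  have e : ∀ z, area z = firstCycle (next z) ^ 2 / 2 + firstCycle (next z) * services z 2
      + firstWait z * firstCycle (next z) + firstWait z * (services z 2 - services z 1)
      + (services z 2 ^ 2 - services z 1 ^ 2) / 2 := fun z => by
    change ((firstWait z + firstCycle (next z) + services z 2) ^ 2
      - (firstWait z + services z 1) ^ 2) / 2 = _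
    ring
  simp only [e]
  have a2 : Integrable (fun z => firstCycle (next z) ^ 2 / 2
      + firstCycle (next z) * services z 2) μ := hi1.add hi2
  have a3 : Integrable (fun z => firstCycle (next z) ^ 2 / 2 + firstCycle (next z) * services z 2
      + firstWait z * firstCycle (next z)) μ := a2.add hi3
  have a4 : Integrable (fun z => firstCycle (next z) ^ 2 / 2 + firstCycle (next z) * services z 2
      + firstWait z * firstCycle (next z) + firstWait z * (services z 2 - services z 1)) μ :=
    a3.add hi4
  rw [integral_add a4 hi5, integral_add a3 hi4, integral_add a2 hi3, integral_add hi1 hi2, integral_div, integral_div,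
    integral_sub q1 q0, s1', s0', e1, e2, e3,
    integral_sub (integrable_services hH1 1) (integrable_services hH1 0), s1, s0, eI, eI2]
  ring

end Expectations

/-! ### Elementary facts on averages. -/

section Deterministic

lemma tendsto_average_of_shift {x : ℕ → ℝ} {c : ℝ}
    (h : Tendsto (fun n : ℕ => (∑ l ∈ Finset.range n, x (l + 1)) / (n : ℝ)) atTop (𝓝 c)) :
    Tendsto (fun n : ℕ => (∑ l ∈ Finset.range (n + 1), x l) / (n : ℝ)) atTop (𝓝 c) := by
  have h2 := h.add (tendsto_const_div_atTop_nhds_zero_nat (x 0))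
  rw [add_zero] at h2
  refine h2.congr fun n => ?_
  rw [Finset.sum_range_succ', add_div]

lemma tendsto_div_of_succ {y : ℕ → ℝ} {c : ℝ}
    (h : Tendsto (fun n : ℕ => y (n + 1) / (n : ℝ)) atTop (𝓝 c)) :
    Tendsto (fun n : ℕ => y n / (n : ℝ)) atTop (𝓝 c) := by
  rw [← tendsto_add_atTop_iff_nat 1]
  have hr : Tendsto (fun n : ℕ => (n : ℝ) / ((n : ℝ) + 1)) atTop (𝓝 1) :=
    tendsto_natCast_div_add_atTop 1
  have h2 := h.mul hr
  rw [mul_one] at h2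
  refine h2.congr' ?_
  filter_upwards [eventually_gt_atTop 0] with n hn
  have : (n : ℝ) ≠ 0 := by positivity
  push_cast
  field_simp

lemma tendsto_succ_div {y : ℕ → ℝ} {c : ℝ}
    (h : Tendsto (fun n : ℕ => y n / (n : ℝ)) atTop (𝓝 c)) :
    Tendsto (fun n : ℕ => y (n + 1) / (n : ℝ)) atTop (𝓝 c) := by
  have hr : Tendsto (fun n : ℕ => ((n : ℝ) + 1) / n) atTop (𝓝 1) := by
    have := tendsto_const_nhds (x := (1 : ℝ)).add (tendsto_const_div_atTop_nhds_zero_nat (1 : ℝ))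
    rw [add_zero] at this
    refine this.congr' ?_
    filter_upwards [eventually_gt_atTop 0] with n hn
    have : (n : ℝ) ≠ 0 := by positivity
    field_simp
  have h2 := (h.comp (tendsto_add_atTop_nat 1)).mul hr
  rw [mul_one] at h2
  refine h2.congr' ?_
  filter_upwards [eventually_gt_atTop 0] with n hn
  have : (n : ℝ) ≠ 0 := by positivity
  simp only [Function.comp_apply]
  push_cast
  field_simp

/-- Cesàro means of a bounded measurable function on `[0, ∞)`. -/
lemma tendsto_integral_average {f : ℝ → ℝ} {L B : ℝ} (hm : Measurable f)
    (hB : ∀ t, 0 ≤ t → |f t| ≤ B) (hL : Tendsto f atTop (𝓝 L)) :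
    Tendsto (fun T : ℝ => T⁻¹ * ∫ t in (0 : ℝ)..T, f t) atTop (𝓝 L) := by
  -- Substituting `t = T * u` turns the average into an integral over `[0, 1]`, where the bound `B`
  -- permits dominated convergence.
  have h1 : Tendsto (fun T : ℝ => ∫ u in (0 : ℝ)..1, f (T * u)) atTop
      (𝓝 (∫ _ in (0 : ℝ)..1, L)) := by
    refine intervalIntegral.tendsto_integral_filter_of_dominated_convergence (fun _ => B) ?_ ?_ ?_ ?_
    · exact Eventually.of_forall fun T =>
        (hm.comp (measurable_const_mul T)).aestronglyMeasurable
    · filter_upwards [eventually_ge_atTop 0] with T hT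
      refine ae_of_all _ fun u hu => ?_
      rw [uIoc_of_le zero_le_one] at hu
      exact hB _ (mul_nonneg hT hu.1.le)
    · exact intervalIntegrable_const
    · refine ae_of_all _ fun u hu => ?_
      rw [uIoc_of_le zero_le_one] at hu
      exact hL.comp (tendsto_id.atTop_mul_const hu.1)
  have h2 : ∫ _ in (0 : ℝ)..1, L = L := by simp
  rw [h2] at h1
  refine h1.congr' ?_
  filter_upwards [eventually_gt_atTop 0] with T hT
  rw [intervalIntegral.integral_comp_mul_left f hT.ne', mul_zero, mul_one, smul_eq_mul]

end Deterministic

/-! ### The age along a path of inputs. -/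

/-- Completion times of the served packets of a path. -/
def completionTime (z : Path) (l : ℕ) : ℝ := cycleStart z (l + 1) + services z (l + 1)

/-- Generation times of the served packets of a path. -/
def generationTime (z : Path) (l : ℕ) : ℝ := cycleStart z (l + 1) - firstWait (next^[l] z)

section Paths

variable {z : Path} {a : ℝ}

lemma cycleStart_strictMono (hz : ∀ l, Good (next^[l] z)) : StrictMono (cycleStart z) :=
  strictMono_nat_of_lt_succ fun l => by
    rw [cycleStart_succ]; linarith [(hz l).firstCycle_pos]

lemma completionTime_le (hz : ∀ l, Good (next^[l] z)) (l : ℕ) :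
    completionTime z l ≤ cycleStart z (l + 2) := by
  rw [completionTime, cycleStart_succ z (l + 1)]
  have h := (hz (l + 1)).services_le_firstCycle
  rw [services_iterate] at h
  simpa using h

lemma le_completionTime (hz : ∀ l, Good (next^[l] z)) (l : ℕ) :
    cycleStart z (l + 1) ≤ completionTime z l := by
  have := (hz 0).services_nonneg (l + 1)
  rw [completionTime]
  simp only [Function.iterate_zero, id] at this
  linarith

lemma isSchedule (hz : ∀ l, Good (next^[l] z)) (hS : Tendsto (cycleStart z) atTop atTop) :
    IsSchedule (completionTime z) (generationTime z) where
  pos := by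
    rw [generationTime, cycleStart_succ]
    have := (hz 0).firstWait_lt_firstCycle
    simp only [cycleStart, Finset.range_zero, Finset.sum_empty]
    linarith
  strictMono := strictMono_nat_of_lt_succ fun l => by
    rw [generationTime, generationTime, cycleStart_succ z (l + 1)]
    linarith [(hz l).firstWait_nonneg, (hz (l + 1)).firstWait_lt_firstCycle]
  mono := monotone_nat_of_le_succ fun l => (completionTime_le hz l).trans (le_completionTime hz _)
  le l := by
    refine le_trans ?_ (le_completionTime hz l)
    rw [generationTime]
    linarith [(hz l).firstWait_nonneg]
  unbounded := tendsto_atTop_mono (le_completionTime hz)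
    (hS.comp (tendsto_add_atTop_nat 1))

lemma peak_iterate (z : Path) (l : ℕ) :
    completionTime z (l + 1) - generationTime z l = peak (next^[l] z) := by
  have h1 : services (next (next (next^[l] z))) 0 = services z (l + 2) := by
    rw [← Function.iterate_succ_apply' next, ← Function.iterate_succ_apply' next, services_iterate]
  rw [completionTime, generationTime, cycleStart_succ z (l + 1), peak, h1,
    Function.iterate_succ_apply']
  ring

lemma area_iterate (z : Path) (l : ℕ) :
    ((completionTime z (l + 1) - generationTime z l) ^ 2
      - (completionTime z l - generationTime z l) ^ 2) / 2 = area (next^[l] z) := by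
  have h1 : services (next (next^[l] z)) 0 = services z (l + 1) := by
    rw [← Function.iterate_succ_apply' next, services_iterate]
  rw [peak_iterate, area, h1, completionTime, generationTime]
  congr 3; ring

lemma age_eq (hz : ∀ l, Good (next^[l] z)) (h0 : services z 0 = 0) (t : ℝ) :
    age a (gaps z) (servedTimes z) (vacations z) t
      = ageAt a (completionTime z) (generationTime z) t := by
  have e1 : completion (gaps z) (servedTimes z) (vacations z) = completionTime z :=
    funext fun l => completion_eq hz h0 l
  have e2 : genTime (gaps z) (servedTimes z) (vacations z) = generationTime z :=
    funext fun l => genTime_eq hz h0 l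
  rw [age, e1, e2]; rfl

/-- The age as a jointly measurable function of the path and of time. -/
def jointAge (a : ℝ) (q : Path × ℝ) : ℝ :=
  q.2 - ⨆ l, if completionTime q.1 l ≤ q.2 then generationTime q.1 l else -a

lemma measurable_completionTime (l : ℕ) : Measurable fun z => completionTime z l := by
  unfold completionTime; fun_prop

lemma measurable_generationTime (l : ℕ) : Measurable fun z => generationTime z l :=
  (measurable_cycleStart _).sub (measurable_firstWait.comp (measurable_iterate_next l))

lemma measurable_jointAge (a : ℝ) : Measurable (jointAge a) := by
  refine measurable_snd.sub (Measurable.iSup fun l => Measurable.ite ?_ ?_ measurable_const)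
  · exact measurableSet_le ((measurable_completionTime l).comp measurable_fst) measurable_snd
  · exact (measurable_generationTime l).comp measurable_fst

/-- A countable supremum of measurable terms is jointly measurable in path and time, which Fubini
needs. Packets not yet completed contribute `-a`, which belongs to the set anyway. -/
lemma ageAt_eq_jointAge (h : IsSchedule (completionTime z) (generationTime z)) (ha : 0 ≤ a)
    (t : ℝ) : ageAt a (completionTime z) (generationTime z) t = jointAge a (z, t) := by
  rw [ageAt, jointAge]
  congr 1
  have hmem : ∀ l, (if completionTime z l ≤ t then generationTime z l else -a)
      ∈ insert (-a) {x : ℝ | ∃ l, completionTime z l ≤ t ∧ generationTime z l = x} := fun l => by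
    split_ifs with hl
    · exact Or.inr ⟨l, hl, rfl⟩
    · exact Or.inl rfl
  have hbdd : BddAbove (range fun l =>
      if completionTime z l ≤ t then generationTime z l else -a) :=
    (h.bddAbove (a := a) t).mono (range_subset_iff.2 hmem)
  refine le_antisymm (csSup_le (insert_nonempty _ _) ?_)
    (ciSup_le fun l => le_csSup (h.bddAbove t) (hmem l))
  rintro x (rfl | ⟨l, hl, rfl⟩)
  · refine le_trans ?_ (le_ciSup hbdd 0)
    split_ifs
    · linarith [h.r_pos 0]
    · exact le_rfl
  · have := le_ciSup hbdd l
    simp only [hl, if_true] at this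
    exact this

/-- The area under the age up to time `T` is at most the area under the age in the cycles that
begin before `T`. -/
lemma integral_age_le (hz : ∀ l, Good (next^[l] z))
    (h : IsSchedule (completionTime z) (generationTime z)) (ha : 0 ≤ a) {T : ℝ} (hT : 0 ≤ T) :
    ENNReal.ofReal (∫ t in (0 : ℝ)..T, ageAt a (completionTime z) (generationTime z) t)
      ≤ ENNReal.ofReal (((completionTime z 0 + a) ^ 2 - a ^ 2) / 2 + area z)
        + ∑' l, {z | cycleStart z (l + 1) ≤ T}.indicator 1 z
          * ENNReal.ofReal (area (next^[l + 1] z)) := by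
  have harea : ∀ l, 0 ≤ area (next^[l] z) := fun l => by
    rw [← area_iterate, ← h.integral_ageAt_succ ha]
    exact intervalIntegral.integral_nonneg (h.mono l.le_succ) fun u hu =>
      h.ageAt_nonneg ha ((h.C_pos l).le.trans hu.1)
  rcases lt_or_ge T (completionTime z 0) with hlt | hge
  · refine le_trans (ENNReal.ofReal_le_ofReal ?_) le_self_add
    have h1 := h.integral_ageAt_mono ha hT hlt.le
    rw [h.integral_ageAt_zero] at h1
    have := harea 0
    simp only [Function.iterate_zero, id] at this
    linarith
  -- The integral is extended to completion `k + 1`; the areas it collects, up to index `k`, belong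
  -- to cycles begun by completion `k`, hence by `T`. The area of index 0 is kept apart because its
  -- law involves `κ`.
  · obtain ⟨k, hk1, hk2⟩ := h.exists_index hge
    have h1 := h.integral_ageAt_mono ha hT hk2.le
    rw [h.integral_ageAt_completion ha, Finset.sum_range_succ'] at h1
    simp only [area_iterate] at h1
    refine (ENNReal.ofReal_le_ofReal h1).trans ?_
    rw [add_comm (∑ l ∈ Finset.range k, _), ← add_assoc]
    simp only [Function.iterate_zero, id]
    refine ENNReal.ofReal_add_le.trans (add_le_add le_rfl ?_)
    rw [ENNReal.ofReal_sum_of_nonneg fun l _ => harea _]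
    refine le_trans (Finset.sum_le_sum fun l hl => ?_) (ENNReal.sum_le_tsum (Finset.range k))
    rw [indicator_of_mem, Pi.one_apply, one_mul]
    have hlk : l + 1 ≤ k := Finset.mem_range.1 hl
    change cycleStart z (l + 1) ≤ T
    refine le_trans ?_ hk1
    refine le_trans ?_ (le_completionTime hz k)
    exact (cycleStart_strictMono hz).monotone (by omega)

/-- Cycles that begin by `T` fill at most `[0, T]` plus the overshoot of the last one, which
truncation caps at `M`. The minimum with `cycleStart z (n + 1)` is what the induction needs while no
cycle start has passed `T`. -/
lemma sum_truncated_cycles_le (hz : ∀ l, Good (next^[l] z)) {T M : ℝ} (hT : 0 ≤ T) (hM : 0 ≤ M)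
    (n : ℕ) : ∑ l ∈ Finset.range n, {z | cycleStart z (l + 1) ≤ T}.indicator
        (fun _ => (1 : ℝ≥0∞)) z * ENNReal.ofReal (min (firstCycle (next^[l + 1] z)) M)
      ≤ ENNReal.ofReal (min (cycleStart z (n + 1)) (T + M)) := by
  have hpos : ∀ l, 0 ≤ cycleStart z l := fun l => by
    have := (cycleStart_strictMono hz).monotone (Nat.zero_le l)
    simpa [cycleStart] using this
  induction n with
  | zero => simp
  | succ n ih =>
    rw [Finset.sum_range_succ, cycleStart_succ z (n + 1)]
    have hI := (hz (n + 1)).firstCycle_pos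
    by_cases h : cycleStart z (n + 1) ≤ T
    · rw [indicator_of_mem (by exact h), one_mul]
      refine (add_le_add ih le_rfl).trans ?_
      rw [← ENNReal.ofReal_add (le_min (hpos _) (by linarith)) (le_min hI.le hM)]
      refine ENNReal.ofReal_le_ofReal ?_
      rw [min_eq_left (by linarith : cycleStart z (n + 1) ≤ T + M)]
      refine le_min ?_ ?_
      · linarith [min_le_left (firstCycle (next^[n + 1] z)) M]
      · linarith [min_le_right (firstCycle (next^[n + 1] z)) M]
    · rw [indicator_of_notMem (by exact h), zero_mul, add_zero]
      refine ih.trans (ENNReal.ofReal_le_ofReal ?_)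
      exact min_le_min_right _ (by linarith)

end Paths

/-! ### Time averages of the age and of its mean. -/

section Averages

variable {lam : ℝ} {νH νV κ : Measure ℝ} [IsProbabilityMeasure (expMeasure lam)]
  [IsProbabilityMeasure νH] [IsProbabilityMeasure νV] [IsProbabilityMeasure κ]

lemma ae_tendsto_average (hg : ∀ᵐ z ∂(pathLaw lam νH νV κ), Good z)
    (hg' : ∀ᵐ z ∂(pathLaw lam νH νV νH), Good z)
    {q : ((ℝ × ℝ × ℝ) × (ℝ × ℝ × ℝ)) × (ℝ × ℝ × ℝ) → ℝ} (hq : Measurable q)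
    (hint : Integrable (fun z => q (threeData z)) (pathLaw lam νH νV νH)) :
    ∀ᵐ z ∂(pathLaw lam νH νV κ), Tendsto (fun n : ℕ =>
      (∑ l ∈ Finset.range n, q (threeData (next^[l] z))) / (n : ℝ)) atTop
      (𝓝 (∫ z, q (threeData z) ∂(pathLaw lam νH νV νH))) := by
  filter_upwards [strong_law_threeData hg hg' hq hint] with z hz
  exact tendsto_div_of_succ (y := fun n => ∑ l ∈ Finset.range n, q (threeData (next^[l] z)))
    (tendsto_average_of_shift (x := fun l => q (threeData (next^[l] z))) hz)

lemma ae_tendsto_average_peak (hg : ∀ᵐ z ∂(pathLaw lam νH νV κ), Good z)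
    (hg' : ∀ᵐ z ∂(pathLaw lam νH νV νH), Good z)
    (hint : Integrable peak (pathLaw lam νH νV νH)) :
    ∀ᵐ z ∂(pathLaw lam νH νV κ), Tendsto (fun n : ℕ =>
      (∑ l ∈ Finset.range n, peak (next^[l] z)) / (n : ℝ)) atTop
      (𝓝 (∫ z, peak z ∂(pathLaw lam νH νV νH))) :=
  ae_tendsto_average hg hg' (q := fun p => p.1.1.2.2 + p.1.2.2.1 + p.2.1) (by fun_prop) hint

lemma ae_tendsto_average_area (hg : ∀ᵐ z ∂(pathLaw lam νH νV κ), Good z)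
    (hg' : ∀ᵐ z ∂(pathLaw lam νH νV νH), Good z)
    (hint : Integrable area (pathLaw lam νH νV νH)) :
    ∀ᵐ z ∂(pathLaw lam νH νV κ), Tendsto (fun n : ℕ =>
      (∑ l ∈ Finset.range n, area (next^[l] z)) / (n : ℝ)) atTop
      (𝓝 (∫ z, area z ∂(pathLaw lam νH νV νH))) :=
  ae_tendsto_average hg hg'
    (q := fun p => ((p.1.1.2.2 + p.1.2.2.1 + p.2.1) ^ 2 - (p.1.1.2.2 + p.1.2.1) ^ 2) / 2)
    (by fun_prop) hint

lemma ae_tendsto_cycleStart_div (hg : ∀ᵐ z ∂(pathLaw lam νH νV κ), Good z)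
    (hg' : ∀ᵐ z ∂(pathLaw lam νH νV νH), Good z)
    (hint : Integrable firstCycle (pathLaw lam νH νV νH)) :
    ∀ᵐ z ∂(pathLaw lam νH νV κ), Tendsto (fun n : ℕ => cycleStart z n / (n : ℝ)) atTop
      (𝓝 (∫ z, firstCycle z ∂(pathLaw lam νH νV νH))) :=
  ae_tendsto_average hg hg' (q := fun p => p.1.1.2.1) (by fun_prop) hint

lemma integral_firstCycle_pos (hg : ∀ᵐ z ∂(pathLaw lam νH νV κ), Good z)
    (hint : Integrable firstCycle (pathLaw lam νH νV κ)) :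
    0 < ∫ z, firstCycle z ∂(pathLaw lam νH νV κ) := by
  rw [integral_pos_iff_support_of_nonneg_ae (hg.mono fun z hz => hz.firstCycle_pos.le) hint]
  have : Function.support firstCycle =ᵐ[pathLaw lam νH νV κ] univ :=
    eventuallyEq_univ.2 (hg.mono fun z hz => hz.firstCycle_pos.ne')
  rw [measure_congr this, measure_univ]
  exact one_pos

lemma area_nonneg {z : Path} (hz : Good z) (hz' : Good (next z)) : 0 ≤ area z := by
  have h1 := hz'.services_le_firstCycle
  have h2 := hz.services_nonneg 2
  have h3 := hz.firstWait_nonneg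
  have h4 := hz.services_nonneg 1
  have e : services (next z) 0 = services z 1 := rfl
  rw [area, peak, services_next_next, e]
  rw [e] at h1
  nlinarith

lemma ae_tendsto_timeAverage (hg : ∀ᵐ z ∂(pathLaw lam νH νV κ), Good z)
    (hg' : ∀ᵐ z ∂(pathLaw lam νH νV νH), Good z)
    (hc : Integrable firstCycle (pathLaw lam νH νV νH))
    (hq : Integrable area (pathLaw lam νH νV νH)) {a : ℝ} (ha : 0 ≤ a) :
    ∀ᵐ z ∂(pathLaw lam νH νV κ), IsSchedule (completionTime z) (generationTime z) ∧
      Tendsto (fun T : ℝ => T⁻¹ * ∫ t in (0 : ℝ)..T,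
        ageAt a (completionTime z) (generationTime z) t) atTop
        (𝓝 ((∫ z, area z ∂(pathLaw lam νH νV νH))
          / ∫ z, firstCycle z ∂(pathLaw lam νH νV νH))) := by
  have hm := integral_firstCycle_pos hg' hc
  filter_upwards [ae_good_iterate hg hg', ae_tendsto_cycleStart_div hg hg' hc,
    ae_tendsto_average_area hg hg' hq] with z hz hS hA
  have hatTop : Tendsto (cycleStart z) atTop atTop := by
    have h1 := hS.pos_mul_atTop hm tendsto_natCast_atTop_atTop
    refine h1.congr' ?_
    filter_upwards [eventually_gt_atTop 0] with n hn
    have : (n : ℝ) ≠ 0 := by positivity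
    field_simp
  have hsch := isSchedule hz hatTop
  refine ⟨hsch, hsch.tendsto_average ha hm ?_ ?_⟩
  -- Completion `n` falls between the cycle starts `n + 1` and `n + 2`, so completion times grow at
  -- the same rate as cycle starts.
  · refine tendsto_of_tendsto_of_tendsto_of_le_of_le (tendsto_succ_div hS)
      (tendsto_succ_div (y := fun n => cycleStart z (n + 1)) (tendsto_succ_div hS))
      (fun n => ?_) fun n => ?_
    · exact div_le_div_of_nonneg_right (le_completionTime hz n) n.cast_nonneg
    · exact div_le_div_of_nonneg_right (completionTime_le hz n) n.cast_nonneg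
  · simpa only [area_iterate] using hA

lemma integral_swap_jointAge {a : ℝ} (ha : 0 ≤ a)
    (hs : ∀ᵐ z ∂(pathLaw lam νH νV κ), IsSchedule (completionTime z) (generationTime z))
    {T : ℝ} (hT : 0 ≤ T) :
    Integrable (fun z => ∫ t in (0 : ℝ)..T, jointAge a (z, t)) (pathLaw lam νH νV κ) ∧
    ∫ t in (0 : ℝ)..T, (∫ z, jointAge a (z, t) ∂(pathLaw lam νH νV κ))
      = ∫ z, (∫ t in (0 : ℝ)..T, jointAge a (z, t)) ∂(pathLaw lam νH νV κ) := by
  set μ := pathLaw lam νH νV κ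
  have hm := (measurable_jointAge a).stronglyMeasurable
  have hb : ∀ᵐ z ∂μ, ∀ t ∈ Ioc 0 T, ‖jointAge a (z, t)‖ ≤ T + a := by
    filter_upwards [hs] with z hz t ht
    rw [← ageAt_eq_jointAge hz ha, Real.norm_eq_abs, abs_of_nonneg (hz.ageAt_nonneg ha ht.1.le)]
    exact (hz.ageAt_le t).trans (by linarith [ht.2])
  have hfin : (volume.restrict (Ioc 0 T)) univ < ∞ := by simp
  have : IsFiniteMeasure (volume.restrict (Ioc 0 T)) := ⟨hfin⟩
  have hint : Integrable (jointAge a) (μ.prod (volume.restrict (Ioc 0 T))) := by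
    refine (integrable_prod_iff hm.aestronglyMeasurable).2 ⟨?_, ?_⟩
    · filter_upwards [hb] with z hz
      exact Integrable.of_bound (hm.comp_measurable measurable_prodMk_left).aestronglyMeasurable
        (T + a) ((ae_restrict_iff' measurableSet_Ioc).2 (ae_of_all _ hz))
    · refine Integrable.of_bound hm.norm.integral_prod_right'.aestronglyMeasurable
        ((T + a) * (volume.restrict (Ioc 0 T)).real univ) ?_
      filter_upwards [hb] with z hz
      refine norm_integral_le_of_norm_le_const ((ae_restrict_iff' measurableSet_Ioc).2
        (ae_of_all _ fun t ht => ?_))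
      rw [norm_norm]
      exact hz t ht
  simp only [intervalIntegral.integral_of_le hT]
  exact ⟨hint.integral_prod_left, (integral_integral_swap (f := fun z t => jointAge a (z, t)) hint).symm⟩

lemma lintegral_indicator_mul (hg : ∀ᵐ z ∂(pathLaw lam νH νV κ), Good z)
    (hg' : ∀ᵐ z ∂(pathLaw lam νH νV νH), Good z) (T : ℝ) {g : Path → ℝ≥0∞} (hgm : Measurable g)
    (l : ℕ) :
    ∫⁻ z, {z | cycleStart z (l + 1) ≤ T}.indicator (fun _ => (1 : ℝ≥0∞)) z * g (next^[l + 1] z)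
        ∂(pathLaw lam νH νV κ)
      = pathLaw lam νH νV κ {z | cycleStart z (l + 1) ≤ T}
        * ∫⁻ z, g z ∂(pathLaw lam νH νV νH) := by
  have hS : MeasurableSet {z | cycleStart z (l + 1) ≤ T} :=
    measurableSet_le (measurable_cycleStart _) measurable_const
  have hind : Measurable ((Iic T).indicator fun _ => (1 : ℝ≥0∞)) :=
    measurable_const.indicator measurableSet_Iic
  have h1 := lintegral_mul_eq_lintegral_mul_lintegral_of_indepFun
    (hind.comp (measurable_cycleStart (l + 1))) (hgm.comp (measurable_iterate_next (l + 1)))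
    ((indepFun_cycleStart (κ := κ) hg hg' (l + 1)).comp hind hgm)
  have h2 : ∫⁻ z, g (next^[l + 1] z) ∂(pathLaw lam νH νV κ) = ∫⁻ z, g z ∂(pathLaw lam νH νV νH) := by
    rw [← map_iterate_next hg hg' l, lintegral_map hgm (measurable_iterate_next _)]
  have h3 : ∫⁻ z, {z | cycleStart z (l + 1) ≤ T}.indicator (fun _ => (1 : ℝ≥0∞)) z
      ∂(pathLaw lam νH νV κ) = pathLaw lam νH νV κ {z | cycleStart z (l + 1) ≤ T} := by
    rw [lintegral_indicator hS, lintegral_one, Measure.restrict_apply_univ]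
  rw [← h2, ← h3]
  exact h1

/-- A bound for the expected number of cycles that begin before `T`. -/
lemma tsum_measure_mul_le (hg : ∀ᵐ z ∂(pathLaw lam νH νV κ), Good z)
    (hg' : ∀ᵐ z ∂(pathLaw lam νH νV νH), Good z) {T M : ℝ} (hT : 0 ≤ T) (hM : 0 ≤ M) :
    (∑' l, pathLaw lam νH νV κ {z | cycleStart z (l + 1) ≤ T})
        * ∫⁻ z, ENNReal.ofReal (min (firstCycle z) M) ∂(pathLaw lam νH νV νH)
      ≤ ENNReal.ofReal (T + M) := by
  have hgm : Measurable fun z => ENNReal.ofReal (min (firstCycle z) M) := by fun_prop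
  have hS : ∀ l, MeasurableSet {z | cycleStart z (l + 1) ≤ T} := fun l =>
    measurableSet_le (measurable_cycleStart _) measurable_const
  rw [← ENNReal.tsum_mul_right]
  refine ENNReal.summable.tsum_le_of_sum_range_le fun n => ?_
  simp only [← lintegral_indicator_mul hg hg' T hgm]
  have hmeas : ∀ l, Measurable fun z => {z | cycleStart z (l + 1) ≤ T}.indicator
      (fun _ => (1 : ℝ≥0∞)) z * ENNReal.ofReal (min (firstCycle (next^[l + 1] z)) M) := fun l =>
    (measurable_const.indicator (hS l)).mul (hgm.comp (measurable_iterate_next (l + 1)))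
  rw [← lintegral_finsetSum _ fun l _ => hmeas l]
  calc _ ≤ ∫⁻ _, ENNReal.ofReal (T + M) ∂(pathLaw lam νH νV κ) := by
        refine lintegral_mono_ae ?_
        filter_upwards [ae_good_iterate hg hg'] with z hz
        exact (sum_truncated_cycles_le hz hT hM n).trans
          (ENNReal.ofReal_le_ofReal (min_le_right _ _))
    _ = _ := by simp

/-- The expected area under the age up to time `T`. -/
lemma integral_area_le (hg : ∀ᵐ z ∂(pathLaw lam νH νV κ), Good z)
    (hg' : ∀ᵐ z ∂(pathLaw lam νH νV νH), Good z)
    (hs : ∀ᵐ z ∂(pathLaw lam νH νV κ), IsSchedule (completionTime z) (generationTime z))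
    (hq : Integrable area (pathLaw lam νH νV νH)) {a : ℝ} (ha : 0 ≤ a)
    (hK : Integrable (fun z => ((completionTime z 0 + a) ^ 2 - a ^ 2) / 2 + area z)
      (pathLaw lam νH νV κ)) {T M : ℝ} (hT : 0 ≤ T) (hM : 0 ≤ M)
    (hpos : 0 < ∫ z, min (firstCycle z) M ∂(pathLaw lam νH νV νH)) :
    ∫ z, (∫ t in (0 : ℝ)..T, jointAge a (z, t)) ∂(pathLaw lam νH νV κ)
      ≤ ∫ z, ‖((completionTime z 0 + a) ^ 2 - a ^ 2) / 2 + area z‖ ∂(pathLaw lam νH νV κ)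
        + (T + M) / (∫ z, min (firstCycle z) M ∂(pathLaw lam νH νV νH))
          * ∫ z, area z ∂(pathLaw lam νH νV νH) := by
  set μ := pathLaw lam νH νV κ with hμ
  set μ' := pathLaw lam νH νV νH with hμ'
  set m := ∫ z, min (firstCycle z) M ∂μ' with hm
  have hint := (integral_swap_jointAge ha hs hT).1
  have hna : 0 ≤ᵐ[μ'] area := by
    filter_upwards [ae_good_iterate hg' hg'] with z hz
    exact area_nonneg (hz 0) (hz 1)
  have hq0 : 0 ≤ ∫ z, area z ∂μ' := integral_nonneg_of_ae hna
  have hmin : ENNReal.ofReal m = ∫⁻ z, ENNReal.ofReal (min (firstCycle z) M) ∂μ' := by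
    refine ofReal_integral_eq_lintegral_ofReal ?_ ?_
    · refine Integrable.of_bound (by fun_prop) M ?_
      filter_upwards [hg'] with z hz
      rw [Real.norm_eq_abs, abs_of_nonneg (le_min hz.firstCycle_pos.le hM)]
      exact min_le_right _ _
    · filter_upwards [hg'] with z hz
      exact le_min hz.firstCycle_pos.le hM
  have hN := tsum_measure_mul_le (κ := κ) hg hg' hT hM
  rw [← hmin, ← ENNReal.le_div_iff_mul_le (Or.inl (by simpa using hpos)) (Or.inl (by simp)),
    ← ENNReal.ofReal_div_of_pos hpos] at hN
  have hS : ∀ l, MeasurableSet {z | cycleStart z (l + 1) ≤ T} := fun l =>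
    measurableSet_le (measurable_cycleStart _) measurable_const
  have hgm : Measurable fun z => ENNReal.ofReal (area z) := measurable_area.ennreal_ofReal
  have hR : 0 ≤ ∫ z, ‖((completionTime z 0 + a) ^ 2 - a ^ 2) / 2 + area z‖ ∂μ
      + (T + M) / m * ∫ z, area z ∂μ' := by
    have : 0 ≤ ∫ z, ‖((completionTime z 0 + a) ^ 2 - a ^ 2) / 2 + area z‖ ∂μ :=
      integral_nonneg fun _ => norm_nonneg _
    positivity
  rw [← ENNReal.ofReal_le_ofReal_iff hR, ofReal_integral_eq_lintegral_ofReal hint (by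
    filter_upwards [hs] with z hz
    refine intervalIntegral.integral_nonneg (μ := volume) hT fun t ht => ?_
    rw [← ageAt_eq_jointAge hz ha]
    exact hz.ageAt_nonneg ha ht.1)]
  calc ∫⁻ z, ENNReal.ofReal (∫ t in (0 : ℝ)..T, jointAge a (z, t)) ∂μ
      ≤ ∫⁻ z, (ENNReal.ofReal ‖((completionTime z 0 + a) ^ 2 - a ^ 2) / 2 + area z‖
        + ∑' l, {z | cycleStart z (l + 1) ≤ T}.indicator (fun _ => (1 : ℝ≥0∞)) z
          * ENNReal.ofReal (area (next^[l + 1] z))) ∂μ := by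
        refine lintegral_mono_ae ?_
        filter_upwards [hs, ae_good_iterate hg hg'] with z hz hz'
        simp only [← ageAt_eq_jointAge hz ha]
        exact (integral_age_le hz' hz ha hT).trans
          (add_le_add (ENNReal.ofReal_le_ofReal (le_abs_self _)) le_rfl)
    _ = ENNReal.ofReal (∫ z, ‖((completionTime z 0 + a) ^ 2 - a ^ 2) / 2 + area z‖ ∂μ)
        + (∑' l, μ {z | cycleStart z (l + 1) ≤ T}) * ENNReal.ofReal (∫ z, area z ∂μ') := by
        have hmeas : ∀ l, Measurable fun z =>
            {z | cycleStart z (l + 1) ≤ T}.indicator (fun _ => (1 : ℝ≥0∞)) z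
              * ENNReal.ofReal (area (next^[l + 1] z)) := fun l =>
          (measurable_const.indicator (hS l)).mul (hgm.comp (measurable_iterate_next (l + 1)))
        rw [lintegral_add_right _ (Measurable.tsum hmeas),
          lintegral_tsum fun l => (hmeas l).aemeasurable,
          ofReal_integral_eq_lintegral_ofReal hK.norm (ae_of_all _ fun _ => norm_nonneg _),
          ofReal_integral_eq_lintegral_ofReal hq hna, ← ENNReal.tsum_mul_right]
        congr 2
        exact funext fun l => lintegral_indicator_mul hg hg' T hgm l
    _ ≤ _ := by
        rw [ENNReal.ofReal_add (integral_nonneg fun _ => norm_nonneg _) (by positivity),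
          ENNReal.ofReal_mul (by positivity)]
        gcongr

lemma tendsto_integral_min (hg' : ∀ᵐ z ∂(pathLaw lam νH νV νH), Good z)
    (hc : Integrable firstCycle (pathLaw lam νH νV νH)) :
    Tendsto (fun M : ℝ => ∫ z, min (firstCycle z) M ∂(pathLaw lam νH νV νH)) atTop
      (𝓝 (∫ z, firstCycle z ∂(pathLaw lam νH νV νH))) := by
  refine tendsto_integral_filter_of_dominated_convergence firstCycle ?_ ?_ hc ?_
  · exact Eventually.of_forall fun M => Measurable.aestronglyMeasurable (by fun_prop)
  · filter_upwards [eventually_ge_atTop 0] with M hM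
    filter_upwards [hg'] with z hz
    rw [Real.norm_eq_abs, abs_of_nonneg (le_min hz.firstCycle_pos.le hM)]
    exact min_le_left _ _
  · refine ae_of_all _ fun z => tendsto_const_nhds.congr' ?_
    filter_upwards [eventually_ge_atTop (firstCycle z)] with M hM
    rw [min_eq_left hM]

/-- Time average of the mean age. -/
lemma tendsto_timeAverage_integral (hg : ∀ᵐ z ∂(pathLaw lam νH νV κ), Good z)
    (hg' : ∀ᵐ z ∂(pathLaw lam νH νV νH), Good z)
    (hc : Integrable firstCycle (pathLaw lam νH νV νH))
    (hq : Integrable area (pathLaw lam νH νV νH)) {a : ℝ} (ha : 0 ≤ a)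
    (hK : Integrable (fun z => ((completionTime z 0 + a) ^ 2 - a ^ 2) / 2 + area z)
      (pathLaw lam νH νV κ)) :
    Tendsto (fun T : ℝ => T⁻¹ * ∫ t in (0 : ℝ)..T,
        (∫ z, jointAge a (z, t) ∂(pathLaw lam νH νV κ))) atTop
      (𝓝 ((∫ z, area z ∂(pathLaw lam νH νV νH))
          / ∫ z, firstCycle z ∂(pathLaw lam νH νV νH))) := by
  have hts := ae_tendsto_timeAverage (κ := κ) hg hg' hc hq ha
  have hs := hts.mono fun z hz => hz.1
  have hm0 := integral_firstCycle_pos hg' hc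
  have hq0 : 0 ≤ ∫ z, area z ∂(pathLaw lam νH νV νH) := by
    refine integral_nonneg_of_ae ?_
    filter_upwards [ae_good_iterate hg' hg'] with z hz
    exact area_nonneg (hz 0) (hz 1)
  set μ := pathLaw lam νH νV κ with hμ
  set q := ∫ z, area z ∂(pathLaw lam νH νV νH) with hqd
  set m := ∫ z, firstCycle z ∂(pathLaw lam νH νV νH) with hmd
  have hc0 : 0 ≤ q / m := by positivity
  set Y : ℝ → Path → ℝ := fun T z => T⁻¹ * ∫ t in (0 : ℝ)..T, jointAge a (z, t) with hY
  have hYint : ∀ T, 0 ≤ T → Integrable (Y T) μ := fun T hT =>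
    (integral_swap_jointAge ha hs hT).1.const_mul _
  have hYeq : ∀ T, 0 ≤ T → ∫ z, Y T z ∂μ
      = T⁻¹ * ∫ t in (0 : ℝ)..T, (∫ z, jointAge a (z, t) ∂μ) := fun T hT => by
    rw [(integral_swap_jointAge ha hs hT).2, ← integral_const_mul]
  have hY0 : ∀ T, 0 ≤ T → ∀ᵐ z ∂μ, 0 ≤ Y T z := fun T hT => by
    filter_upwards [hs] with z hz
    refine mul_nonneg (inv_nonneg.2 hT)
      (intervalIntegral.integral_nonneg (μ := volume) hT fun t ht => ?_)
    rw [← ageAt_eq_jointAge hz ha]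
    exact hz.ageAt_nonneg ha ht.1
  -- Lower bound: cut off at its almost sure limit, the time average is bounded and its mean
  -- converges.
  have hlow : Tendsto (fun T => ∫ z, min (Y T z) (q / m) ∂μ) atTop (𝓝 (∫ _, q / m ∂μ)) := by
    refine tendsto_integral_filter_of_dominated_convergence (fun _ => q / m) ?_ ?_
      (integrable_const _) ?_
    · filter_upwards [eventually_ge_atTop 0] with T hT
      exact (hYint T hT).aestronglyMeasurable.inf aestronglyMeasurable_const
    · filter_upwards [eventually_ge_atTop 0] with T hT
      filter_upwards [hY0 T hT] with z hz
      rw [Real.norm_eq_abs, abs_of_nonneg (le_min hz hc0)]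
      exact min_le_right _ _
    · filter_upwards [hts] with z hz
      have h1 := hz.2.min (tendsto_const_nhds (x := q / m))
      rw [min_self] at h1
      refine h1.congr fun T => ?_
      simp only [hY, ageAt_eq_jointAge hz.1 ha]
  rw [integral_const, probReal_univ, one_smul] at hlow
  refine tendsto_order.2 ⟨fun b hb => ?_, fun b hb => ?_⟩
  · filter_upwards [(tendsto_order.1 hlow).1 b hb, eventually_ge_atTop 0] with T h1 hT
    rw [← hYeq T hT]
    refine h1.trans_le (integral_mono_ae ?_ (hYint T hT) (ae_of_all _ fun z => min_le_left _ _))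
    exact (hYint T hT).inf (integrable_const _)
  -- Upper bound: `M` is fixed first, so large that the truncated mean cycle already gives a ratio
  -- below `b`; then the initial area and the overshoot vanish after division by `T`.
  · have hlimM := tendsto_integral_min hg' hc
    have h1 : Tendsto (fun M : ℝ => q / ∫ z, min (firstCycle z) M ∂(pathLaw lam νH νV νH)) atTop
        (𝓝 (q / m)) := tendsto_const_nhds.div hlimM hm0.ne'
    obtain ⟨M, hM1, hM2, hM3⟩ := (((tendsto_order.1 h1).2 b hb).and
      (((tendsto_order.1 hlimM).1 0 hm0).and (eventually_ge_atTop 0))).exists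
    set mM := ∫ z, min (firstCycle z) M ∂(pathLaw lam νH νV νH) with hmM
    set K := ∫ z, ‖((completionTime z 0 + a) ^ 2 - a ^ 2) / 2 + area z‖ ∂μ with hKd
    have h2 : Tendsto (fun T : ℝ => (K + M / mM * q) * T⁻¹ + q / mM) atTop (𝓝 (q / mM)) := by
      have := (tendsto_inv_atTop_zero.const_mul (K + M / mM * q)).add_const (q / mM)
      rwa [mul_zero, zero_add] at this
    filter_upwards [(tendsto_order.1 h2).2 b hM1, eventually_gt_atTop 0] with T h3 hT
    refine lt_of_le_of_lt ?_ h3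
    have h4 : ∫ z, (∫ t in (0 : ℝ)..T, jointAge a (z, t)) ∂μ ≤ K + (T + M) / mM * q :=
      integral_area_le hg hg' hs hq ha hK hT.le hM3 hM2
    rw [(integral_swap_jointAge ha hs hT.le).2]
    refine (mul_le_mul_of_nonneg_left h4 (inv_nonneg.2 hT.le)).trans (le_of_eq ?_)
    field_simp
    ring

lemma integrable_jointAge (hs : ∀ᵐ z ∂(pathLaw lam νH νV κ),
    IsSchedule (completionTime z) (generationTime z)) {a : ℝ} (ha : 0 ≤ a) {t : ℝ} (ht : 0 ≤ t) :
    Integrable (fun z => jointAge a (z, t)) (pathLaw lam νH νV κ) ∧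
      |∫ z, jointAge a (z, t) ∂(pathLaw lam νH νV κ)| ≤ t + a := by
  have hb : ∀ᵐ z ∂(pathLaw lam νH νV κ), ‖jointAge a (z, t)‖ ≤ t + a := by
    filter_upwards [hs] with z hz
    rw [← ageAt_eq_jointAge hz ha, Real.norm_eq_abs, abs_of_nonneg (hz.ageAt_nonneg ha ht)]
    exact hz.ageAt_le t
  refine ⟨Integrable.of_bound ((measurable_jointAge a).comp
    measurable_prodMk_right).aestronglyMeasurable _ hb, ?_⟩
  have := norm_integral_le_of_norm_le_const hb
  rwa [probReal_univ, mul_one, Real.norm_eq_abs] at this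

lemma limit_eq_of_tendsto_integral_jointAge (hs : ∀ᵐ z ∂(pathLaw lam νH νV κ),
    IsSchedule (completionTime z) (generationTime z)) {a : ℝ} (ha : 0 ≤ a) {L c : ℝ}
    (hc : Tendsto (fun T : ℝ => T⁻¹ * ∫ t in (0 : ℝ)..T,
        (∫ z, jointAge a (z, t) ∂(pathLaw lam νH νV κ))) atTop (𝓝 c))
    (hL : Tendsto (fun t : ℝ => ∫ z, jointAge a (z, t) ∂(pathLaw lam νH νV κ)) atTop (𝓝 L)) :
    L = c := by
  have hm : Measurable fun t : ℝ => ∫ z, jointAge a (z, t) ∂(pathLaw lam νH νV κ) :=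
    ((measurable_jointAge a).stronglyMeasurable.integral_prod_left').measurable
  obtain ⟨T, hT⟩ := eventually_atTop.1 (hL.abs.eventually_lt_const (lt_add_one |L|))
  -- The bound joins two regimes: `|L| + 1` beyond the time from which the limit controls the mean
  -- age, and the deterministic bound `t + a` before it.
  refine tendsto_nhds_unique (tendsto_integral_average hm (B := max (|L| + 1) (T + a))
    (fun t ht => ?_) hL) hc
  rcases le_total T t with h | h
  · exact (hT t h).le.trans (le_max_left _ _)
  · exact ((integrable_jointAge hs ha ht).2.trans (by linarith)).trans (le_max_right _ _)

end Averages

/-! ### From the given random variables to the path space. -/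

section Transfer

variable {Ω : Type*} [MeasurableSpace Ω] {P : Measure Ω}

/-- Every preimage under the constant coordinate is everything or empty, so adjoining it preserves
independence. This accommodates the artificial service of length 0. -/
lemma iIndepFun_of_const {ι : Type*} [IsProbabilityMeasure P] {f : ι → Ω → ℝ} {i₀ : ι} {c : ℝ}
    (hc : ∀ ω, f i₀ ω = c) (h : iIndepFun (fun i : {i // i ≠ i₀} => f i) P) : iIndepFun f P := by
  classical
  rw [iIndepFun_iff_measure_inter_preimage_eq_mul] at h ⊢
  have key : ∀ (T : Finset ι) {B : ι → Set ℝ}, i₀ ∉ T → (∀ i ∈ T, MeasurableSet (B i)) →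
      P (⋂ i ∈ T, f i ⁻¹' B i) = ∏ i ∈ T, P (f i ⁻¹' B i) := by
    intro T B hT hB
    have hne : ∀ i ∈ T, i ≠ i₀ := fun i hi h => hT (h ▸ hi)
    have h1 := h (T.subtype (· ≠ i₀)) (sets := fun i => B i)
      fun i hi => hB i (Finset.mem_subtype.1 hi)
    rw [Finset.prod_subtype_of_mem (fun i => P (f i ⁻¹' B i)) hne] at h1
    rw [← h1]
    congr 1
    ext ω
    simp only [mem_iInter, Finset.mem_subtype, Subtype.forall]
    exact ⟨fun h i _ hi => h i hi, fun h i hi => h i (hne i hi) hi⟩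
  intro S B hB
  by_cases hS : i₀ ∈ S
  · rw [← Finset.insert_erase hS, Finset.set_biInter_insert,
      Finset.prod_insert (Finset.notMem_erase _ _)]
    have h2 := key (S.erase i₀) (B := B) (Finset.notMem_erase _ _)
      fun i hi => hB i (Finset.mem_of_mem_erase hi)
    by_cases hcB : c ∈ B i₀
    · have : f i₀ ⁻¹' B i₀ = univ := eq_univ_of_forall fun ω => by rwa [mem_preimage, hc]
      rw [this, univ_inter, measure_univ, one_mul, h2]
    · have : f i₀ ⁻¹' B i₀ = ∅ := eq_empty_of_forall_notMem fun ω => by rwa [mem_preimage, hc]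
      rw [this, empty_inter, measure_empty, zero_mul]
  · exact key S hS hB

/-- The inputs of the system, with a service of length `0` at time `0`. -/
def inputs (X H : ℕ → Ω → ℝ) (V : ℕ → ℕ → Ω → ℝ) : Idx → Ω → ℝ
  | Sum.inl n => X n
  | Sum.inr (Sum.inl 0) => fun _ => 0
  | Sum.inr (Sum.inl (l + 1)) => H l
  | Sum.inr (Sum.inr p) => V p.1 p.2

/-- Renumbering of the services from `1` on. -/
def renumber : Idx → Idx
  | Sum.inl n => Sum.inl n
  | Sum.inr (Sum.inl l) => Sum.inr (Sum.inl (l - 1))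
  | Sum.inr (Sum.inr p) => Sum.inr (Sum.inr p)

lemma hasLaw_inputs [IsProbabilityMeasure P] {lam : ℝ} {νH νV : Measure ℝ}
    [IsProbabilityMeasure (expMeasure lam)] [IsProbabilityMeasure νH] [IsProbabilityMeasure νV]
    {X H : ℕ → Ω → ℝ} {V : ℕ → ℕ → Ω → ℝ} (hX : ∀ n, HasLaw (X n) (expMeasure lam) P)
    (hH : ∀ l, HasLaw (H l) νH P) (hV : ∀ l j, HasLaw (V l j) νV P)
    (hindep : iIndepFun
      (Sum.elim X (Sum.elim H (fun p : ℕ × ℕ => V p.1 p.2)) : ℕ ⊕ ℕ ⊕ (ℕ × ℕ) → Ω → ℝ) P) :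
    HasLaw (fun ω i => inputs X H V i ω) (pathLaw lam νH νV (Measure.dirac 0)) P := by
  have hlaw : ∀ i, HasLaw (inputs X H V i) (marginal lam νH νV (Measure.dirac 0) i) P := by
    rintro (n | (_ | l) | p)
    · exact hX n
    · exact ⟨measurable_const.aemeasurable, by
        change P.map (fun _ => (0 : ℝ)) = Measure.dirac 0
        rw [Measure.map_const, measure_univ, one_smul]⟩
    · exact hH l
    · exact hV p.1 p.2
  refine iIndepFun.hasLaw_infinitePi hlaw ?_ (aemeasurable_pi_iff.2 fun i => (hlaw i).aemeasurable)
  refine iIndepFun_of_const (i₀ := Sum.inr (Sum.inl 0)) (c := 0) (fun _ => rfl) ?_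
  -- The subtraction `l - 1` identifies services 0 and 1, so injectivity holds only once the
  -- artificial service is removed.
  have hinj : Function.Injective fun i : {i : Idx // i ≠ Sum.inr (Sum.inl 0)} => renumber i := by
    rintro ⟨n | (_ | l) | p, hi⟩ ⟨n' | (_ | l') | p', hi'⟩ h <;>
      first | exact absurd rfl hi | exact absurd rfl hi' | simp_all [renumber]
  have h := hindep.precomp hinj
  convert! h using 1
  funext i
  rcases i with ⟨n | (_ | l) | p, hi⟩
  · rfl
  · exact absurd rfl hi
  · rfl
  · rfl

lemma integral_comp_of_ae_eq {ξ : Ω → Path} {μ : Measure Path} (hξ : HasLaw ξ μ P) {f g : Path → ℝ}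
    (hg : Measurable g) (h : ∀ᵐ z ∂μ, f z = g z) : ∫ ω, f (ξ ω) ∂P = ∫ z, g z ∂μ := by
  rw [← hξ.map_eq] at h ⊢
  rw [integral_map hξ.aemeasurable hg.aestronglyMeasurable]
  exact integral_congr_ae (ae_of_ae_map hξ.aemeasurable h)

lemma integrable_comp_of_ae_eq {ξ : Ω → Path} {μ : Measure Path} (hξ : HasLaw ξ μ P)
    {f g : Path → ℝ} (hg : Integrable g μ) (h : ∀ᵐ z ∂μ, f z = g z) :
    Integrable (fun ω => f (ξ ω)) P := by
  rw [← hξ.map_eq] at h hg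
  exact (hg.comp_aemeasurable hξ.aemeasurable).congr
    ((ae_of_ae_map hξ.aemeasurable h).mono fun _ h => h.symm)

end Transfer

/-! ### Identification of the means with the closed forms. -/

section ClosedForms

variable {lam : ℝ} {νH νV κ : Measure ℝ} [IsProbabilityMeasure (expMeasure lam)]
  [IsProbabilityMeasure νH] [IsProbabilityMeasure νV] [IsProbabilityMeasure κ]

lemma integrable_initial_area (hg : ∀ᵐ z ∂(pathLaw lam νH νV κ), Good z)
    (hc : Integrable (fun z => firstCycle z ^ 2) (pathLaw lam νH νV κ))
    (hc' : Integrable (fun z => firstCycle z ^ 2) (pathLaw lam νH νV νH))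
    (hH : Integrable (fun x => x ^ 2) νH) (a : ℝ) :
    Integrable (fun z => ((completionTime z 0 + a) ^ 2 - a ^ 2) / 2 + area z)
      (pathLaw lam νH νV κ) := by
  have h1 := memLp_services measurable_firstCycle hc
  have h2 : MemLp (fun z => services z 1) 2 (pathLaw lam νH νV κ) :=
    memLp_services (measurable_services _) (integrable_services hH 0)
  have h3 := ((h1.add h2).add (memLp_const a)).integrable_sq
  refine ((h3.sub (integrable_const (a ^ 2))).div_const 2).add (integrable_area hg hc hc' hH) |>.congr
    (ae_of_all _ fun z => ?_)
  simp [completionTime, cycleStart]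

lemma integral_peak_eq_paoi (hlam : 0 < lam) (hH : ∀ᵐ x ∂νH, 0 ≤ x) (hV : ∀ᵐ x ∂νV, 0 ≤ x)
    (hV0 : νV {0} ≠ 1) (h1 : Integrable (fun x => x) νH) (h2 : Integrable (fun x => x) νV) :
    ∫ z, peak z ∂(pathLaw lam νH νV νH) = paoi lam (lst νH) (lst νV) := by
  have hg := ae_good (lam := lam) hH hV hH hV0
  have hw := integral_firstWait (νH := νH) hlam hH hV hV0 hg
  have hc := integrable_firstCycle hlam hH hV hV0 hg h1 h2
  have hd := (hasDerivWithinAt_cycleLST hlam hH hV hV0 h1 h2).derivWithin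
    (uniqueDiffOn_Ici 0 0 self_mem_Ici)
  have e : ∫ x, x ∂νH = -deriv₀ (lst νH) := by rw [deriv₀_lst hH h1, neg_neg]
  rw [integral_peak hg hw.1 hc.1 h1, hw.2, hc.2, deriv₀, hd, e, paoi, meanWaiting]
  ring

lemma mean_area_div_mean_cycle_eq_aoi (hlam : 0 < lam) (hH : ∀ᵐ x ∂νH, 0 ≤ x)
    (hV : ∀ᵐ x ∂νV, 0 ≤ x) (hV0 : νV {0} ≠ 1) (h1 : Integrable (fun x => x ^ 2) νH)
    (h2 : Integrable (fun x => x ^ 2) νV) :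
    (∫ z, area z ∂(pathLaw lam νH νV νH)) / ∫ z, firstCycle z ∂(pathLaw lam νH νV νH)
      = aoi lam (lst νH) (lst νV) := by
  have hg := ae_good (lam := lam) hH hV hH hV0
  have h1' := integrable_of_integrable_sq h1
  have h2' := integrable_of_integrable_sq h2
  have hw := integral_firstWait (νH := νH) hlam hH hV hV0 hg
  have hc := integrable_firstCycle hlam hH hV hV0 hg h1' h2'
  have hc2 := integrable_firstCycle_sq hlam hH hV hV0 hg h1 h2
  have hm := integral_firstCycle_pos hg hc.1
  have e : ∫ x, x ∂νH = -deriv₀ (lst νH) := by rw [deriv₀_lst hH h1', neg_neg]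
  rw [integral_area hg hc2.1 h1, hw.2, hc2.2, e, add_div, mul_div_cancel_left₀ _ hm.ne', hc.2, aoi,
    meanWaiting, div_div, mul_neg, div_neg, neg_div]
  ring

end ClosedForms

lemma peakAge_eq_peak {z : Path} (hz : ∀ l, Good (next^[l] z)) (h0 : services z 0 = 0) (l : ℕ) :
    peakAge (gaps z) (servedTimes z) (vacations z) l = peak (next^[l] z) := by
  have h1 : services (next (next (next^[l] z))) 0 = services z (l + 2) := by
    rw [← Function.iterate_succ_apply' next, ← Function.iterate_succ_apply' next, services_iterate]
  rw [peakAge_eq hz h0, peak, h1, Function.iterate_succ_apply']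

end

end BRS

/-! ### Assembly of the four claims. -/

theorem mainTheorem2 {Ω : Type*} [MeasurableSpace Ω] (P : Measure Ω) [IsProbabilityMeasure P]
    (lam : ℝ) (hlam : 0 < lam)
    (νH νV : Measure ℝ) [IsProbabilityMeasure νH] [IsProbabilityMeasure νV]
    (hνH : ∀ᵐ x ∂νH, 0 ≤ x) (hνV : ∀ᵐ x ∂νV, 0 ≤ x) (hνV0 : νV {0} ≠ 1)
    (X H : ℕ → Ω → ℝ) (V : ℕ → ℕ → Ω → ℝ)
    (hX : ∀ n, HasLaw (X n) (expMeasure lam) P)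
    (hH : ∀ l, HasLaw (H l) νH P)
    (hV : ∀ l j, HasLaw (V l j) νV P)
    (hindep : iIndepFun
      (Sum.elim X (Sum.elim H (fun p : ℕ × ℕ => V p.1 p.2)) : ℕ ⊕ ℕ ⊕ (ℕ × ℕ) → Ω → ℝ) P)
    (a : ℝ) (ha : 0 ≤ a) :
    -- the transform of the regenerative cycle
    (∀ l : ℕ, ∀ s : ℝ, 0 ≤ s →
      ∫ ω, Real.exp (-(s * BRS.cycle (X · ω) (H · ω) (V · · ω) l)) ∂P
        = BRS.cycleLST lam (BRS.lst νH) (BRS.lst νV) s) ∧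
    -- the mean waiting time
    ((∀ l : ℕ, Integrable (fun ω => BRS.waiting (X · ω) (H · ω) (V · · ω) l) P) ∧
      (∀ l : ℕ, 1 ≤ l → ∫ ω, BRS.waiting (X · ω) (H · ω) (V · · ω) l ∂P
        = BRS.meanWaiting lam (BRS.lst νH) (BRS.lst νV))) ∧
    -- the PAoI
    (Integrable (fun x => x) νH → Integrable (fun x => x) νV →
      DifferentiableOn ℝ (BRS.lst νH) (Ici 0) ∧
      DifferentiableOn ℝ (BRS.lst νV) (Ici 0) ∧
      (∀ l : ℕ, Integrable (fun ω => BRS.peakAge (X · ω) (H · ω) (V · · ω) l) P) ∧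
      Tendsto (fun l : ℕ => ∫ ω, BRS.peakAge (X · ω) (H · ω) (V · · ω) l ∂P) atTop
        (𝓝 (BRS.paoi lam (BRS.lst νH) (BRS.lst νV))) ∧
      (∀ᵐ ω ∂P, Tendsto
        (fun k : ℕ => (k : ℝ)⁻¹ *
          ∑ l ∈ Finset.range k, BRS.peakAge (X · ω) (H · ω) (V · · ω) l) atTop
        (𝓝 (BRS.paoi lam (BRS.lst νH) (BRS.lst νV))))) ∧
    -- the AoI
    (Integrable (fun x => x ^ 2) νH → Integrable (fun x => x ^ 2) νV →
      ContDiffOn ℝ 2 (BRS.cycleLST lam (BRS.lst νH) (BRS.lst νV)) (Ici 0) ∧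
      (∀ t : ℝ, 0 ≤ t → Integrable (fun ω => BRS.age a (X · ω) (H · ω) (V · · ω) t) P) ∧
      (∀ᵐ ω ∂P, Tendsto
        (fun T : ℝ => T⁻¹ * ∫ t in (0 : ℝ)..T, BRS.age a (X · ω) (H · ω) (V · · ω) t) atTop
        (𝓝 (BRS.aoi lam (BRS.lst νH) (BRS.lst νV)))) ∧
      Tendsto
        (fun T : ℝ => T⁻¹ * ∫ t in (0 : ℝ)..T,
          (∫ ω, BRS.age a (X · ω) (H · ω) (V · · ω) t ∂P)) atTop
        (𝓝 (BRS.aoi lam (BRS.lst νH) (BRS.lst νV))) ∧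
      (∀ L : ℝ, Tendsto (fun t : ℝ => ∫ ω, BRS.age a (X · ω) (H · ω) (V · · ω) t ∂P) atTop
          (𝓝 L) →
        L = BRS.aoi lam (BRS.lst νH) (BRS.lst νV))) := by
  have : IsProbabilityMeasure (expMeasure lam) := isProbabilityMeasure_expMeasure hlam
  have hδ : ∀ᵐ x ∂(Measure.dirac (0 : ℝ)), 0 ≤ x := by simp [ae_dirac_eq]
  have hg := BRS.ae_good (lam := lam) hνH hνV hδ hνV0
  have hg' := BRS.ae_good (lam := lam) hνH hνV hνH hνV0
  set ξ : Ω → BRS.Path := fun ω i => BRS.inputs X H V i ω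
  have hξ : HasLaw ξ (BRS.pathLaw lam νH νV (Measure.dirac 0)) P :=
    BRS.hasLaw_inputs hX hH hV hindep
  have hgood : ∀ᵐ z ∂(BRS.pathLaw lam νH νV (Measure.dirac 0)),
      (∀ l, BRS.Good (BRS.next^[l] z)) ∧ BRS.services z 0 = 0 := by
    refine (BRS.ae_good_iterate hg hg').and ?_
    have h := BRS.pathLaw_map_apply (lam := lam) (νH := νH) (νV := νV) (κ := Measure.dirac 0)
      (Sum.inr (Sum.inl 0))
    have h0 : ∀ᵐ x ∂(BRS.marginal lam νH νV (Measure.dirac 0) (Sum.inr (Sum.inl 0))), x = 0 := by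
      change ∀ᵐ x ∂(Measure.dirac (0 : ℝ)), x = 0
      simp [ae_dirac_eq]
    rw [← h] at h0
    exact ae_of_ae_map (measurable_pi_apply _).aemeasurable h0
  have hw := BRS.integral_firstWait (νH := νH) hlam hδ hνV hνV0 hg
  have hw' := BRS.integral_firstWait (νH := νH) hlam hνH hνV hνV0 hg'
  refine ⟨fun l s hs => ?_, ⟨fun l => ?_, fun l hl => ?_⟩, fun h1 h2 => ?_, fun h1 h2 => ?_⟩
  -- The cycle after packet `l` is cycle `l + 1` of the path, hence has the `νH`-opened law even for
  -- `l = 0`.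
  · have hm : Measurable fun z => Real.exp (-(s * BRS.firstCycle z)) := by fun_prop
    rw [← BRS.integral_exp_firstCycle hlam hνV hνV0 hg' hs,
      ← BRS.integral_comp_iterate_next hg hg' hm l]
    refine BRS.integral_comp_of_ae_eq hξ (f := fun z => Real.exp (-(s * BRS.cycle (BRS.gaps z)
      (BRS.servedTimes z) (BRS.vacations z) l))) (hm.comp (BRS.measurable_iterate_next _)) ?_
    filter_upwards [hgood] with z hz
    rw [BRS.cycle_eq hz.1 hz.2]
  · have h : Integrable (fun z => BRS.firstWait (BRS.next^[l] z))
        (BRS.pathLaw lam νH νV (Measure.dirac 0)) := by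
      rcases l with _ | l
      · exact hw.1
      · exact BRS.integrable_comp_iterate_next hg hg' hw'.1 l
    exact BRS.integrable_comp_of_ae_eq hξ (f := fun z => BRS.waiting (BRS.gaps z)
      (BRS.servedTimes z) (BRS.vacations z) l) h
      (hgood.mono fun z hz => BRS.waiting_eq hz.1 hz.2 l)
  · obtain ⟨l, rfl⟩ := Nat.exists_eq_add_of_le' hl
    rw [← hw'.2, ← BRS.integral_comp_iterate_next hg hg' BRS.measurable_firstWait l]
    exact BRS.integral_comp_of_ae_eq hξ (f := fun z => BRS.waiting (BRS.gaps z)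
      (BRS.servedTimes z) (BRS.vacations z) (l + 1))
      (BRS.measurable_firstWait.comp (BRS.measurable_iterate_next _))
      (hgood.mono fun z hz => BRS.waiting_eq hz.1 hz.2 (l + 1))
  · have hc' := BRS.integrable_firstCycle hlam hνH hνV hνV0 hg' h1 h2
    have hp := BRS.integrable_peak hg hw.1 hc'.1 h1
    have hp' := BRS.integrable_peak hg' hw'.1 hc'.1 h1
    have hpeak : ∀ l, ∀ᵐ z ∂(BRS.pathLaw lam νH νV (Measure.dirac 0)),
        BRS.peakAge (BRS.gaps z) (BRS.servedTimes z) (BRS.vacations z) l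
          = BRS.peak (BRS.next^[l] z) := fun l =>
      hgood.mono fun z hz => BRS.peakAge_eq_peak hz.1 hz.2 l
    refine ⟨BRS.differentiableOn_lst hνH h1, BRS.differentiableOn_lst hνV h2, fun l => ?_, ?_, ?_⟩
    · refine BRS.integrable_comp_of_ae_eq hξ (f := fun z => BRS.peakAge (BRS.gaps z)
        (BRS.servedTimes z) (BRS.vacations z) l) ?_ (hpeak l)
      rcases l with _ | l
      · exact hp
      · exact BRS.integrable_comp_iterate_next hg hg' hp' l
    -- From the second peak on, the mean is constant in `l`.
    · rw [← tendsto_add_atTop_iff_nat 1]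
      refine tendsto_const_nhds.congr fun l => ?_
      rw [← BRS.integral_peak_eq_paoi hlam hνH hνV hνV0 h1 h2,
        ← BRS.integral_comp_iterate_next hg hg' BRS.measurable_peak l]
      exact (BRS.integral_comp_of_ae_eq hξ (f := fun z => BRS.peakAge (BRS.gaps z)
        (BRS.servedTimes z) (BRS.vacations z) (l + 1))
        (BRS.measurable_peak.comp (BRS.measurable_iterate_next _)) (hpeak (l + 1))).symm
    · have h := (BRS.ae_tendsto_average_peak hg hg' hp').and (ae_all_iff.2 hpeak)
      rw [← hξ.map_eq, BRS.integral_peak_eq_paoi hlam hνH hνV hνV0 h1 h2] at h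
      filter_upwards [ae_of_ae_map hξ.aemeasurable h] with ω hω
      refine hω.1.congr fun k => ?_
      rw [div_eq_inv_mul]
      congr 1
      exact Finset.sum_congr rfl fun l _ => (hω.2 l).symm
  · have hδ2 : Integrable (fun x : ℝ => x ^ 2) (Measure.dirac 0) := by
      exact integrable_dirac (by simp)
    have h1' := BRS.integrable_of_integrable_sq h1
    have h2' := BRS.integrable_of_integrable_sq h2
    have hc' := (BRS.integrable_firstCycle hlam hνH hνV hνV0 hg' h1' h2').1
    have hcs := (BRS.integrable_firstCycle_sq hlam hδ hνV hνV0 hg hδ2 h2).1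
    have hcs' := (BRS.integrable_firstCycle_sq hlam hνH hνV hνV0 hg' h1 h2).1
    have hq := BRS.integrable_area hg' hcs' hcs' h1
    have hK := BRS.integrable_initial_area hg hcs hcs' h1 a
    have haoi := BRS.mean_area_div_mean_cycle_eq_aoi hlam hνH hνV hνV0 h1 h2
    have hts := BRS.ae_tendsto_timeAverage hg hg' hc' hq ha
    have hs := hts.mono fun z hz => hz.1
    have hlim := BRS.tendsto_timeAverage_integral hg hg' hc' hq ha hK
    rw [haoi] at hlim hts
    have hage : ∀ᵐ z ∂(BRS.pathLaw lam νH νV (Measure.dirac 0)), ∀ t,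
        BRS.age a (BRS.gaps z) (BRS.servedTimes z) (BRS.vacations z) t
          = BRS.jointAge a (z, t) := by
      filter_upwards [hgood, hs] with z hz hz' t
      rw [BRS.age_eq hz.1 hz.2, BRS.ageAt_eq_jointAge hz' ha]
    have hmean : ∀ t, ∫ ω, BRS.age a (X · ω) (H · ω) (V · · ω) t ∂P
        = ∫ z, BRS.jointAge a (z, t) ∂(BRS.pathLaw lam νH νV (Measure.dirac 0)) := fun t =>
      BRS.integral_comp_of_ae_eq hξ (f := fun z => BRS.age a (BRS.gaps z) (BRS.servedTimes z)
        (BRS.vacations z) t) ((BRS.measurable_jointAge a).comp measurable_prodMk_right)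
        (hage.mono fun z hz => hz t)
    simp only [hmean]
    refine ⟨BRS.contDiffOn_cycleLST hlam hνV hνV0 (BRS.contDiffOn_lst hνH h1)
      (BRS.contDiffOn_lst hνV h2), fun t ht => ?_, ?_, hlim, fun L hL =>
      BRS.limit_eq_of_tendsto_integral_jointAge hs ha hlim hL⟩
    · exact BRS.integrable_comp_of_ae_eq hξ (f := fun z => BRS.age a (BRS.gaps z)
        (BRS.servedTimes z) (BRS.vacations z) t) (BRS.integrable_jointAge hs ha ht).1
        (hage.mono fun z hz => hz t)
    · have h := hts.and hage
      rw [← hξ.map_eq] at h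
      filter_upwards [ae_of_ae_map hξ.aemeasurable h] with ω hω
      refine hω.1.2.congr fun T => ?_
      congr 1
      refine intervalIntegral.integral_congr fun t _ => ?_
      exact (BRS.ageAt_eq_jointAge hω.1.1 ha t).trans (hω.2 t).symm
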